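/- A complex superalgebra is a complex vector space $A=A_0\oplus A_1$ with a bilinear product such that $A_iA_j\subseteq A_{i+j}$ for $i,j\in\mathbb{Z}/2$; it has type $(3,1)$ if $\dim A_0=3$ and $\dim A_1=1$. It is a Jordan superalgebra if for all homogeneous $x,y,z,t$, with parities $|x|,|y|,|z|,|t|$, one has $xy=(-1)^{|x||y|}yx$ and $$((xy)z)t+(-1)^{|y||z|+|y||t|+|z||t|}((xt)z)y+(-1)^{|x||y|+|x||z|+|x||t|+|z||t|}((yt)z)x=(xy)(zt)+(-1)^{|t|(|y|+|z|)}(xt)(yz)+(-1)^{|y||z|}(xz)(yt).$$ Isomorphisms are bijective linear maps that preserve products and parities. Let $\mathrm{Der}(A)=\mathrm{Der}(A)_0\oplus\mathrm{Der}(A)_1$ be the space of superderivations, where $\mathrm{Der}(A)_p$ consists of the linear maps $D$ with $D(A_i)\subseteq A_{i+p}$ and $D(xy)=D(x)y+(-1)^{p|x|}xD(y)$ for homogeneous $x$. A nonzero superalgebra is indecomposable if it is not the direct sum of two nonzero graded ideals. **Theorem.** Up to isomorphism there are exactly 59 complex Jordan superalgebras of type $(3,1)$ with nonzero multiplication, namely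 the pairwise non-isomorphic superalgebras $\mathfrak{J}_1,\dots,\mathfrak{J}_{59}$ below. They are given in a basis $e_1,e_2,e_3$ of the even part and $f$ of the odd part; the products are supercommutative, and products of basis elements that are not determined in this way by the listed ones are zero. The number in parentheses is the orbit dimension, computed as $4^2-\dim\mathrm{Der}(\mathfrak{J}_i)$. The last entry is a decomposition of $\mathfrak{J}_i$ into a direct sum of indecomposable superalgebras (or states that $\mathfrak{J}_i$ is indecomposable), with the following summands. * One even basis element $e$: $U_1$: $e^2=e$; $U_2$: $e^2=0$. * Even basis $e_1,e_2$: $B_1$: $e_1^2=e_1,\ e_1e_2=e_2$; $B_2$: $e_1^2=e_1,\ e_1e_2=\frac12e_2$; $B_3$: $e_1^2=e_2$. * Even basis $e_1,e_2,e_3$: $T_1,\dots,T_{10}$ are the even parts of $\mathfrak{J}_{34},\mathfrak{J}_{37},\mathfrak{J}_{40},\mathfrak{J}_{41},\mathfrak{J}_{42},\mathfrak{J}_{44},\mathfrak{J}_{47},\mathfrak{J}_{50},\mathfrak{J}_{53},\mathfrak{J}_{56}$, in this order. * $S_1^1$: one odd basis element $f$, zero product. Basis $e$ even, $f$ odd: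 $S_1^2$: $e^2=e,\ ef=\frac12f$; $S_2^2$: $e^2=e,\ ef=f$. * Even $e_1,e_2$ and odd $f$: $S_9^3$: $e_1^2=e_1,\ e_1e_2=e_2,\ e_1f=\frac12f$; $S_{10}^3$: $e_1^2=e_1,\ e_1e_2=e_2,\ e_1f=f$; $S_{11}^3$: $e_1^2=e_1,\ e_1e_2=\frac12e_2,\ e_1f=\frac12f$; $S_{12}^3$: $e_1^2=e_1,\ e_1e_2=\frac12e_2,\ e_1f=f$; $S_{13}^3$: $e_1^2=e_1,\ e_2^2=e_2,\ e_1f=\frac12f,\ e_2f=\frac12f$. The list: * $\mathfrak{J}_{1}$ (15): $e_1^2=e_1,\ e_2^2=e_2,\ e_3^2=e_3$; $U_1\oplus U_1\oplus U_1\oplus S_1^1$. * $\mathfrak{J}_{2}$ (14): $e_1^2=e_1,\ e_2^2=e_2,\ e_3^2=e_3,\ e_1f=f$; $S_2^2\oplus U_1\oplus U_1$. * $\mathfrak{J}_{3}$ (14): $e_1^2=e_1,\ e_2^2=e_2,\ e_3^2=e_3,\ e_1f=\frac{1}{2}f$; $S_1^2\oplus U_1\oplus U_1$. * $\mathfrak{J}_{4}$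 (14): $e_1^2=e_1,\ e_2^2=e_2,\ e_3^2=e_3,\ e_1f=\frac{1}{2}f,\ e_2f=\frac{1}{2}f$; $S_{13}^3\oplus U_1$. * $\mathfrak{J}_{5}$ (12): $e_1^2=e_1,\ e_2^2=e_2$; $U_1\oplus U_1\oplus U_2\oplus S_1^1$. * $\mathfrak{J}_{6}$ (13): $e_1^2=e_1,\ e_2^2=e_2,\ e_1f=f$; $S_2^2\oplus U_1\oplus U_2$. * $\mathfrak{J}_{7}$ (13): $e_1^2=e_1,\ e_2^2=e_2,\ e_1f=\frac{1}{2}f$; $S_1^2\oplus U_1\oplus U_2$. * $\mathfrak{J}_{8}$ (13): $e_1^2=e_1,\ e_2^2=e_2,\ e_1f=\frac{1}{2}f,\ e_2f=\frac{1}{2}f$; $S_{13}^3\oplus U_2$. * $\mathfrak{J}_{9}$ (7): $e_1^2=e_1$; $U_1\oplus U_2\oplus U_2\oplus S_1^1$. * $\mathfrak{J}_{10}$ (10): $e_1^2=e_1,\ e_1f=f$; $S_2^2\oplus U_2\oplus U_2$. * $\mathfrak{J}_{11}$ (10): $e_1^2=e_1,\ e_1f=\frac{1}{2}f$; $S_1^2\oplus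 U_2\oplus U_2$. * $\mathfrak{J}_{12}$ (14): $e_1^2=e_1,\ e_1e_2=e_2,\ e_3^2=e_3$; $B_1\oplus U_1\oplus S_1^1$. * $\mathfrak{J}_{13}$ (13): $e_1^2=e_1,\ e_1e_2=e_2,\ e_3^2=e_3,\ e_3f=f$; $B_1\oplus S_2^2$. * $\mathfrak{J}_{14}$ (13): $e_1^2=e_1,\ e_1e_2=e_2,\ e_3^2=e_3,\ e_3f=\frac{1}{2}f$; $B_1\oplus S_1^2$. * $\mathfrak{J}_{15}$ (12): $e_1^2=e_1,\ e_1e_2=e_2,\ e_3^2=e_3,\ e_1f=f$; $S_{10}^3\oplus U_1$. * $\mathfrak{J}_{16}$ (13): $e_1^2=e_1,\ e_1e_2=e_2,\ e_3^2=e_3,\ e_1f=\frac{1}{2}f$; $S_9^3\oplus U_1$. * $\mathfrak{J}_{17}$ (13): $e_1^2=e_1,\ e_1e_2=e_2,\ e_3^2=e_3,\ e_1f=\frac{1}{2}f,\ e_3f=\frac{1}{2}f$; indecomposable. * $\mathfrak{J}_{18}$ (11): $e_1^2=e_1,\ e_1e_2=e_2$; $B_1\oplus U_2\oplus S_1^1$.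 * $\mathfrak{J}_{19}$ (11): $e_1^2=e_1,\ e_1e_2=e_2,\ e_1f=f$; $S_{10}^3\oplus U_2$. * $\mathfrak{J}_{20}$ (12): $e_1^2=e_1,\ e_1e_2=e_2,\ e_1f=\frac{1}{2}f$; $S_9^3\oplus U_2$. * $\mathfrak{J}_{21}$ (13): $e_1^2=e_1,\ e_1e_2=\frac{1}{2}e_2,\ e_3^2=e_3$; $B_2\oplus U_1\oplus S_1^1$. * $\mathfrak{J}_{22}$ (12): $e_1^2=e_1,\ e_1e_2=\frac{1}{2}e_2,\ e_3^2=e_3,\ e_3f=f$; $B_2\oplus S_2^2$. * $\mathfrak{J}_{23}$ (12): $e_1^2=e_1,\ e_1e_2=\frac{1}{2}e_2,\ e_3^2=e_3,\ e_3f=\frac{1}{2}f$; $B_2\oplus S_1^2$. * $\mathfrak{J}_{24}$ (13): $e_1^2=e_1,\ e_1e_2=\frac{1}{2}e_2,\ e_3^2=e_3,\ e_1f=f$; $S_{12}^3\oplus U_1$. * $\mathfrak{J}_{25}$ (10): $e_1^2=e_1,\ e_1e_2=\frac{1}{2}e_2,\ e_3^2=e_3,\ e_1f=\frac{1}{2}f$;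 $S_{11}^3\oplus U_1$. * $\mathfrak{J}_{26}$ (12): $e_1^2=e_1,\ e_1e_2=\frac{1}{2}e_2,\ e_3^2=e_3,\ e_1f=\frac{1}{2}f,\ e_3f=\frac{1}{2}f$; indecomposable. * $\mathfrak{J}_{27}$ (10): $e_1^2=e_1,\ e_1e_2=\frac{1}{2}e_2$; $B_2\oplus U_2\oplus S_1^1$. * $\mathfrak{J}_{28}$ (12): $e_1^2=e_1,\ e_1e_2=\frac{1}{2}e_2,\ e_1f=f$; $S_{12}^3\oplus U_2$. * $\mathfrak{J}_{29}$ (9): $e_1^2=e_1,\ e_1e_2=\frac{1}{2}e_2,\ e_1f=\frac{1}{2}f$; $S_{11}^3\oplus U_2$. * $\mathfrak{J}_{30}$ (11): $e_1^2=e_2,\ e_3^2=e_3$; $B_3\oplus U_1\oplus S_1^1$. * $\mathfrak{J}_{31}$ (12): $e_1^2=e_2,\ e_3^2=e_3,\ e_3f=f$; $S_2^2\oplus B_3$. * $\mathfrak{J}_{32}$ (12): $e_1^2=e_2,\ e_3^2=e_3,\ e_3f=\frac{1}{2}f$; $S_1^2\oplus B_3$. * $\mathfrak{J}_{33}$ (6):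 $e_1^2=e_2$; $B_3\oplus U_2\oplus S_1^1$. * $\mathfrak{J}_{34}$ (13): $e_1^2=e_1,\ e_1e_2=e_2,\ e_1e_3=e_3,\ e_2^2=e_3$; $T_1\oplus S_1^1$. * $\mathfrak{J}_{35}$ (11): $e_1^2=e_1,\ e_1e_2=e_2,\ e_1e_3=e_3,\ e_2^2=e_3,\ e_1f=f$; indecomposable. * $\mathfrak{J}_{36}$ (12): $e_1^2=e_1,\ e_1e_2=e_2,\ e_1e_3=e_3,\ e_2^2=e_3,\ e_1f=\frac{1}{2}f$; indecomposable. * $\mathfrak{J}_{37}$ (11): $e_1^2=e_1,\ e_1e_2=e_2,\ e_1e_3=e_3$; $T_2\oplus S_1^1$. * $\mathfrak{J}_{38}$ (7): $e_1^2=e_1,\ e_1e_2=e_2,\ e_1e_3=e_3,\ e_1f=f$; indecomposable. * $\mathfrak{J}_{39}$ (10): $e_1^2=e_1,\ e_1e_2=e_2,\ e_1e_3=e_3,\ e_1f=\frac{1}{2}f$; indecomposable. * $\mathfrak{J}_{40}$ (10): $e_1^2=e_2,\ e_1e_2=e_3$; $T_3\oplus S_1^1$. * $\mathfrak{J}_{41}$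 (8): $e_1^2=e_2,\ e_1e_3=e_2$; $T_4\oplus S_1^1$. * $\mathfrak{J}_{42}$ (14): $e_1^2=e_1,\ e_2^2=e_2,\ e_3^2=e_1+e_2,\ e_1e_3=\frac{1}{2}e_3,\ e_2e_3=\frac{1}{2}e_3$; $T_5\oplus S_1^1$. * $\mathfrak{J}_{43}$ (12): $e_1^2=e_1,\ e_2^2=e_2,\ e_3^2=e_1+e_2,\ e_1e_3=\frac{1}{2}e_3,\ e_2e_3=\frac{1}{2}e_3,\ e_1f=\frac{1}{2}f,\ e_2f=\frac{1}{2}f$; indecomposable. * $\mathfrak{J}_{44}$ (12): $e_1^2=e_1,\ e_1e_2=\frac{1}{2}e_2,\ e_1e_3=e_3$; $T_6\oplus S_1^1$. * $\mathfrak{J}_{45}$ (10): $e_1^2=e_1,\ e_1e_2=\frac{1}{2}e_2,\ e_1e_3=e_3,\ e_1f=f$; indecomposable. * $\mathfrak{J}_{46}$ (9): $e_1^2=e_1,\ e_1e_2=\frac{1}{2}e_2,\ e_1e_3=e_3,\ e_1f=\frac{1}{2}f$; indecomposable. * $\mathfrak{J}_{47}$ (9): $e_1^2=e_1,\ e_1e_2=\frac{1}{2}e_2,\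 e_1e_3=\frac{1}{2}e_3$; $T_7\oplus S_1^1$. * $\mathfrak{J}_{48}$ (9): $e_1^2=e_1,\ e_1e_2=\frac{1}{2}e_2,\ e_1e_3=\frac{1}{2}e_3,\ e_1f=f$; indecomposable. * $\mathfrak{J}_{49}$ (4): $e_1^2=e_1,\ e_1e_2=\frac{1}{2}e_2,\ e_1e_3=\frac{1}{2}e_3,\ e_1f=\frac{1}{2}f$; indecomposable. * $\mathfrak{J}_{50}$ (12): $e_1^2=e_1,\ e_1e_2=\frac{1}{2}e_2,\ e_2^2=e_3$; $T_8\oplus S_1^1$. * $\mathfrak{J}_{51}$ (13): $e_1^2=e_1,\ e_1e_2=\frac{1}{2}e_2,\ e_2^2=e_3,\ e_1f=f$; indecomposable. * $\mathfrak{J}_{52}$ (11): $e_1^2=e_1,\ e_1e_2=\frac{1}{2}e_2,\ e_2^2=e_3,\ e_1f=\frac{1}{2}f$; indecomposable. * $\mathfrak{J}_{53}$ (13): $e_1^2=e_1,\ e_1e_2=\frac{1}{2}e_2,\ e_2^2=e_3,\ e_1e_3=e_3$; $T_9\oplus S_1^1$. * $\mathfrak{J}_{54}$ (12): $e_1^2=e_1,\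 e_1e_2=\frac{1}{2}e_2,\ e_2^2=e_3,\ e_1e_3=e_3,\ e_1f=f$; indecomposable. * $\mathfrak{J}_{55}$ (11): $e_1^2=e_1,\ e_1e_2=\frac{1}{2}e_2,\ e_2^2=e_3,\ e_1e_3=e_3,\ e_1f=\frac{1}{2}f$; indecomposable. * $\mathfrak{J}_{56}$ (13): $e_1^2=e_1,\ e_2^2=e_2,\ e_1e_3=\frac{1}{2}e_3,\ e_2e_3=\frac{1}{2}e_3$; $T_{10}\oplus S_1^1$. * $\mathfrak{J}_{57}$ (13): $e_1^2=e_1,\ e_2^2=e_2,\ e_1e_3=\frac{1}{2}e_3,\ e_2e_3=\frac{1}{2}e_3,\ e_1f=f$; indecomposable. * $\mathfrak{J}_{58}$ (12): $e_1^2=e_1,\ e_2^2=e_2,\ e_1e_3=\frac{1}{2}e_3,\ e_2e_3=\frac{1}{2}e_3,\ e_1f=\frac{1}{2}f$; indecomposable. * $\mathfrak{J}_{59}$ (10): $e_1^2=e_1,\ e_2^2=e_2,\ e_1e_3=\frac{1}{2}e_3,\ e_2e_3=\frac{1}{2}e_3,\ e_1f=\frac{1}{2}f,\ e_2f=\frac{1}{2}f$;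 indecomposable. -/

import Mathlib

noncomputable section

/-- A complex superalgebra on the vector space `A`: a bilinear product together with a grading
`A = A₀ ⊕ A₁` by `ℤ/2` such that `Aᵢ Aⱼ ⊆ Aᵢ₊ⱼ`. -/
structure Superalgebra (A : Type*) [AddCommGroup A] [Module ℂ A] where
  mul : A →ₗ[ℂ] A →ₗ[ℂ] A
  grade : ZMod 2 → Submodule ℂ A
  isCompl : IsCompl (grade 0) (grade 1)
  mul_mem : ∀ (i j : ZMod 2) (x y : A), x ∈ grade i → y ∈ grade j → mul x y ∈ grade (i + j)

namespace Superalgebra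

/-- The sign `(-1)^i` of a parity `i`. -/
def sign (i : ZMod 2) : ℂ := if i = 0 then 1 else -1

section
variable {A : Type*} [AddCommGroup A] [Module ℂ A]

/-- Jordan superalgebras: the two graded identities, for homogeneous `x`, `y`, `z`, `t` of
parities `a`, `b`, `c`, `d`. -/
structure IsJordan (S : Superalgebra A) : Prop where
  supercomm : ∀ (a b : ZMod 2) (x y : A), x ∈ S.grade a → y ∈ S.grade b →
    S.mul x y = sign (a * b) • S.mul y x
  jordan : ∀ (a b c d : ZMod 2) (x y z t : A),
    x ∈ S.grade a → y ∈ S.grade b → z ∈ S.grade c → t ∈ S.grade d →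
    S.mul (S.mul (S.mul x y) z) t
      + sign (b * c + b * d + c * d) • S.mul (S.mul (S.mul x t) z) y
      + sign (a * b + a * c + a * d + c * d) • S.mul (S.mul (S.mul y t) z) x
    = S.mul (S.mul x y) (S.mul z t)
      + sign (d * (b + c)) • S.mul (S.mul x t) (S.mul y z)
      + sign (b * c) • S.mul (S.mul x z) (S.mul y t)

/-- `S` has type `(m, n)`: its even part has dimension `m`, its odd part has dimension `n`
(used only for positive `m` and `n`). -/
def HasType (S : Superalgebra A) (m n : ℕ) : Prop :=
  Module.finrank ℂ (S.grade 0) = m ∧ Module.finrank ℂ (S.grade 1) = n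

/-- The superderivations of parity `p`: linear maps `D` with `D(Aᵢ) ⊆ Aᵢ₊ₚ` and
`D(xy) = D(x) y + (-1)^(p |x|) x D(y)`. -/
def derivationsOfParity (S : Superalgebra A) (p : ZMod 2) : Submodule ℂ (A →ₗ[ℂ] A) where
  carrier := {D | (∀ (i : ZMod 2) (x : A), x ∈ S.grade i → D x ∈ S.grade (i + p)) ∧
    ∀ (i : ZMod 2) (x y : A), x ∈ S.grade i →
      D (S.mul x y) = S.mul (D x) y + sign (p * i) • S.mul x (D y)}
  zero_mem' := by simp
  add_mem' := by
    rintro D E ⟨hD, hD'⟩ ⟨hE, hE'⟩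
    refine ⟨fun i x hx => Submodule.add_mem _ (hD i x hx) (hE i x hx), fun i x y hx => ?_⟩
    simp only [LinearMap.add_apply, map_add, hD' i x y hx, hE' i x y hx, smul_add]
    abel
  smul_mem' := by
    rintro c D ⟨hD, hD'⟩
    refine ⟨fun i x hx => Submodule.smul_mem _ c (hD i x hx), fun i x y hx => ?_⟩
    simp only [LinearMap.smul_apply, map_smul, hD' i x y hx, smul_add, smul_comm c]

/-- The space `Der(S) = Der(S)₀ + Der(S)₁` of superderivations. -/
def derivations (S : Superalgebra A) : Submodule ℂ (A →ₗ[ℂ] A) :=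
  S.derivationsOfParity 0 ⊔ S.derivationsOfParity 1

/-- `I` is a graded two-sided ideal. -/
def IsGradedIdeal (S : Superalgebra A) (I : Submodule ℂ A) : Prop :=
  (∀ x ∈ I, ∀ y : A, S.mul x y ∈ I ∧ S.mul y x ∈ I) ∧
    I = (I ⊓ S.grade 0) ⊔ (I ⊓ S.grade 1)

/-- `S` is nonzero and is not the direct sum of two nonzero graded ideals. -/
def IsIndecomposable (S : Superalgebra A) : Prop :=
  Nontrivial A ∧ ∀ I K : Submodule ℂ A, S.IsGradedIdeal I → S.IsGradedIdeal K → IsCompl I K →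
    I = ⊥ ∨ K = ⊥

/-- Isomorphism of superalgebras: a linear bijection that preserves products and parities. -/
def IsIsomorphic (S : Superalgebra A) {B : Type*} [AddCommGroup B] [Module ℂ B]
    (T : Superalgebra B) : Prop :=
  ∃ φ : A ≃ₗ[ℂ] B, (∀ x y, φ (S.mul x y) = T.mul (φ x) (φ y)) ∧
    ∀ (i : ZMod 2) (x : A), x ∈ S.grade i ↔ φ x ∈ T.grade i

end

/-- The direct sum of a finite family of superalgebras. -/
def directSum {ι : Type*} {A : ι → Type*} [∀ i, AddCommGroup (A i)] [∀ i, Module ℂ (A i)]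
    (S : ∀ i, Superalgebra (A i)) : Superalgebra (∀ i, A i) where
  mul := LinearMap.mk₂ ℂ (fun x y i => (S i).mul (x i) (y i))
    (by intros; ext; simp) (by intros; ext; simp) (by intros; ext; simp) (by intros; ext; simp)
  grade p := Submodule.pi Set.univ fun i => (S i).grade p
  isCompl := by
    constructor
    · rw [Submodule.disjoint_def]
      intro x h0 h1
      ext i
      exact (Submodule.disjoint_def.1 (S i).isCompl.disjoint) (x i) (h0 i trivial) (h1 i trivial)
    · rw [codisjoint_iff, eq_top_iff]
      intro x _
      have h : ∀ i, ∃ y ∈ (S i).grade 0, ∃ z ∈ (S i).grade 1, y + z = x i := fun i => by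
        rw [← Submodule.mem_sup, (S i).isCompl.sup_eq_top]
        trivial
      choose y hy z hz hyz using h
      exact Submodule.mem_sup.2 ⟨y, fun i _ => hy i, z, fun i _ => hz i, funext hyz⟩
  mul_mem i j x y hx hy k _ := (S k).mul_mem i j _ _ (hx k trivial) (hy k trivial)

/-- Multiplication tables in a basis `e₁, …, eₘ` (even), `f₁, …, fₙ` (odd), numbered from `0` here:
`eᵢ eⱼ = ∑ₖ even i j k • eₖ`, `eᵢ fₚ = fₚ eᵢ = act i • fₚ`, `fₚ f_q = 0`. -/
structure Table (m n : ℕ) where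
  even : Fin m → Fin m → Fin m → ℂ
  act : Fin m → ℂ

/-- The superalgebra with a given multiplication table, in coordinates. -/
def Table.alg {m n : ℕ} (t : Table m n) : Superalgebra ((Fin m → ℂ) × (Fin n → ℂ)) where
  mul := LinearMap.mk₂ ℂ
    (fun x y => (fun k => ∑ i, ∑ j, t.even i j k * (x.1 i * y.1 j),
      (∑ i, t.act i * x.1 i) • y.2 + (∑ i, t.act i * y.1 i) • x.2))
    (by
      intro x x' y
      ext k
      · simp [add_mul, mul_add, Finset.sum_add_distrib]
      · simp [add_mul, mul_add, Finset.sum_add_distrib]; ring)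
    (by
      intro c x y
      ext k
      · simp only [Prod.smul_fst, Pi.smul_apply, smul_eq_mul, Finset.mul_sum]
        exact Finset.sum_congr rfl fun i _ => Finset.sum_congr rfl fun j _ => by ring
      · simp only [Prod.smul_fst, Prod.smul_snd, Pi.smul_apply, Pi.add_apply, smul_eq_mul,
          Finset.mul_sum, mul_add, Finset.sum_mul]
        congr 1 <;> exact Finset.sum_congr rfl fun i _ => by ring)
    (by
      intro x y y'
      ext k
      · simp [mul_add, Finset.sum_add_distrib]
      · simp [add_mul, mul_add, Finset.sum_add_distrib]; ring)
    (by
      intro c x y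
      ext k
      · simp only [Prod.smul_fst, Pi.smul_apply, smul_eq_mul, Finset.mul_sum]
        exact Finset.sum_congr rfl fun i _ => Finset.sum_congr rfl fun j _ => by ring
      · simp only [Prod.smul_fst, Prod.smul_snd, Pi.smul_apply, Pi.add_apply, smul_eq_mul,
          Finset.mul_sum, mul_add, Finset.sum_mul]
        congr 1 <;> exact Finset.sum_congr rfl fun i _ => by ring)
  grade i := if i = 0 then Submodule.prod ⊤ ⊥ else Submodule.prod ⊥ ⊤
  isCompl := by
    simp only [if_true, one_ne_zero, if_false]
    constructor
    · rw [Submodule.disjoint_def]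
      rintro ⟨x, u⟩ h h'
      simp_all
    · rw [codisjoint_iff, eq_top_iff]
      rintro ⟨x, u⟩ -
      exact Submodule.mem_sup.2 ⟨(x, 0), by simp, (0, u), by simp, by simp⟩
  mul_mem := by
    intro i j
    have h01 : ∀ k : ZMod 2, k = 0 ∨ k = 1 := by decide
    have h2 : (1 : ZMod 2) + 1 = 0 := rfl
    rcases h01 i with rfl | rfl <;> rcases h01 j with rfl | rfl <;> rintro ⟨x, u⟩ ⟨y, v⟩ <;>
      simp +contextual [h2, funext_iff]

/-- The structure constants of the single rule `eᵢ eⱼ = eⱼ eᵢ = c • eₖ`; a multiplication is written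
as the sum of its nonzero rules. -/
def rule {m : ℕ} (i j k : Fin m) (c : ℂ) : Fin m → Fin m → Fin m → ℂ :=
  fun a b l => if ((a = i ∧ b = j) ∨ (a = j ∧ b = i)) ∧ l = k then c else 0

/-! Even multiplications on `e₁, e₂, e₃`. -/

def evenUUU : Fin 3 → Fin 3 → Fin 3 → ℂ := rule 0 0 0 1 + rule 1 1 1 1 + rule 2 2 2 1
def evenUUN : Fin 3 → Fin 3 → Fin 3 → ℂ := rule 0 0 0 1 + rule 1 1 1 1
def evenUNN : Fin 3 → Fin 3 → Fin 3 → ℂ := rule 0 0 0 1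
def evenB₁U : Fin 3 → Fin 3 → Fin 3 → ℂ := rule 0 0 0 1 + rule 2 2 2 1 + rule 0 1 1 1
def evenB₁N : Fin 3 → Fin 3 → Fin 3 → ℂ := rule 0 0 0 1 + rule 0 1 1 1
def evenB₂U : Fin 3 → Fin 3 → Fin 3 → ℂ := rule 0 0 0 1 + rule 2 2 2 1 + rule 0 1 1 (1/2)
def evenB₂N : Fin 3 → Fin 3 → Fin 3 → ℂ := rule 0 0 0 1 + rule 0 1 1 (1/2)
def evenB₃U : Fin 3 → Fin 3 → Fin 3 → ℂ := rule 0 0 1 1 + rule 2 2 2 1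
def evenB₃N : Fin 3 → Fin 3 → Fin 3 → ℂ := rule 0 0 1 1
def evenT₁ : Fin 3 → Fin 3 → Fin 3 → ℂ := rule 0 0 0 1 + rule 1 1 2 1 + rule 0 1 1 1 + rule 0 2 2 1
def evenT₂ : Fin 3 → Fin 3 → Fin 3 → ℂ := rule 0 0 0 1 + rule 0 1 1 1 + rule 0 2 2 1
def evenT₃ : Fin 3 → Fin 3 → Fin 3 → ℂ := rule 0 0 1 1 + rule 0 1 2 1
def evenT₄ : Fin 3 → Fin 3 → Fin 3 → ℂ := rule 0 0 1 1 + rule 0 2 1 1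
def evenT₅ : Fin 3 → Fin 3 → Fin 3 → ℂ := rule 0 0 0 1 + rule 1 1 1 1 + rule 2 2 0 1 + rule 2 2 1 1 + rule 0 2 2 (1/2) + rule 1 2 2 (1/2)
def evenT₆ : Fin 3 → Fin 3 → Fin 3 → ℂ := rule 0 0 0 1 + rule 0 1 1 (1/2) + rule 0 2 2 1
def evenT₇ : Fin 3 → Fin 3 → Fin 3 → ℂ := rule 0 0 0 1 + rule 0 1 1 (1/2) + rule 0 2 2 (1/2)
def evenT₈ : Fin 3 → Fin 3 → Fin 3 → ℂ := rule 0 0 0 1 + rule 1 1 2 1 + rule 0 1 1 (1/2)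
def evenT₉ : Fin 3 → Fin 3 → Fin 3 → ℂ := rule 0 0 0 1 + rule 1 1 2 1 + rule 0 1 1 (1/2) + rule 0 2 2 1
def evenT₁₀ : Fin 3 → Fin 3 → Fin 3 → ℂ := rule 0 0 0 1 + rule 1 1 1 1 + rule 0 2 2 (1/2) + rule 1 2 2 (1/2)

/-- A multiplication table together with its type. -/
structure Summand where
  m : ℕ
  n : ℕ
  table : Table m n

/-! Indecomposable summands of dimension at most three. -/

def U₁ : Summand := ⟨1, 0, ⟨rule 0 0 0 1, ![0]⟩⟩
def U₂ : Summand := ⟨1, 0, ⟨0, ![0]⟩⟩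
def B₁ : Summand := ⟨2, 0, ⟨rule 0 0 0 1 + rule 0 1 1 1, ![0, 0]⟩⟩
def B₂ : Summand := ⟨2, 0, ⟨rule 0 0 0 1 + rule 0 1 1 (1/2), ![0, 0]⟩⟩
def B₃ : Summand := ⟨2, 0, ⟨rule 0 0 1 1, ![0, 0]⟩⟩
def T₁ : Summand := ⟨3, 0, ⟨evenT₁, ![0, 0, 0]⟩⟩
def T₂ : Summand := ⟨3, 0, ⟨evenT₂, ![0, 0, 0]⟩⟩
def T₃ : Summand := ⟨3, 0, ⟨evenT₃, ![0, 0, 0]⟩⟩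
def T₄ : Summand := ⟨3, 0, ⟨evenT₄, ![0, 0, 0]⟩⟩
def T₅ : Summand := ⟨3, 0, ⟨evenT₅, ![0, 0, 0]⟩⟩
def T₆ : Summand := ⟨3, 0, ⟨evenT₆, ![0, 0, 0]⟩⟩
def T₇ : Summand := ⟨3, 0, ⟨evenT₇, ![0, 0, 0]⟩⟩
def T₈ : Summand := ⟨3, 0, ⟨evenT₈, ![0, 0, 0]⟩⟩
def T₉ : Summand := ⟨3, 0, ⟨evenT₉, ![0, 0, 0]⟩⟩
def T₁₀ : Summand := ⟨3, 0, ⟨evenT₁₀, ![0, 0, 0]⟩⟩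
def S₁₁ : Summand := ⟨0, 1, ⟨0, ![]⟩⟩
def S₂₁ : Summand := ⟨1, 1, ⟨rule 0 0 0 1, ![1/2]⟩⟩
def S₂₂ : Summand := ⟨1, 1, ⟨rule 0 0 0 1, ![1]⟩⟩
def S₃₉ : Summand := ⟨2, 1, ⟨rule 0 0 0 1 + rule 0 1 1 1, ![1/2, 0]⟩⟩
def S₃₁₀ : Summand := ⟨2, 1, ⟨rule 0 0 0 1 + rule 0 1 1 1, ![1, 0]⟩⟩
def S₃₁₁ : Summand := ⟨2, 1, ⟨rule 0 0 0 1 + rule 0 1 1 (1/2), ![1/2, 0]⟩⟩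
def S₃₁₂ : Summand := ⟨2, 1, ⟨rule 0 0 0 1 + rule 0 1 1 (1/2), ![1, 0]⟩⟩
def S₃₁₃ : Summand := ⟨2, 1, ⟨rule 0 0 0 1 + rule 1 1 1 1, ![1/2, 1/2]⟩⟩

/-- A line of the classification: a multiplication table of type `(3, 1)`, the number
`16 - dim Der`, and the indecomposable summands. -/
structure Row where
  table : Table 3 1
  orbit : ℕ
  summands : List Summand

/-- The line of a decomposable superalgebra, with its summands. -/
def row (even : Fin 3 → Fin 3 → Fin 3 → ℂ) (act : Fin 3 → ℂ) (orbit : ℕ) (l : List Summand) :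
    Row :=
  ⟨⟨even, act⟩, orbit, l⟩

/-- The line of an indecomposable superalgebra, which is its own only summand. -/
def indec (even : Fin 3 → Fin 3 → Fin 3 → ℂ) (act : Fin 3 → ℂ) (orbit : ℕ) : Row :=
  row even act orbit [⟨3, 1, ⟨even, act⟩⟩]

/-- The classification table; line `i` describes the superalgebra numbered `i + 1`. -/
def rows : Fin 59 → Row := ![
  row evenUUU ![0, 0, 0] 15 [U₁, U₁, U₁, S₁₁],
  row evenUUU ![1, 0, 0] 14 [S₂₂, U₁, U₁],
  row evenUUU ![1/2, 0, 0] 14 [S₂₁, U₁, U₁],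
  row evenUUU ![1/2, 1/2, 0] 14 [S₃₁₃, U₁],
  row evenUUN ![0, 0, 0] 12 [U₁, U₁, U₂, S₁₁],
  row evenUUN ![1, 0, 0] 13 [S₂₂, U₁, U₂],
  row evenUUN ![1/2, 0, 0] 13 [S₂₁, U₁, U₂],
  row evenUUN ![1/2, 1/2, 0] 13 [S₃₁₃, U₂],
  row evenUNN ![0, 0, 0] 7 [U₁, U₂, U₂, S₁₁],
  row evenUNN ![1, 0, 0] 10 [S₂₂, U₂, U₂],
  row evenUNN ![1/2, 0, 0] 10 [S₂₁, U₂, U₂],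
  row evenB₁U ![0, 0, 0] 14 [B₁, U₁, S₁₁],
  row evenB₁U ![0, 0, 1] 13 [B₁, S₂₂],
  row evenB₁U ![0, 0, 1/2] 13 [B₁, S₂₁],
  row evenB₁U ![1, 0, 0] 12 [S₃₁₀, U₁],
  row evenB₁U ![1/2, 0, 0] 13 [S₃₉, U₁],
  indec evenB₁U ![1/2, 0, 1/2] 13,
  row evenB₁N ![0, 0, 0] 11 [B₁, U₂, S₁₁],
  row evenB₁N ![1, 0, 0] 11 [S₃₁₀, U₂],
  row evenB₁N ![1/2, 0, 0] 12 [S₃₉, U₂],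
  row evenB₂U ![0, 0, 0] 13 [B₂, U₁, S₁₁],
  row evenB₂U ![0, 0, 1] 12 [B₂, S₂₂],
  row evenB₂U ![0, 0, 1/2] 12 [B₂, S₂₁],
  row evenB₂U ![1, 0, 0] 13 [S₃₁₂, U₁],
  row evenB₂U ![1/2, 0, 0] 10 [S₃₁₁, U₁],
  indec evenB₂U ![1/2, 0, 1/2] 12,
  row evenB₂N ![0, 0, 0] 10 [B₂, U₂, S₁₁],
  row evenB₂N ![1, 0, 0] 12 [S₃₁₂, U₂],
  row evenB₂N ![1/2, 0, 0] 9 [S₃₁₁, U₂],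
  row evenB₃U ![0, 0, 0] 11 [B₃, U₁, S₁₁],
  row evenB₃U ![0, 0, 1] 12 [S₂₂, B₃],
  row evenB₃U ![0, 0, 1/2] 12 [S₂₁, B₃],
  row evenB₃N ![0, 0, 0] 6 [B₃, U₂, S₁₁],
  row evenT₁ ![0, 0, 0] 13 [T₁, S₁₁],
  indec evenT₁ ![1, 0, 0] 11,
  indec evenT₁ ![1/2, 0, 0] 12,
  row evenT₂ ![0, 0, 0] 11 [T₂, S₁₁],
  indec evenT₂ ![1, 0, 0] 7,
  indec evenT₂ ![1/2, 0, 0] 10,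
  row evenT₃ ![0, 0, 0] 10 [T₃, S₁₁],
  row evenT₄ ![0, 0, 0] 8 [T₄, S₁₁],
  row evenT₅ ![0, 0, 0] 14 [T₅, S₁₁],
  indec evenT₅ ![1/2, 1/2, 0] 12,
  row evenT₆ ![0, 0, 0] 12 [T₆, S₁₁],
  indec evenT₆ ![1, 0, 0] 10,
  indec evenT₆ ![1/2, 0, 0] 9,
  row evenT₇ ![0, 0, 0] 9 [T₇, S₁₁],
  indec evenT₇ ![1, 0, 0] 9,
  indec evenT₇ ![1/2, 0, 0] 4,
  row evenT₈ ![0, 0, 0] 12 [T₈, S₁₁],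
  indec evenT₈ ![1, 0, 0] 13,
  indec evenT₈ ![1/2, 0, 0] 11,
  row evenT₉ ![0, 0, 0] 13 [T₉, S₁₁],
  indec evenT₉ ![1, 0, 0] 12,
  indec evenT₉ ![1/2, 0, 0] 11,
  row evenT₁₀ ![0, 0, 0] 13 [T₁₀, S₁₁],
  indec evenT₁₀ ![1, 0, 0] 13,
  indec evenT₁₀ ![1/2, 0, 0] 12,
  indec evenT₁₀ ![1/2, 1/2, 0] 10]

/-- The superalgebra numbered `i + 1`. -/
def classified (i : Fin 59) :
    Superalgebra ((Fin 3 → ℂ) × (Fin 1 → ℂ)) :=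
  (rows i).table.alg

/-- The direct sum of the summands listed in line `i`. -/
def summandSum (i : Fin 59) :=
  directSum fun k : Fin (rows i).summands.length => ((rows i).summands.get k).table.alg

end Superalgebra

end

/-! The odd part is a line ℂf and supercommutativity gives ff = -ff, hence ff = 0. A Jordan
superalgebra of type (3, 1) is therefore a three-dimensional algebra J together with a linear
functional a on J, defined by xf = a(x)f. Sorting the superidentity by the number of odd arguments:
with none it says that J is a Jordan algebra (`IsJordanProduct`); with one it is either trivial or
the cubic condition a((xy)z) + 2a(x)a(y)a(z) = a(xy)a(z) + a(yz)a(x) + a(xz)a(y) (`IsJordanAction`);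
with more, every term contains a product of two odd elements and vanishes. So the pairs (J, a) have
to be classified.

Classification of J (`IsJordanProduct.isListed_or_eq_zero`). Jordan algebras are power associative,
so each element is nilpotent or generates a nonzero idempotent. Without idempotents J is nil, and
either some x has x, x², x³ as a basis, or all cubes vanish and polarization leaves little room.
With an idempotent e that is not a unit, multiplication by e is diagonalizable with eigenvalues 0,
1/2, 1, and the Peirce multiplication rules together with x·x³ = x²·x² settle each pair of
eigenvalues on a complement of ℂe. If e is a unit and there is no other idempotent, then every
element is a scalar plus a nilpotent one.

Classification of a (`IsJordanAction.isRow`). The cubic condition forces a(x) to be 0, 1/2 or 1 on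
idempotents and 0 on elements of square zero. On two orthogonal idempotents the values are both 1/2
or one of them is 0, and on three of them one value is 0. Up to permuting idempotents these values
give the 59 lines. If the product of J is zero, then so is a, hence the whole product.

The remaining claims are finite computations. Twice every structure constant is an integer, so
identities and dimensions are obtained by evaluating integer tables, with fraction-free Gaussian
elimination (`finrank_solutions`, `solutions_le_of_implies`). Superderivations split into four
independent unknowns, each described by a linear system (`finrank_derivations`). Non-isomorphism
follows from the dimension of Der and the radical dimensions of six bilinear forms built from traces
of multiplications and from a (`finrank_radical_eq`, `code_injective`). A decomposition into graded
ideals gives an idempotent of the even centroid; for each summand this centroid consists of scalars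
plus a strictly triangular part, so the idempotent is 0 or 1 (`isIndecomposable_of_isLocal`). -/

noncomputable section

namespace Superalgebra

/-! ### Integer linear systems -/

/-- The entrywise combination `a • r + b • s` of two integer rows, padded by zeros. -/
def rowComb (a b : ℤ) : List ℤ → List ℤ → List ℤ
  | [], s => s.map (b * ·)
  | x :: r, s => (a * x + b * s.headD 0) :: rowComb a b r s.tail

theorem getD_rowComb (a b : ℤ) (r s : List ℤ) (i : ℕ) :
    (rowComb a b r s).getD i 0 = a * r.getD i 0 + b * s.getD i 0 := by
  induction r generalizing s i with
  | nil =>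
    simp only [rowComb, List.getD_eq_getElem?_getD, List.getElem?_map]
    cases s[i]? <;> simp
  | cons x r ih =>
    cases i
    · cases s <;> simp [rowComb]
    · cases s <;> simp only [rowComb, List.getD_cons_succ, ih, List.tail] <;> simp

/-- The linear form with integer coefficients `r`. -/
def rowForm (n : ℕ) (r : List ℤ) : (Fin n → ℂ) →ₗ[ℂ] ℂ :=
  ∑ i : Fin n, (r.getD i 0 : ℂ) • LinearMap.proj i

theorem rowForm_apply {n : ℕ} (r : List ℤ) (x : Fin n → ℂ) :
    rowForm n r x = ∑ i : Fin n, (r.getD i 0 : ℂ) * x i := by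
  simp [rowForm]

theorem rowForm_succ {n : ℕ} (r : List ℤ) (x : Fin (n + 1) → ℂ) :
    rowForm (n + 1) r x = (r.headD 0 : ℂ) * x 0 + rowForm n r.tail (fun i => x i.succ) := by
  rw [rowForm_apply, rowForm_apply, Fin.sum_univ_succ]
  cases r <;> simp

theorem rowForm_rowComb {n : ℕ} (a b : ℤ) (r s : List ℤ) (x : Fin n → ℂ) :
    rowForm n (rowComb a b r s) x = a * rowForm n r x + b * rowForm n s x := by
  simp only [rowForm_apply, getD_rowComb, Finset.mul_sum, ← Finset.sum_add_distrib]
  exact Finset.sum_congr rfl fun i _ => by push_cast; ring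

/-- The solution space of a homogeneous linear system. -/
def solutions (n : ℕ) (M : List (List ℤ)) : Submodule ℂ (Fin n → ℂ) where
  carrier := {x | ∀ r ∈ M, rowForm n r x = 0}
  zero_mem' := by simp
  add_mem' := by
    intro x y hx hy r hr
    rw [map_add, hx r hr, hy r hr, add_zero]
  smul_mem' := by
    intro c x hx r hr
    rw [map_smul, hx r hr, smul_zero]

theorem mem_solutions {n : ℕ} {M : List (List ℤ)} {x : Fin n → ℂ} :
    x ∈ solutions n M ↔ ∀ r ∈ M, rowForm n r x = 0 := Iff.rfl

/-- Elimination of the first variable of the row `s` by means of the row `r`. -/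
def eliminate (r s : List ℤ) : List ℤ := rowComb (-s.headD 0) (r.headD 0) r.tail s.tail

/-- The dimension of the solution space, by Gaussian elimination. -/
def nullity : ℕ → List (List ℤ) → ℕ
  | 0, _ => 0
  | n + 1, M =>
    match M.find? fun r => r.headD 0 ≠ 0 with
    | none => nullity n (M.map List.tail) + 1
    | some r => nullity n (M.map (eliminate r))

/-- Whether the rows `l ∈ N` are combinations of the rows of `M`, by Gaussian elimination. -/
def implies : ℕ → List (List ℤ) → List (List ℤ) → Bool
  | 0, _, _ => true
  | n + 1, M, N =>
    match M.find? fun r => r.headD 0 ≠ 0 with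
    | none => (N.all fun l => l.headD 0 = 0) && implies n (M.map List.tail) (N.map List.tail)
    | some r => implies n (M.map (eliminate r)) (N.map (eliminate r))

theorem solutions_succ_of_none {n : ℕ} {M : List (List ℤ)} (h : ∀ r ∈ M, r.headD 0 = 0)
    (x : Fin (n + 1) → ℂ) :
    x ∈ solutions (n + 1) M ↔ (fun i => x i.succ) ∈ solutions n (M.map List.tail) := by
  simp only [mem_solutions, List.forall_mem_map, rowForm_succ]
  exact forall₂_congr fun r hr => by rw [h r hr]; simp

/-- Elimination is fraction free: a row s becomes r₀s - s₀r. Since the pivot r₀ is nonzero, no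
information is lost as long as the equation of r itself is kept. The pivot row also appears in the
reduced list, where it has become zero. -/
theorem solutions_succ_of_some {n : ℕ} {M : List (List ℤ)} {r : List ℤ} (hr : r ∈ M)
    (h : r.headD 0 ≠ 0) (x : Fin (n + 1) → ℂ) :
    x ∈ solutions (n + 1) M ↔ rowForm (n + 1) r x = 0 ∧
      (fun i => x i.succ) ∈ solutions n (M.map (eliminate r)) := by
  have h' : (r.headD 0 : ℂ) ≠ 0 := by exact_mod_cast h
  simp only [mem_solutions, List.forall_mem_map, eliminate, rowForm_rowComb]
  constructor
  · intro H
    refine ⟨H r hr, fun s hs => ?_⟩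
    have h1 := H r hr
    have h2 := H s hs
    rw [rowForm_succ] at h1 h2
    push_cast
    linear_combination (r.headD 0 : ℂ) * h2 - (s.headD 0 : ℂ) * h1
  · rintro ⟨h1, H⟩ s hs
    have h2 := H s hs
    rw [rowForm_succ] at h1 ⊢
    push_cast at h2
    apply mul_left_cancel₀ h'
    linear_combination h2 + (s.headD 0 : ℂ) * h1

/-- The rows of N are reduced by the pivots of M. A reduced form is the pivot times the original one
modulo the pivot row, so its vanishing on solutions of M can be pulled back. Only this direction is
used. -/
theorem solutions_le_of_implies {n : ℕ} {M N : List (List ℤ)} (h : implies n M N = true) :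
    solutions n M ≤ solutions n N := by
  intro x hx
  induction n generalizing M N with
  | zero => simp [mem_solutions, rowForm_apply]
  | succ n ih =>
    rw [implies] at h
    split at h
    · next hM =>
      have hM' : ∀ r ∈ M, r.headD 0 = 0 := by simpa using hM
      simp only [Bool.and_eq_true, List.all_eq_true, decide_eq_true_eq] at h
      exact (solutions_succ_of_none h.1 x).2 (ih h.2 ((solutions_succ_of_none hM' x).1 hx))
    · next r hM =>
      have hr : r.headD 0 ≠ 0 := by simpa using List.find?_some hM
      have hr' : (r.headD 0 : ℂ) ≠ 0 := by exact_mod_cast hr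
      obtain ⟨h1, h2⟩ := (solutions_succ_of_some (List.mem_of_find?_eq_some hM) hr x).1 hx
      have h3 := ih h h2
      simp only [mem_solutions, List.forall_mem_map, eliminate, rowForm_rowComb] at h3
      intro l hl
      have h4 := h3 l hl
      rw [rowForm_succ] at h1 ⊢
      push_cast at h4
      apply mul_left_cancel₀ hr'
      linear_combination h4 + (l.headD 0 : ℂ) * h1

theorem finrank_solutions (n : ℕ) (M : List (List ℤ)) :
    Module.finrank ℂ (solutions n M) = nullity n M := by
  induction n generalizing M with
  | zero =>
    rw [nullity]
    exact Module.finrank_zero_of_subsingleton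
  | succ n ih =>
    rw [nullity]
    split
    · next hM =>
      have hM' : ∀ r ∈ M, r.headD 0 = 0 := by simpa using hM
      rw [← ih]
      refine (LinearEquiv.finrank_eq (N := ℂ × solutions n (M.map List.tail))
        { toFun := fun (x : solutions (n + 1) M) => (x.1 0, ⟨_, (solutions_succ_of_none hM' _).1 x.2⟩)
          map_add' := fun x y => rfl
          map_smul' := fun c x => rfl
          invFun := fun p => ⟨Fin.cons p.1 p.2.1, (solutions_succ_of_none hM' _).2 p.2.2⟩
          left_inv := fun x => by
            ext i
            refine Fin.cases ?_ (fun j => ?_) i <;> simp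
          right_inv := fun p => by simp }).trans (by simp [add_comm])
    · next r hM =>
      have hr : r.headD 0 ≠ 0 := by simpa using List.find?_some hM
      have hr' : (r.headD 0 : ℂ) ≠ 0 := by exact_mod_cast hr
      have key := solutions_succ_of_some (n := n) (List.mem_of_find?_eq_some hM) hr
      rw [← ih]
      refine LinearEquiv.finrank_eq
        { toFun := fun x => ⟨_, ((key _).1 x.2).2⟩
          map_add' := fun x y => rfl
          map_smul' := fun c x => rfl
          -- The first variable is recovered from the others by solving the pivot equation.
          invFun := fun p =>
            ⟨Fin.cons (-(r.headD 0 : ℂ)⁻¹ * rowForm n r.tail p.1) p.1,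
              (key _).2 ⟨by
              rw [rowForm_succ]
              simp only [Fin.cons_zero, Fin.cons_succ]
              field_simp
              ring, p.2⟩⟩
          left_inv := fun x => by
            have h := ((key _).1 x.2).1
            rw [rowForm_succ] at h
            ext i
            refine Fin.cases ?_ (fun j => ?_) i
            · simp only [Fin.cons_zero]
              field_simp
              linear_combination -h
            · simp
          right_inv := fun p => by simp }

end Superalgebra

end

namespace Superalgebra

set_option linter.unusedSimpArgs false

/-! ### The classification table in integers -/

/-- The integer analogue of `rule`. -/
def intRule {m : ℕ} (i j k : Fin m) (c : ℤ) : Fin m → Fin m → Fin m → ℤ :=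
  fun a b l => if ((a = i ∧ b = j) ∨ (a = j ∧ b = i)) ∧ l = k then c else 0

/-- Multiplication tables with integer entries, which stand for twice the structure constants. -/
structure IntTable (m : ℕ) where
  even : Fin m → Fin m → Fin m → ℤ
  act : Fin m → ℤ

/-- The even structure constants that are half of the given integers. -/
noncomputable def halfEven {m : ℕ} (c : Fin m → Fin m → Fin m → ℤ) : Fin m → Fin m → Fin m → ℂ :=
  fun i j k => (c i j k : ℂ) / 2

/-- The complex vector that is half of an integer vector. -/
noncomputable def halfAct {m : ℕ} (a : Fin m → ℤ) : Fin m → ℂ := fun i => (a i : ℂ) / 2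

/-- The multiplication table given by an integer table. -/
noncomputable def IntTable.half {m : ℕ} (t : IntTable m) (n : ℕ) : Table m n :=
  ⟨halfEven t.even, halfAct t.act⟩

/-- The integer analogue of `Summand`. -/
structure IntSummand where
  m : ℕ
  n : ℕ
  table : IntTable m

/-- The integer analogue of `Row`. -/
structure IntRow where
  table : IntTable 3
  orbit : ℕ
  summands : List IntSummand

/-- The summand given by an integer table. -/
noncomputable def IntSummand.half (s : IntSummand) : Summand := ⟨s.m, s.n, s.table.half s.n⟩

/-- The line given by an integer table. -/
noncomputable def IntRow.half (r : IntRow) : Row :=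
  ⟨r.table.half 1, r.orbit, r.summands.map IntSummand.half⟩

/-- The integer analogue of `row`. -/
def intRow (even : Fin 3 → Fin 3 → Fin 3 → ℤ) (act : Fin 3 → ℤ) (orbit : ℕ)
    (l : List IntSummand) : IntRow :=
  ⟨⟨even, act⟩, orbit, l⟩

/-- The integer analogue of `indec`. -/
def intIndec (even : Fin 3 → Fin 3 → Fin 3 → ℤ) (act : Fin 3 → ℤ) (orbit : ℕ) : IntRow :=
  intRow even act orbit [⟨3, 1, ⟨even, act⟩⟩]

def intEvenUUU : Fin 3 → Fin 3 → Fin 3 → ℤ := intRule 0 0 0 2 + intRule 1 1 1 2 + intRule 2 2 2 2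
def intEvenUUN : Fin 3 → Fin 3 → Fin 3 → ℤ := intRule 0 0 0 2 + intRule 1 1 1 2
def intEvenUNN : Fin 3 → Fin 3 → Fin 3 → ℤ := intRule 0 0 0 2
def intEvenB₁U : Fin 3 → Fin 3 → Fin 3 → ℤ := intRule 0 0 0 2 + intRule 2 2 2 2 + intRule 0 1 1 2
def intEvenB₁N : Fin 3 → Fin 3 → Fin 3 → ℤ := intRule 0 0 0 2 + intRule 0 1 1 2
def intEvenB₂U : Fin 3 → Fin 3 → Fin 3 → ℤ := intRule 0 0 0 2 + intRule 2 2 2 2 + intRule 0 1 1 1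
def intEvenB₂N : Fin 3 → Fin 3 → Fin 3 → ℤ := intRule 0 0 0 2 + intRule 0 1 1 1
def intEvenB₃U : Fin 3 → Fin 3 → Fin 3 → ℤ := intRule 0 0 1 2 + intRule 2 2 2 2
def intEvenB₃N : Fin 3 → Fin 3 → Fin 3 → ℤ := intRule 0 0 1 2
def intEvenT₁ : Fin 3 → Fin 3 → Fin 3 → ℤ := intRule 0 0 0 2 + intRule 1 1 2 2 + intRule 0 1 1 2 + intRule 0 2 2 2
def intEvenT₂ : Fin 3 → Fin 3 → Fin 3 → ℤ := intRule 0 0 0 2 + intRule 0 1 1 2 + intRule 0 2 2 2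
def intEvenT₃ : Fin 3 → Fin 3 → Fin 3 → ℤ := intRule 0 0 1 2 + intRule 0 1 2 2
def intEvenT₄ : Fin 3 → Fin 3 → Fin 3 → ℤ := intRule 0 0 1 2 + intRule 0 2 1 2
def intEvenT₅ : Fin 3 → Fin 3 → Fin 3 → ℤ := intRule 0 0 0 2 + intRule 1 1 1 2 + intRule 2 2 0 2 + intRule 2 2 1 2 + intRule 0 2 2 1 + intRule 1 2 2 1
def intEvenT₆ : Fin 3 → Fin 3 → Fin 3 → ℤ := intRule 0 0 0 2 + intRule 0 1 1 1 + intRule 0 2 2 2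
def intEvenT₇ : Fin 3 → Fin 3 → Fin 3 → ℤ := intRule 0 0 0 2 + intRule 0 1 1 1 + intRule 0 2 2 1
def intEvenT₈ : Fin 3 → Fin 3 → Fin 3 → ℤ := intRule 0 0 0 2 + intRule 1 1 2 2 + intRule 0 1 1 1
def intEvenT₉ : Fin 3 → Fin 3 → Fin 3 → ℤ := intRule 0 0 0 2 + intRule 1 1 2 2 + intRule 0 1 1 1 + intRule 0 2 2 2
def intEvenT₁₀ : Fin 3 → Fin 3 → Fin 3 → ℤ := intRule 0 0 0 2 + intRule 1 1 1 2 + intRule 0 2 2 1 + intRule 1 2 2 1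

def intU₁ : IntSummand := ⟨1, 0, ⟨intRule 0 0 0 2, ![0]⟩⟩
def intU₂ : IntSummand := ⟨1, 0, ⟨0, ![0]⟩⟩
def intB₁ : IntSummand := ⟨2, 0, ⟨intRule 0 0 0 2 + intRule 0 1 1 2, ![0, 0]⟩⟩
def intB₂ : IntSummand := ⟨2, 0, ⟨intRule 0 0 0 2 + intRule 0 1 1 1, ![0, 0]⟩⟩
def intB₃ : IntSummand := ⟨2, 0, ⟨intRule 0 0 1 2, ![0, 0]⟩⟩
def intT₁ : IntSummand := ⟨3, 0, ⟨intEvenT₁, ![0, 0, 0]⟩⟩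
def intT₂ : IntSummand := ⟨3, 0, ⟨intEvenT₂, ![0, 0, 0]⟩⟩
def intT₃ : IntSummand := ⟨3, 0, ⟨intEvenT₃, ![0, 0, 0]⟩⟩
def intT₄ : IntSummand := ⟨3, 0, ⟨intEvenT₄, ![0, 0, 0]⟩⟩
def intT₅ : IntSummand := ⟨3, 0, ⟨intEvenT₅, ![0, 0, 0]⟩⟩
def intT₆ : IntSummand := ⟨3, 0, ⟨intEvenT₆, ![0, 0, 0]⟩⟩
def intT₇ : IntSummand := ⟨3, 0, ⟨intEvenT₇, ![0, 0, 0]⟩⟩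
def intT₈ : IntSummand := ⟨3, 0, ⟨intEvenT₈, ![0, 0, 0]⟩⟩
def intT₉ : IntSummand := ⟨3, 0, ⟨intEvenT₉, ![0, 0, 0]⟩⟩
def intT₁₀ : IntSummand := ⟨3, 0, ⟨intEvenT₁₀, ![0, 0, 0]⟩⟩
def intS₁₁ : IntSummand := ⟨0, 1, ⟨0, ![]⟩⟩
def intS₂₁ : IntSummand := ⟨1, 1, ⟨intRule 0 0 0 2, ![1]⟩⟩
def intS₂₂ : IntSummand := ⟨1, 1, ⟨intRule 0 0 0 2, ![2]⟩⟩
def intS₃₉ : IntSummand := ⟨2, 1, ⟨intRule 0 0 0 2 + intRule 0 1 1 2, ![1, 0]⟩⟩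
def intS₃₁₀ : IntSummand := ⟨2, 1, ⟨intRule 0 0 0 2 + intRule 0 1 1 2, ![2, 0]⟩⟩
def intS₃₁₁ : IntSummand := ⟨2, 1, ⟨intRule 0 0 0 2 + intRule 0 1 1 1, ![1, 0]⟩⟩
def intS₃₁₂ : IntSummand := ⟨2, 1, ⟨intRule 0 0 0 2 + intRule 0 1 1 1, ![2, 0]⟩⟩
def intS₃₁₃ : IntSummand := ⟨2, 1, ⟨intRule 0 0 0 2 + intRule 1 1 1 2, ![1, 1]⟩⟩

/-- The classification table with doubled structure constants. -/
def intRows : Fin 59 → IntRow := ![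
  intRow intEvenUUU ![0, 0, 0] 15 [intU₁, intU₁, intU₁, intS₁₁],
  intRow intEvenUUU ![2, 0, 0] 14 [intS₂₂, intU₁, intU₁],
  intRow intEvenUUU ![1, 0, 0] 14 [intS₂₁, intU₁, intU₁],
  intRow intEvenUUU ![1, 1, 0] 14 [intS₃₁₃, intU₁],
  intRow intEvenUUN ![0, 0, 0] 12 [intU₁, intU₁, intU₂, intS₁₁],
  intRow intEvenUUN ![2, 0, 0] 13 [intS₂₂, intU₁, intU₂],
  intRow intEvenUUN ![1, 0, 0] 13 [intS₂₁, intU₁, intU₂],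
  intRow intEvenUUN ![1, 1, 0] 13 [intS₃₁₃, intU₂],
  intRow intEvenUNN ![0, 0, 0] 7 [intU₁, intU₂, intU₂, intS₁₁],
  intRow intEvenUNN ![2, 0, 0] 10 [intS₂₂, intU₂, intU₂],
  intRow intEvenUNN ![1, 0, 0] 10 [intS₂₁, intU₂, intU₂],
  intRow intEvenB₁U ![0, 0, 0] 14 [intB₁, intU₁, intS₁₁],
  intRow intEvenB₁U ![0, 0, 2] 13 [intB₁, intS₂₂],
  intRow intEvenB₁U ![0, 0, 1] 13 [intB₁, intS₂₁],
  intRow intEvenB₁U ![2, 0, 0] 12 [intS₃₁₀, intU₁],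
  intRow intEvenB₁U ![1, 0, 0] 13 [intS₃₉, intU₁],
  intIndec intEvenB₁U ![1, 0, 1] 13,
  intRow intEvenB₁N ![0, 0, 0] 11 [intB₁, intU₂, intS₁₁],
  intRow intEvenB₁N ![2, 0, 0] 11 [intS₃₁₀, intU₂],
  intRow intEvenB₁N ![1, 0, 0] 12 [intS₃₉, intU₂],
  intRow intEvenB₂U ![0, 0, 0] 13 [intB₂, intU₁, intS₁₁],
  intRow intEvenB₂U ![0, 0, 2] 12 [intB₂, intS₂₂],
  intRow intEvenB₂U ![0, 0, 1] 12 [intB₂, intS₂₁],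
  intRow intEvenB₂U ![2, 0, 0] 13 [intS₃₁₂, intU₁],
  intRow intEvenB₂U ![1, 0, 0] 10 [intS₃₁₁, intU₁],
  intIndec intEvenB₂U ![1, 0, 1] 12,
  intRow intEvenB₂N ![0, 0, 0] 10 [intB₂, intU₂, intS₁₁],
  intRow intEvenB₂N ![2, 0, 0] 12 [intS₃₁₂, intU₂],
  intRow intEvenB₂N ![1, 0, 0] 9 [intS₃₁₁, intU₂],
  intRow intEvenB₃U ![0, 0, 0] 11 [intB₃, intU₁, intS₁₁],
  intRow intEvenB₃U ![0, 0, 2] 12 [intS₂₂, intB₃],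
  intRow intEvenB₃U ![0, 0, 1] 12 [intS₂₁, intB₃],
  intRow intEvenB₃N ![0, 0, 0] 6 [intB₃, intU₂, intS₁₁],
  intRow intEvenT₁ ![0, 0, 0] 13 [intT₁, intS₁₁],
  intIndec intEvenT₁ ![2, 0, 0] 11,
  intIndec intEvenT₁ ![1, 0, 0] 12,
  intRow intEvenT₂ ![0, 0, 0] 11 [intT₂, intS₁₁],
  intIndec intEvenT₂ ![2, 0, 0] 7,
  intIndec intEvenT₂ ![1, 0, 0] 10,
  intRow intEvenT₃ ![0, 0, 0] 10 [intT₃, intS₁₁],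
  intRow intEvenT₄ ![0, 0, 0] 8 [intT₄, intS₁₁],
  intRow intEvenT₅ ![0, 0, 0] 14 [intT₅, intS₁₁],
  intIndec intEvenT₅ ![1, 1, 0] 12,
  intRow intEvenT₆ ![0, 0, 0] 12 [intT₆, intS₁₁],
  intIndec intEvenT₆ ![2, 0, 0] 10,
  intIndec intEvenT₆ ![1, 0, 0] 9,
  intRow intEvenT₇ ![0, 0, 0] 9 [intT₇, intS₁₁],
  intIndec intEvenT₇ ![2, 0, 0] 9,
  intIndec intEvenT₇ ![1, 0, 0] 4,
  intRow intEvenT₈ ![0, 0, 0] 12 [intT₈, intS₁₁],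
  intIndec intEvenT₈ ![2, 0, 0] 13,
  intIndec intEvenT₈ ![1, 0, 0] 11,
  intRow intEvenT₉ ![0, 0, 0] 13 [intT₉, intS₁₁],
  intIndec intEvenT₉ ![2, 0, 0] 12,
  intIndec intEvenT₉ ![1, 0, 0] 11,
  intRow intEvenT₁₀ ![0, 0, 0] 13 [intT₁₀, intS₁₁],
  intIndec intEvenT₁₀ ![2, 0, 0] 13,
  intIndec intEvenT₁₀ ![1, 0, 0] 12,
  intIndec intEvenT₁₀ ![1, 1, 0] 10]

/-- Only the constants 1 and 1/2 occur in the tables, so this and the next lemma translate all of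
them. The constant 1/2 is written `2⁻¹` because the translations first normalize with `one_div`. -/
theorem rule_one {m : ℕ} (i j k : Fin m) : rule i j k 1 = halfEven (intRule i j k 2) := by
  ext a b l
  simp only [rule, halfEven, intRule]
  split_ifs <;> norm_num

theorem rule_half {m : ℕ} (i j k : Fin m) : rule i j k 2⁻¹ = halfEven (intRule i j k 1) := by
  ext a b l
  simp only [rule, halfEven, intRule]
  split_ifs <;> norm_num

theorem halfEven_add {m : ℕ} (c d : Fin m → Fin m → Fin m → ℤ) :
    halfEven c + halfEven d = halfEven (c + d) := by
  ext
  simp [halfEven, add_div]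

theorem zero_eq_halfEven {m : ℕ} : (0 : Fin m → Fin m → Fin m → ℂ) = halfEven 0 := by
  ext
  simp [halfEven]

theorem halfAct_empty : (![] : Fin 0 → ℂ) = halfAct ![] := by
  ext i
  exact i.elim0

theorem halfAct_cons {m : ℕ} (x : ℤ) (a : Fin m → ℤ) :
    halfAct (Matrix.vecCons x a) = Matrix.vecCons ((x : ℂ) / 2) (halfAct a) := by
  ext i
  refine Fin.cases ?_ (fun j => ?_) i <;> simp [halfAct]

theorem evenUUU_eq : evenUUU = halfEven intEvenUUU := by
  simp only [one_div, evenUUU, intEvenUUU, rule_one, rule_half, halfEven_add]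

theorem evenUUN_eq : evenUUN = halfEven intEvenUUN := by
  simp only [one_div, evenUUN, intEvenUUN, rule_one, rule_half, halfEven_add]

theorem evenUNN_eq : evenUNN = halfEven intEvenUNN := by
  simp only [one_div, evenUNN, intEvenUNN, rule_one, rule_half, halfEven_add]

theorem evenB₁U_eq : evenB₁U = halfEven intEvenB₁U := by
  simp only [one_div, evenB₁U, intEvenB₁U, rule_one, rule_half, halfEven_add]

theorem evenB₁N_eq : evenB₁N = halfEven intEvenB₁N := by
  simp only [one_div, evenB₁N, intEvenB₁N, rule_one, rule_half, halfEven_add]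

theorem evenB₂U_eq : evenB₂U = halfEven intEvenB₂U := by
  simp only [one_div, evenB₂U, intEvenB₂U, rule_one, rule_half, halfEven_add]

theorem evenB₂N_eq : evenB₂N = halfEven intEvenB₂N := by
  simp only [one_div, evenB₂N, intEvenB₂N, rule_one, rule_half, halfEven_add]

theorem evenB₃U_eq : evenB₃U = halfEven intEvenB₃U := by
  simp only [one_div, evenB₃U, intEvenB₃U, rule_one, rule_half, halfEven_add]

theorem evenB₃N_eq : evenB₃N = halfEven intEvenB₃N := by
  simp only [one_div, evenB₃N, intEvenB₃N, rule_one, rule_half, halfEven_add]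

theorem evenT₁_eq : evenT₁ = halfEven intEvenT₁ := by
  simp only [one_div, evenT₁, intEvenT₁, rule_one, rule_half, halfEven_add]

theorem evenT₂_eq : evenT₂ = halfEven intEvenT₂ := by
  simp only [one_div, evenT₂, intEvenT₂, rule_one, rule_half, halfEven_add]

theorem evenT₃_eq : evenT₃ = halfEven intEvenT₃ := by
  simp only [one_div, evenT₃, intEvenT₃, rule_one, rule_half, halfEven_add]

theorem evenT₄_eq : evenT₄ = halfEven intEvenT₄ := by
  simp only [one_div, evenT₄, intEvenT₄, rule_one, rule_half, halfEven_add]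

theorem evenT₅_eq : evenT₅ = halfEven intEvenT₅ := by
  simp only [one_div, evenT₅, intEvenT₅, rule_one, rule_half, halfEven_add]

theorem evenT₆_eq : evenT₆ = halfEven intEvenT₆ := by
  simp only [one_div, evenT₆, intEvenT₆, rule_one, rule_half, halfEven_add]

theorem evenT₇_eq : evenT₇ = halfEven intEvenT₇ := by
  simp only [one_div, evenT₇, intEvenT₇, rule_one, rule_half, halfEven_add]

theorem evenT₈_eq : evenT₈ = halfEven intEvenT₈ := by
  simp only [one_div, evenT₈, intEvenT₈, rule_one, rule_half, halfEven_add]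

theorem evenT₉_eq : evenT₉ = halfEven intEvenT₉ := by
  simp only [one_div, evenT₉, intEvenT₉, rule_one, rule_half, halfEven_add]

theorem evenT₁₀_eq : evenT₁₀ = halfEven intEvenT₁₀ := by
  simp only [one_div, evenT₁₀, intEvenT₁₀, rule_one, rule_half, halfEven_add]

theorem U₁_eq : U₁ = intU₁.half := by
  simp [U₁, intU₁, IntSummand.half, IntTable.half, rule_one, rule_half, halfEven_add,
    zero_eq_halfEven, halfAct_cons, ← halfAct_empty]

theorem U₂_eq : U₂ = intU₂.half := by
  simp [U₂, intU₂, IntSummand.half, IntTable.half, rule_one, rule_half, halfEven_add,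
    zero_eq_halfEven, halfAct_cons, ← halfAct_empty]

theorem B₁_eq : B₁ = intB₁.half := by
  simp [B₁, intB₁, IntSummand.half, IntTable.half, rule_one, rule_half, halfEven_add,
    zero_eq_halfEven, halfAct_cons, ← halfAct_empty]

theorem B₂_eq : B₂ = intB₂.half := by
  simp [B₂, intB₂, IntSummand.half, IntTable.half, rule_one, rule_half, halfEven_add,
    zero_eq_halfEven, halfAct_cons, ← halfAct_empty]

theorem B₃_eq : B₃ = intB₃.half := by
  simp [B₃, intB₃, IntSummand.half, IntTable.half, rule_one, rule_half, halfEven_add,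
    zero_eq_halfEven, halfAct_cons, ← halfAct_empty]

theorem T₁_eq : T₁ = intT₁.half := by
  simp [T₁, intT₁, IntSummand.half, IntTable.half, evenT₁_eq, rule_one, rule_half, halfEven_add,
    zero_eq_halfEven, halfAct_cons, ← halfAct_empty]

theorem T₂_eq : T₂ = intT₂.half := by
  simp [T₂, intT₂, IntSummand.half, IntTable.half, evenT₂_eq, rule_one, rule_half, halfEven_add,
    zero_eq_halfEven, halfAct_cons, ← halfAct_empty]

theorem T₃_eq : T₃ = intT₃.half := by
  simp [T₃, intT₃, IntSummand.half, IntTable.half, evenT₃_eq, rule_one, rule_half, halfEven_add,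
    zero_eq_halfEven, halfAct_cons, ← halfAct_empty]

theorem T₄_eq : T₄ = intT₄.half := by
  simp [T₄, intT₄, IntSummand.half, IntTable.half, evenT₄_eq, rule_one, rule_half, halfEven_add,
    zero_eq_halfEven, halfAct_cons, ← halfAct_empty]

theorem T₅_eq : T₅ = intT₅.half := by
  simp [T₅, intT₅, IntSummand.half, IntTable.half, evenT₅_eq, rule_one, rule_half, halfEven_add,
    zero_eq_halfEven, halfAct_cons, ← halfAct_empty]

theorem T₆_eq : T₆ = intT₆.half := by
  simp [T₆, intT₆, IntSummand.half, IntTable.half, evenT₆_eq, rule_one, rule_half, halfEven_add,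
    zero_eq_halfEven, halfAct_cons, ← halfAct_empty]

theorem T₇_eq : T₇ = intT₇.half := by
  simp [T₇, intT₇, IntSummand.half, IntTable.half, evenT₇_eq, rule_one, rule_half, halfEven_add,
    zero_eq_halfEven, halfAct_cons, ← halfAct_empty]

theorem T₈_eq : T₈ = intT₈.half := by
  simp [T₈, intT₈, IntSummand.half, IntTable.half, evenT₈_eq, rule_one, rule_half, halfEven_add,
    zero_eq_halfEven, halfAct_cons, ← halfAct_empty]

theorem T₉_eq : T₉ = intT₉.half := by
  simp [T₉, intT₉, IntSummand.half, IntTable.half, evenT₉_eq, rule_one, rule_half, halfEven_add,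
    zero_eq_halfEven, halfAct_cons, ← halfAct_empty]

theorem T₁₀_eq : T₁₀ = intT₁₀.half := by
  simp [T₁₀, intT₁₀, IntSummand.half, IntTable.half, evenT₁₀_eq, rule_one, rule_half, halfEven_add,
    zero_eq_halfEven, halfAct_cons, ← halfAct_empty]

theorem S₁₁_eq : S₁₁ = intS₁₁.half := by
  simp [S₁₁, intS₁₁, IntSummand.half, IntTable.half, rule_one, rule_half, halfEven_add,
    zero_eq_halfEven, halfAct_cons, ← halfAct_empty]

theorem S₂₁_eq : S₂₁ = intS₂₁.half := by
  simp [S₂₁, intS₂₁, IntSummand.half, IntTable.half, rule_one, rule_half, halfEven_add,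
    zero_eq_halfEven, halfAct_cons, ← halfAct_empty]

theorem S₂₂_eq : S₂₂ = intS₂₂.half := by
  simp [S₂₂, intS₂₂, IntSummand.half, IntTable.half, rule_one, rule_half, halfEven_add,
    zero_eq_halfEven, halfAct_cons, ← halfAct_empty]

theorem S₃₉_eq : S₃₉ = intS₃₉.half := by
  simp [S₃₉, intS₃₉, IntSummand.half, IntTable.half, rule_one, rule_half, halfEven_add,
    zero_eq_halfEven, halfAct_cons, ← halfAct_empty]

theorem S₃₁₀_eq : S₃₁₀ = intS₃₁₀.half := by
  simp [S₃₁₀, intS₃₁₀, IntSummand.half, IntTable.half, rule_one, rule_half, halfEven_add,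
    zero_eq_halfEven, halfAct_cons, ← halfAct_empty]

theorem S₃₁₁_eq : S₃₁₁ = intS₃₁₁.half := by
  simp [S₃₁₁, intS₃₁₁, IntSummand.half, IntTable.half, rule_one, rule_half, halfEven_add,
    zero_eq_halfEven, halfAct_cons, ← halfAct_empty]

theorem S₃₁₂_eq : S₃₁₂ = intS₃₁₂.half := by
  simp [S₃₁₂, intS₃₁₂, IntSummand.half, IntTable.half, rule_one, rule_half, halfEven_add,
    zero_eq_halfEven, halfAct_cons, ← halfAct_empty]

theorem S₃₁₃_eq : S₃₁₃ = intS₃₁₃.half := by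
  simp [S₃₁₃, intS₃₁₃, IntSummand.half, IntTable.half, rule_one, rule_half, halfEven_add,
    zero_eq_halfEven, halfAct_cons, ← halfAct_empty]

theorem row_eq {e : Fin 3 → Fin 3 → Fin 3 → ℂ} {a : Fin 3 → ℂ} {o : ℕ} {l : List Summand}
    {e' : Fin 3 → Fin 3 → Fin 3 → ℤ} {a' : Fin 3 → ℤ} {l' : List IntSummand}
    (he : e = halfEven e') (ha : a = halfAct a') (hl : l = l'.map IntSummand.half) :
    row e a o l = (intRow e' a' o l').half := by
  subst he ha hl
  rfl

theorem indec_eq {e : Fin 3 → Fin 3 → Fin 3 → ℂ} {a : Fin 3 → ℂ} {o : ℕ}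
    {e' : Fin 3 → Fin 3 → Fin 3 → ℤ} {a' : Fin 3 → ℤ}
    (he : e = halfEven e') (ha : a = halfAct a') :
    indec e a o = (intIndec e' a' o).half := by
  subst he ha
  rfl

theorem rows_eq (i : Fin 59) : rows i = (intRows i).half := by
  fin_cases i <;>
  first
  | refine row_eq ?_ ?_ ?_
    · simp only [evenUUU_eq, evenUUN_eq, evenUNN_eq, evenB₁U_eq, evenB₁N_eq, evenB₂U_eq, evenB₂N_eq, evenB₃U_eq, evenB₃N_eq, evenT₁_eq, evenT₂_eq, evenT₃_eq, evenT₄_eq, evenT₅_eq, evenT₆_eq, evenT₇_eq, evenT₈_eq, evenT₉_eq, evenT₁₀_eq]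
    · simp [halfAct_cons, ← halfAct_empty]
    · simp only [U₁_eq, U₂_eq, B₁_eq, B₂_eq, B₃_eq, T₁_eq, T₂_eq, T₃_eq, T₄_eq, T₅_eq, T₆_eq, T₇_eq, T₈_eq, T₉_eq, T₁₀_eq, S₁₁_eq, S₂₁_eq, S₂₂_eq, S₃₉_eq, S₃₁₀_eq, S₃₁₁_eq, S₃₁₂_eq, S₃₁₃_eq, List.map]
  | refine indec_eq ?_ ?_
    · simp only [evenUUU_eq, evenUUN_eq, evenUNN_eq, evenB₁U_eq, evenB₁N_eq, evenB₂U_eq, evenB₂N_eq, evenB₃U_eq, evenB₃N_eq, evenT₁_eq, evenT₂_eq, evenT₃_eq, evenT₄_eq, evenT₅_eq, evenT₆_eq, evenT₇_eq, evenT₈_eq, evenT₉_eq, evenT₁₀_eq]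
    · simp [halfAct_cons, ← halfAct_empty]

end Superalgebra

namespace Superalgebra

/-! ### Linear systems attached to a table -/

/-- The row with entry `g l k` at the unknown with index `(l, k)`. -/
def matrixRow {m : ℕ} (g : Fin m → Fin m → ℤ) : List ℤ :=
  List.ofFn fun p : Fin (m * m) => g p.divNat p.modNat

/-- All triples of indices. -/
def triples (m : ℕ) : List (Fin m × Fin m × Fin m) :=
  (List.finRange m).flatMap fun i => (List.finRange m).flatMap fun j =>
    (List.finRange m).map fun k => (i, j, k)

namespace IntTable

/-- The equations for the matrix of the even part of an even superderivation. -/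
def derivationRows (t : IntTable 3) : List (List ℤ) :=
  ((triples 3).map fun p => matrixRow fun l k =>
    (if k = p.2.2 then t.even p.1 p.2.1 l else 0) - (if l = p.1 then t.even k p.2.1 p.2.2 else 0)
      - (if l = p.2.1 then t.even p.1 k p.2.2 else 0)) ++
  (List.finRange 3).map fun i => matrixRow fun l k => if l = i then t.act k else 0

/-- The equations for the functional `d` of an odd superderivation with `D e = d e • f`. -/
def oddFunctionalRows (t : IntTable 3) : List (List ℤ) :=
  (List.finRange 3).flatMap fun i => (List.finRange 3).map fun j => List.ofFn fun l =>
    t.even i j l - (if l = i then t.act j else 0) - (if l = j then t.act i else 0)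

/-- The equations for the image of `f` under an odd superderivation. -/
def oddVectorRows (t : IntTable 3) : List (List ℤ) :=
  (List.finRange 3).flatMap fun i => (List.finRange 3).map fun k => List.ofFn fun l =>
    t.even i l k - if l = k then t.act i else 0

/-- The equations for the matrix of an even element of the centroid, preceded by its scalar on the
odd part. -/
def centroidRows {m : ℕ} (t : IntTable m) (n : ℕ) : List (List ℤ) :=
  ((triples m).map fun p => 0 :: matrixRow fun l k =>
    (if k = p.2.2 then t.even p.1 p.2.1 l else 0) - if l = p.1 then t.even k p.2.1 p.2.2 else 0) ++
  if n = 0 then [] else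
    (List.finRange m).map fun i => t.act i :: matrixRow fun l k => if l = i then -t.act k else 0

/-- The equations for a scalar matrix up to terms that increase `ord`, preceded by a scalar on the
odd part. -/
def scalarRows (m n : ℕ) (ord : Fin m → ℕ) : List (List ℤ) :=
  ((List.finRange m).flatMap fun i => (List.finRange m).map fun j => 0 :: matrixRow fun l k =>
    if i = j ∨ ord i < ord j then 0 else if l = i ∧ k = j then 1 else 0) ++
  (((List.finRange m).flatMap fun i => (List.finRange m).map fun j => 0 :: matrixRow fun l k =>
    (if l = i ∧ k = i then 1 else 0) - (if l = j ∧ k = j then 1 else 0)) ++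
  if n = 0 then [] else
    (List.finRange m).map fun i => 1 :: matrixRow fun l k => -if l = i ∧ k = i then 1 else 0)

end IntTable

/-- Whether the even part of the centroid consists of scalars up to terms that increase `ord`. -/
def IntSummand.isLocal (s : IntSummand) (ord : Fin s.m → ℕ) : Bool :=
  implies (s.m * s.m + 1) (s.table.centroidRows s.n) (IntTable.scalarRows s.m s.n ord)

/-- The order `0, 2, 1` on indices. -/
def swapOrd (i : ℕ) : ℕ := if i = 1 then 2 else if i = 2 then 1 else i

/-- The hypotheses of `isIndecomposable_of_isLocal`. The second order is needed for T₄, whose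
centroid contains the map e₃ ↦ e₂ that kills e₁ and e₂; it is strictly triangular only if e₂ comes
last. -/
theorem summands_isLocal : ∀ i : Fin 59, ∀ s ∈ (intRows i).summands, s.n ≤ 1 ∧ 1 ≤ s.m + s.n ∧
    (s.isLocal (fun j => j) ∨ s.isLocal fun j => swapOrd j) := by
  decide +kernel

/-- The matrix of `p • tr(L_x L_y)`-like forms. -/
def IntTable.trace (t : IntTable 3) (i : Fin 3) : ℤ := ∑ j, t.even i j j

/-- The rows of the Gram matrix of the form
`p 0 * τ (x y) + p 1 * τ x * τ y + p 2 * a (x y) + p 3 * a x * a y`, where `τ` is the trace of the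
multiplication on the even part and `a` its action on the odd part. -/
def IntTable.gramRows (t : IntTable 3) (p : Fin 4 → ℤ) : List (List ℤ) :=
  (List.finRange 3).map fun i => List.ofFn fun j =>
    p 0 * (∑ k, t.even i j k * t.trace k) + p 1 * (t.trace i * t.trace j) +
      p 2 * (∑ k, t.even i j k * t.act k) + p 3 * (t.act i * t.act j)

/-- Any coefficients give an isomorphism invariant. These six choices, together with the orbit
dimension, are enough to separate the 59 lines. -/
def forms : Fin 6 → Fin 4 → ℤ :=
  ![![0, 0, 1, 0], ![-3, 1, 0, 2], ![-5, 2, 0, 0], ![0, 0, -1, 1], ![-2, 1, 0, 0], ![-1, 0, 3, -2]]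

/-- Orbit dimension and radical dimensions in one number. -/
def IntRow.code (r : IntRow) : ℕ :=
  ((List.finRange 6).map fun k => nullity 3 (r.table.gramRows (forms k))).foldl (fun c d => 4 * c + d) r.orbit

/-- The radicals live in a three-dimensional space, so their dimensions are digits in base 4 and the
code loses nothing. -/
theorem code_injective : ∀ i j : Fin 59, (intRows i).code = (intRows j).code → i = j := by
  decide +kernel

/-- The terms count, in this order, the matrix of an even superderivation on the even part, its free
scalar on f, and the two independent components of an odd superderivation. -/
theorem orbit_add_nullity : ∀ i : Fin 59, (intRows i).orbit +
    (nullity 9 (intRows i).table.derivationRows + 1 +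
      (nullity 3 (intRows i).table.oddFunctionalRows + nullity 3 (intRows i).table.oddVectorRows))
      = 16 := by
  decide +kernel

end Superalgebra

noncomputable section

namespace Superalgebra

/-! ### Coordinates in the superalgebra of a table -/

section alg
variable {m n : ℕ} (t : Table m n)

theorem alg_mul_fst (x y : (Fin m → ℂ) × (Fin n → ℂ)) (k : Fin m) :
    (t.alg.mul x y).1 k = ∑ i, ∑ j, t.even i j k * (x.1 i * y.1 j) := rfl

theorem alg_mul_snd (x y : (Fin m → ℂ) × (Fin n → ℂ)) :
    (t.alg.mul x y).2 = (∑ i, t.act i * x.1 i) • y.2 + (∑ i, t.act i * y.1 i) • x.2 := rfl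

theorem mem_grade_zero {x : (Fin m → ℂ) × (Fin n → ℂ)} : x ∈ t.alg.grade 0 ↔ x.2 = 0 := by
  simp [Table.alg]

theorem mem_grade_one {x : (Fin m → ℂ) × (Fin n → ℂ)} : x ∈ t.alg.grade 1 ↔ x.1 = 0 := by
  simp [Table.alg]

end alg

theorem zmod_two_cases (i : ZMod 2) : i = 0 ∨ i = 1 := by
  revert i
  decide

theorem sign_zero : sign 0 = 1 := by simp [sign]

theorem sign_one : sign 1 = -1 := by simp [sign]

theorem one_add_one_zmod : (1 : ZMod 2) + 1 = 0 := rfl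

/-! ### Superderivations -/

theorem rowForm_ofFn {n : ℕ} (g : Fin n → ℤ) (x : Fin n → ℂ) :
    rowForm n (List.ofFn g) x = ∑ i, (g i : ℂ) * x i := by
  simp [rowForm_apply, List.getD_eq_getElem?_getD]

theorem rowForm_matrixRow {m : ℕ} (g : Fin m → Fin m → ℤ) (x : Fin (m * m) → ℂ) :
    rowForm (m * m) (matrixRow g) x = ∑ l, ∑ k, (g l k : ℂ) * x (finProdFinEquiv (l, k)) := by
  rw [matrixRow, rowForm_ofFn, ← finProdFinEquiv.sum_comp, Fintype.sum_prod_type]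
  refine Finset.sum_congr rfl fun l _ => Finset.sum_congr rfl fun k _ => ?_
  have h := finProdFinEquiv.symm_apply_apply (l, k)
  rw [finProdFinEquiv_symm_apply, Prod.mk.injEq] at h
  rw [h.1, h.2]

theorem sum_ite_row {m : ℕ} (g : Fin m → ℂ) (y : Fin m → Fin m → ℂ) (i : Fin m) :
    ∑ l, ∑ k, (if l = i then g k else 0) * y l k = ∑ k, g k * y i k := by
  rw [Fintype.sum_eq_single i fun l hl => by simp [hl]]
  simp

theorem sum_ite_col {m : ℕ} (g : Fin m → ℂ) (y : Fin m → Fin m → ℂ) (k : Fin m) :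
    ∑ l, ∑ k', (if k' = k then g l else 0) * y l k' = ∑ l, g l * y l k := by
  simp

/-- The equations for the matrix `X` of an even superderivation, `D eₗ = ∑ₖ X l k • eₖ`. -/
structure Table.IsEvenDerivation (t : Table 3 1) (X : Fin 3 → Fin 3 → ℂ) : Prop where
  even : ∀ i j k, ∑ l, t.even i j l * X l k =
    (∑ l, t.even l j k * X i l) + ∑ l, t.even i l k * X j l
  act : ∀ i, ∑ l, t.act l * X i l = 0

/-- The equations for the functional `d` of an odd superderivation, `D e = d e • f`. -/
def Table.IsOddFunctional (t : Table 3 1) (d : Fin 3 → ℂ) : Prop :=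
  ∀ i j, ∑ l, t.even i j l * d l = t.act j * d i + t.act i * d j

/-- The equations for the image `u` of `f` under an odd superderivation. -/
def Table.IsOddVector (t : Table 3 1) (u : Fin 3 → ℂ) : Prop :=
  ∀ i k, ∑ l, t.even i l k * u l = t.act i * u k

theorem mem_triples {m : ℕ} (p : Fin m × Fin m × Fin m) : p ∈ triples m := by
  simp [triples]

/-- The equations are linear in the structure constants, so the doubled table changes each of them
only by the factor 2. -/
theorem mem_solutions_derivationRows (t : IntTable 3) (x : Fin 9 → ℂ) :
    x ∈ solutions 9 t.derivationRows ↔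
      (t.half 1).IsEvenDerivation fun l k => x (finProdFinEquiv (l, k)) := by
  have key : x ∈ solutions 9 t.derivationRows ↔
      (∀ p : Fin 3 × Fin 3 × Fin 3, rowForm (3 * 3) (matrixRow fun l k =>
        (if k = p.2.2 then t.even p.1 p.2.1 l else 0)
          - (if l = p.1 then t.even k p.2.1 p.2.2 else 0)
          - (if l = p.2.1 then t.even p.1 k p.2.2 else 0)) x = 0) ∧
      ∀ i : Fin 3, rowForm (3 * 3) (matrixRow fun l k => if l = i then t.act k else 0) x = 0 := by
    simp only [mem_solutions, IntTable.derivationRows, List.forall_mem_append, List.forall_mem_map,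
      mem_triples, List.mem_finRange, forall_const, Nat.reduceMul]
  rw [key]
  simp only [rowForm_matrixRow, Prod.forall]
  have h1 : ∀ i j k : Fin 3, ∑ l : Fin 3, ∑ k' : Fin 3, ((((if k' = k then t.even i j l else 0)
      - (if l = i then t.even k' j k else 0) - (if l = j then t.even i k' k else 0) : ℤ)) : ℂ)
        * x (finProdFinEquiv (l, k')) =
      2 * (∑ l, (t.half 1).even i j l * x (finProdFinEquiv (l, k)) -
        ((∑ l, (t.half 1).even l j k * x (finProdFinEquiv (i, l))) +
          ∑ l, (t.half 1).even i l k * x (finProdFinEquiv (j, l)))) := by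
    intro i j k
    push_cast
    simp only [sub_mul, Finset.sum_sub_distrib]
    rw [sum_ite_col (fun l => (t.even i j l : ℂ)) fun l k => x (finProdFinEquiv (l, k)),
      sum_ite_row (fun l => (t.even l j k : ℂ)) fun l k => x (finProdFinEquiv (l, k)),
      sum_ite_row (fun l => (t.even i l k : ℂ)) fun l k => x (finProdFinEquiv (l, k))]
    simp only [IntTable.half, halfEven, div_mul_eq_mul_div, ← Finset.sum_div]
    ring
  have h2 : ∀ i : Fin 3, ∑ l : Fin 3, ∑ k : Fin 3, (((if l = i then t.act k else 0 : ℤ)) : ℂ)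
        * x (finProdFinEquiv (l, k)) =
      2 * ∑ l, (t.half 1).act l * x (finProdFinEquiv (i, l)) := by
    intro i
    push_cast
    rw [sum_ite_row (fun l => (t.act l : ℂ)) fun l k => x (finProdFinEquiv (l, k))]
    simp only [IntTable.half, halfAct, div_mul_eq_mul_div, ← Finset.sum_div]
    ring
  simp only [h1, h2, mul_eq_zero, two_ne_zero, false_or, sub_eq_zero]
  exact ⟨fun h => ⟨h.1, h.2⟩, fun h => ⟨h.1, h.2⟩⟩

theorem mem_solutions_oddFunctionalRows (t : IntTable 3) (d : Fin 3 → ℂ) :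
    d ∈ solutions 3 t.oddFunctionalRows ↔ (t.half 1).IsOddFunctional d := by
  simp only [mem_solutions, IntTable.oddFunctionalRows, List.forall_mem_flatMap,
    List.forall_mem_map, List.mem_finRange, forall_const, rowForm_ofFn, Table.IsOddFunctional]
  refine forall₂_congr fun i j => ?_
  simp only [IntTable.half, halfEven, halfAct]
  push_cast
  simp only [sub_mul, ite_mul, zero_mul, Finset.sum_sub_distrib, Finset.sum_ite_eq',
    Finset.mem_univ, if_true, div_mul_eq_mul_div, ← Finset.sum_div]
  constructor <;> intro h
  · linear_combination h / 2
  · linear_combination 2 * h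

theorem mem_solutions_oddVectorRows (t : IntTable 3) (u : Fin 3 → ℂ) :
    u ∈ solutions 3 t.oddVectorRows ↔ (t.half 1).IsOddVector u := by
  simp only [mem_solutions, IntTable.oddVectorRows, List.forall_mem_flatMap,
    List.forall_mem_map, List.mem_finRange, forall_const, rowForm_ofFn, Table.IsOddVector]
  refine forall₂_congr fun i j => ?_
  simp only [IntTable.half, halfEven, halfAct]
  push_cast
  simp only [sub_mul, ite_mul, zero_mul, Finset.sum_sub_distrib, Finset.sum_ite_eq',
    Finset.mem_univ, if_true, div_mul_eq_mul_div, ← Finset.sum_div]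
  constructor <;> intro h
  · linear_combination h / 2
  · linear_combination 2 * h

/-- The even linear map with matrix `X` on the even part and the scalar `c` on the odd part. -/
def evenMap (X : Fin 3 → Fin 3 → ℂ) (c : ℂ) :
    ((Fin 3 → ℂ) × (Fin 1 → ℂ)) →ₗ[ℂ] ((Fin 3 → ℂ) × (Fin 1 → ℂ)) where
  toFun v := (fun k => ∑ l, v.1 l * X l k, c • v.2)
  map_add' v w := by
    ext
    · simp [add_mul, Finset.sum_add_distrib]
    · simp [mul_add]
  map_smul' a v := by
    ext
    · simp [mul_assoc, Finset.mul_sum]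
    · simp [mul_left_comm]

/-- The odd linear map with `e ↦ d e • f` and `f ↦ u`. -/
def oddMap (d u : Fin 3 → ℂ) :
    ((Fin 3 → ℂ) × (Fin 1 → ℂ)) →ₗ[ℂ] ((Fin 3 → ℂ) × (Fin 1 → ℂ)) where
  toFun v := (v.2 0 • u, fun _ => ∑ l, v.1 l * d l)
  map_add' v w := by
    ext
    · simp [add_mul]
    · simp [add_mul, Finset.sum_add_distrib]
  map_smul' a v := by
    ext
    · simp [mul_assoc]
    · simp [mul_assoc, Finset.mul_sum]

/-- The scalar c is free: in D(xf) = D(x)f + xD(f) the terms c·a(x)f cancel, and a(Dx) = 0 is left,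
which does not involve c. -/
theorem evenMap_mem {t : Table 3 1} {X : Fin 3 → Fin 3 → ℂ} (h : t.IsEvenDerivation X) (c : ℂ) :
    evenMap X c ∈ t.alg.derivationsOfParity 0 := by
  have h1 := h.even
  have h2 := h.act
  simp only [Fin.sum_univ_three] at h1 h2
  refine ⟨fun i x hx => ?_, fun i x y _ => ?_⟩
  · rcases zmod_two_cases i with rfl | rfl
    · simp_all [mem_grade_zero, evenMap]
    · simp_all [mem_grade_one, evenMap, Pi.zero_def]
  · rw [zero_mul, sign_zero, one_smul]
    ext k
    · simp only [evenMap, LinearMap.coe_mk, AddHom.coe_mk, alg_mul_fst, Prod.fst_add, Pi.add_apply,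
        Fin.sum_univ_three]
      linear_combination x.1 0 * y.1 0 * h1 0 0 k + x.1 0 * y.1 1 * h1 0 1 k + x.1 0 * y.1 2 * h1 0 2 k +
        x.1 1 * y.1 0 * h1 1 0 k + x.1 1 * y.1 1 * h1 1 1 k + x.1 1 * y.1 2 * h1 1 2 k +
        x.1 2 * y.1 0 * h1 2 0 k + x.1 2 * y.1 1 * h1 2 1 k + x.1 2 * y.1 2 * h1 2 2 k
    · simp only [evenMap, LinearMap.coe_mk, AddHom.coe_mk, alg_mul_snd, Prod.snd_add, Pi.add_apply,
        Fin.sum_univ_three, Pi.smul_apply, smul_eq_mul]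
      linear_combination -y.2 k * (x.1 0 * h2 0 + x.1 1 * h2 1 + x.1 2 * h2 2) -
        x.2 k * (y.1 0 * h2 0 + y.1 1 * h2 1 + y.1 2 * h2 2)

/-- The conditions on d and u decouple: in D(ef) = D(e)f + eD(f) the first term is a multiple of ff
= 0. Commutativity of the even part is used for D(fe), where u stands on the left of e. -/
theorem oddMap_mem {t : Table 3 1} {d u : Fin 3 → ℂ} (hd : t.IsOddFunctional d)
    (hu : t.IsOddVector u) (hc : ∀ i j k, t.even i j k = t.even j i k) :
    oddMap d u ∈ t.alg.derivationsOfParity 1 := by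
  simp only [Table.IsOddFunctional, Table.IsOddVector, Fin.sum_univ_three] at hd hu
  refine ⟨fun i x hx => ?_, fun i x y hx => ?_⟩
  · rcases zmod_two_cases i with rfl | rfl
    · rw [mem_grade_zero] at hx
      rw [zero_add, mem_grade_one]
      simp [oddMap, hx]
    · rw [mem_grade_one] at hx
      rw [one_add_one_zmod, mem_grade_zero]
      simp [oddMap, hx, Pi.zero_def]
  · rcases zmod_two_cases i with rfl | rfl
    · rw [mem_grade_zero] at hx
      rw [mul_zero, sign_zero, one_smul]
      ext k
      · simp only [oddMap, LinearMap.coe_mk, AddHom.coe_mk, alg_mul_fst, alg_mul_snd, hx,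
          Prod.fst_add, Pi.add_apply, Fin.sum_univ_three, Pi.smul_apply, smul_eq_mul,
          Pi.zero_apply]
        linear_combination -y.2 0 * (x.1 0 * hu 0 k + x.1 1 * hu 1 k + x.1 2 * hu 2 k)
      · simp only [oddMap, LinearMap.coe_mk, AddHom.coe_mk, alg_mul_fst, alg_mul_snd, hx,
          Prod.snd_add, Pi.add_apply, Fin.sum_univ_three, Pi.smul_apply, smul_eq_mul,
          Pi.zero_apply]
        linear_combination x.1 0 * y.1 0 * hd 0 0 + x.1 0 * y.1 1 * hd 0 1 + x.1 0 * y.1 2 * hd 0 2 +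
        x.1 1 * y.1 0 * hd 1 0 + x.1 1 * y.1 1 * hd 1 1 + x.1 1 * y.1 2 * hd 1 2 +
        x.1 2 * y.1 0 * hd 2 0 + x.1 2 * y.1 1 * hd 2 1 + x.1 2 * y.1 2 * hd 2 2
    · rw [mem_grade_one] at hx
      rw [mul_one, sign_one, neg_one_smul]
      ext k
      · simp only [oddMap, LinearMap.coe_mk, AddHom.coe_mk, alg_mul_fst, alg_mul_snd, hx,
          Prod.fst_add, Prod.fst_neg, Pi.add_apply, Pi.neg_apply, Fin.sum_univ_three,
          Pi.smul_apply, smul_eq_mul, Pi.zero_apply]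
        have h0 := hu 0 k
        have h1 := hu 1 k
        have h2 := hu 2 k
        simp only [hc 1 0 k, hc 2 0 k, hc 2 1 k] at h0 h1 h2 ⊢
        linear_combination -x.2 0 * (y.1 0 * h0 + y.1 1 * h1 + y.1 2 * h2)
      -- This component is D(ff) = uf - fu = 0: the two terms cancel because of the sign.
      · have hk : k = 0 := Subsingleton.elim _ _
        subst hk
        simp only [oddMap, LinearMap.coe_mk, AddHom.coe_mk, alg_mul_fst, alg_mul_snd, hx,
          Prod.snd_add, Prod.snd_neg, Pi.add_apply, Pi.neg_apply, Fin.sum_univ_three,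
          Pi.smul_apply, smul_eq_mul, Pi.zero_apply]
        ring

/-- The basis vector `eᵢ`. -/
def evenUnit (i : Fin 3) : (Fin 3 → ℂ) × (Fin 1 → ℂ) := (Pi.single i 1, 0)

/-- The basis vector `f`. -/
def oddUnit : (Fin 3 → ℂ) × (Fin 1 → ℂ) := (0, fun _ => 1)

theorem sum_units (v : (Fin 3 → ℂ) × (Fin 1 → ℂ)) :
    v = (∑ i, v.1 i • evenUnit i) + v.2 0 • oddUnit := by
  ext k
  · fin_cases k <;> simp [evenUnit, oddUnit, Fin.sum_univ_three]
  · have hk : k = 0 := Subsingleton.elim _ _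
    subst hk
    simp [evenUnit, oddUnit, Prod.snd_sum]

theorem mul_evenUnit_evenUnit (t : Table 3 1) (i j : Fin 3) :
    t.alg.mul (evenUnit i) (evenUnit j) = (fun k => t.even i j k, 0) := by
  ext k
  · rw [alg_mul_fst, Fintype.sum_eq_single i fun l hl => by simp [evenUnit, hl],
      Fintype.sum_eq_single j fun l hl => by simp [evenUnit, hl]]
    simp [evenUnit]
  · simp [alg_mul_snd, evenUnit]

theorem mul_evenUnit_oddUnit (t : Table 3 1) (i : Fin 3) :
    t.alg.mul (evenUnit i) oddUnit = (0, fun _ => t.act i) := by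
  ext k
  · simp [alg_mul_fst, oddUnit]
  · simp [alg_mul_snd, evenUnit, oddUnit, Pi.single_apply]

theorem evenUnit_mem (t : Table 3 1) (i : Fin 3) : evenUnit i ∈ t.alg.grade 0 :=
  (mem_grade_zero t).2 rfl

theorem oddUnit_mem (t : Table 3 1) : oddUnit ∈ t.alg.grade 1 := (mem_grade_one t).2 rfl

theorem exists_evenMap {t : Table 3 1} {D : ((Fin 3 → ℂ) × (Fin 1 → ℂ)) →ₗ[ℂ] _}
    (hD : D ∈ t.alg.derivationsOfParity 0) :
    ∃ X c, t.IsEvenDerivation X ∧ evenMap X c = D := by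
  obtain ⟨h1, h2⟩ := hD
  have he : ∀ i, (D (evenUnit i)).2 = 0 := fun i =>
    (mem_grade_zero t).1 (by simpa using h1 0 _ (evenUnit_mem t i))
  have ho : (D oddUnit).1 = 0 := (mem_grade_one t).1 (by simpa using h1 1 _ (oddUnit_mem t))
  have hD : evenMap (fun l => (D (evenUnit l)).1) ((D oddUnit).2 0) = D := by
    refine LinearMap.ext fun v => ?_
    conv_rhs => rw [sum_units v]
    ext k
    · simp [evenMap, ho, Prod.fst_sum]
    · have hk : k = 0 := Subsingleton.elim _ _
      subst hk
      simp [evenMap, he, Prod.snd_sum, mul_comm]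
  refine ⟨fun l => (D (evenUnit l)).1, (D oddUnit).2 0, ⟨fun i j k => ?_, fun i => ?_⟩, hD⟩
  · have h := congrArg (fun v => v.1 k) (h2 0 _ (evenUnit j) (evenUnit_mem t i))
    rw [mul_evenUnit_evenUnit] at h
    conv_lhs at h => rw [← hD]
    simpa [evenMap, alg_mul_fst, sign_zero, evenUnit, Pi.single_apply] using h
  · have h := congrArg (fun v => v.2 0) (h2 0 _ oddUnit (evenUnit_mem t i))
    rw [mul_evenUnit_oddUnit] at h
    conv_lhs at h => rw [← hD]
    simpa [evenMap, alg_mul_snd, sign_zero, evenUnit, oddUnit, Pi.single_apply, mul_comm] using h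

theorem exists_oddMap {t : Table 3 1} {D : ((Fin 3 → ℂ) × (Fin 1 → ℂ)) →ₗ[ℂ] _}
    (hD : D ∈ t.alg.derivationsOfParity 1) :
    ∃ d u, t.IsOddFunctional d ∧ t.IsOddVector u ∧ oddMap d u = D := by
  obtain ⟨h1, h2⟩ := hD
  have he : ∀ i, (D (evenUnit i)).1 = 0 := fun i =>
    (mem_grade_one t).1 (by simpa using h1 0 _ (evenUnit_mem t i))
  have ho : (D oddUnit).2 = 0 :=
    (mem_grade_zero t).1 (by simpa [one_add_one_zmod] using h1 1 _ (oddUnit_mem t))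
  have hD : oddMap (fun l => (D (evenUnit l)).2 0) (D oddUnit).1 = D := by
    refine LinearMap.ext fun v => ?_
    conv_rhs => rw [sum_units v]
    ext k
    · simp [oddMap, he, Prod.fst_sum]
    · have hk : k = 0 := Subsingleton.elim _ _
      subst hk
      simp [oddMap, ho, Prod.snd_sum]
  refine ⟨fun l => (D (evenUnit l)).2 0, (D oddUnit).1, fun i j => ?_, fun i k => ?_, hD⟩
  · have h := congrArg (fun v => v.2 0) (h2 0 _ (evenUnit j) (evenUnit_mem t i))
    rw [mul_evenUnit_evenUnit] at h
    conv_lhs at h => rw [← hD]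
    simpa [oddMap, alg_mul_snd, sign_zero, evenUnit, Pi.single_apply] using h
  · have h := congrArg (fun v => v.1 k) (h2 0 _ oddUnit (evenUnit_mem t i))
    rw [mul_evenUnit_oddUnit] at h
    conv_lhs at h => rw [← hD]
    simpa [oddMap, alg_mul_fst, sign_zero, evenUnit, oddUnit, Pi.single_apply, eq_comm] using h

/-- The even superderivations are parametrized by a matrix and a free scalar, the odd ones by a
functional and a vector. The two parities meet in zero, so the dimensions add up. -/
theorem finrank_derivations (t : IntTable 3) (hc : ∀ i j k, t.even i j k = t.even j i k) :
    Module.finrank ℂ (t.half 1).alg.derivations =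
      nullity 9 t.derivationRows + 1 +
        (nullity 3 t.oddFunctionalRows + nullity 3 t.oddVectorRows) := by
  have hc' : ∀ i j k, (t.half 1).even i j k = (t.half 1).even j i k := fun i j k => by
    simp [IntTable.half, halfEven, hc i j k]
  have h0 : Module.finrank ℂ ((t.half 1).alg.derivationsOfParity 0) =
      Module.finrank ℂ (solutions 9 t.derivationRows × ℂ) := by
    refine (LinearEquiv.finrank_eq (LinearEquiv.ofBijective
      { toFun := fun p : solutions 9 t.derivationRows × ℂ =>
          (⟨evenMap (fun l k => p.1.1 (finProdFinEquiv (l, k))) p.2,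
            evenMap_mem ((mem_solutions_derivationRows t _).1 p.1.2) p.2⟩ :
              (t.half 1).alg.derivationsOfParity 0)
        map_add' := fun p q => ?_
        map_smul' := fun a p => ?_ } ⟨?_, ?_⟩)).symm
    · refine Subtype.ext (LinearMap.ext fun v => ?_)
      ext k
      · simp [evenMap, mul_add, Finset.sum_add_distrib]
      · simp [evenMap, add_mul]
    · refine Subtype.ext (LinearMap.ext fun v => ?_)
      ext k
      · simp [evenMap, Finset.mul_sum, mul_left_comm]
      · simp [evenMap, mul_assoc]
    · intro p q hpq
      have h : ∀ v, evenMap (fun l k => p.1.1 (finProdFinEquiv (l, k))) p.2 v =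
          evenMap (fun l k => q.1.1 (finProdFinEquiv (l, k))) q.2 v := fun v =>
        LinearMap.congr_fun (congrArg Subtype.val hpq) v
      refine Prod.ext (Subtype.ext (funext fun i => ?_)) ?_
      · obtain ⟨⟨l, k⟩, rfl⟩ := (finProdFinEquiv (m := 3) (n := 3)).surjective i
        simpa [evenMap, evenUnit, Pi.single_apply] using congrArg (fun v => v.1 k) (h (evenUnit l))
      · simpa [evenMap, oddUnit] using congrArg (fun v => v.2 0) (h oddUnit)
    · rintro ⟨D, hD⟩
      obtain ⟨X, c, hX, rfl⟩ := exists_evenMap hD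
      have hX' : (fun l k => (fun i : Fin 9 => X ((finProdFinEquiv (m := 3) (n := 3)).symm i).1
          ((finProdFinEquiv (m := 3) (n := 3)).symm i).2) (finProdFinEquiv (l, k))) = X := by
        funext l k
        simp only [Equiv.symm_apply_apply]
      refine ⟨(⟨fun i => X ((finProdFinEquiv (m := 3) (n := 3)).symm i).1
          ((finProdFinEquiv (m := 3) (n := 3)).symm i).2,
        (mem_solutions_derivationRows t _).2 (by rw [hX']; exact hX)⟩, c), Subtype.ext ?_⟩
      change evenMap _ c = evenMap X c
      rw [hX']
  have h1 : Module.finrank ℂ ((t.half 1).alg.derivationsOfParity 1) =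
      Module.finrank ℂ (solutions 3 t.oddFunctionalRows × solutions 3 t.oddVectorRows) := by
    refine (LinearEquiv.finrank_eq (LinearEquiv.ofBijective
      { toFun := fun p : solutions 3 t.oddFunctionalRows × solutions 3 t.oddVectorRows =>
          (⟨oddMap p.1.1 p.2.1, oddMap_mem ((mem_solutions_oddFunctionalRows t _).1 p.1.2)
            ((mem_solutions_oddVectorRows t _).1 p.2.2) hc'⟩ :
              (t.half 1).alg.derivationsOfParity 1)
        map_add' := fun p q => ?_
        map_smul' := fun a p => ?_ } ⟨?_, ?_⟩)).symm
    · refine Subtype.ext (LinearMap.ext fun v => ?_)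
      ext k
      · simp [oddMap, mul_add]
      · simp [oddMap, mul_add, Finset.sum_add_distrib]
    · refine Subtype.ext (LinearMap.ext fun v => ?_)
      ext k
      · simp [oddMap, mul_left_comm]
      · simp [oddMap, Finset.mul_sum, mul_left_comm]
    · intro p q hpq
      have h : ∀ v, oddMap p.1.1 p.2.1 v = oddMap q.1.1 q.2.1 v := fun v =>
        LinearMap.congr_fun (congrArg Subtype.val hpq) v
      refine Prod.ext (Subtype.ext (funext fun l => ?_)) (Subtype.ext (funext fun k => ?_))
      · simpa [oddMap, evenUnit, Pi.single_apply] using congrArg (fun v => v.2 0) (h (evenUnit l))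
      · simpa [oddMap, oddUnit] using congrArg (fun v => v.1 k) (h oddUnit)
    · rintro ⟨D, hD⟩
      obtain ⟨d, u, hd, hu, rfl⟩ := exists_oddMap hD
      exact ⟨(⟨d, (mem_solutions_oddFunctionalRows t d).2 hd⟩,
        ⟨u, (mem_solutions_oddVectorRows t u).2 hu⟩), rfl⟩
  -- Comparing the even and the odd shape of the same map on the basis vectors shows that the matrix
  -- and the scalar vanish.
  have hdisj : (t.half 1).alg.derivationsOfParity 0 ⊓ (t.half 1).alg.derivationsOfParity 1 = ⊥ := by
    rw [eq_bot_iff]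
    rintro D ⟨hD0, hD1⟩
    obtain ⟨X, c, -, rfl⟩ := exists_evenMap hD0
    obtain ⟨d, u, -, -, hdu⟩ := exists_oddMap hD1
    refine LinearMap.ext fun v => ?_
    have h : ∀ v, oddMap d u v = evenMap X c v := LinearMap.congr_fun hdu
    have hX : ∀ l k, X l k = 0 := fun l k => by
      simpa [evenMap, oddMap, evenUnit, Pi.single_apply, eq_comm] using
        congrArg (fun v => v.1 k) (h (evenUnit l))
    have hc0 : c = 0 := by
      simpa [evenMap, oddMap, oddUnit, eq_comm] using congrArg (fun v => v.2 0) (h oddUnit)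
    ext k
    · simp [evenMap, hX]
    · simp [evenMap, hc0]
  have h := Submodule.finrank_sup_add_finrank_inf_eq ((t.half 1).alg.derivationsOfParity 0)
    ((t.half 1).alg.derivationsOfParity 1)
  rw [hdisj, finrank_bot, add_zero, h0, h1, Module.finrank_prod, Module.finrank_prod,
    finrank_solutions, finrank_solutions, finrank_solutions, Module.finrank_self] at h
  exact h

end Superalgebra

end

noncomputable section

namespace Superalgebra

/-! ### Indecomposability -/

/-- A strictly triangular matrix is nilpotent, and a nilpotent idempotent is zero. -/
theorem eq_zero_of_idempotent_of_strict {m : ℕ} {M : Fin m → Fin m → ℂ} {ord : Fin m → ℕ}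
    (hM : ∀ i j, ∑ k, M i k * M k j = M i j) (h0 : ∀ i j, ¬ ord i < ord j → M i j = 0) :
    ∀ i j, M i j = 0 := by
  -- Induction on the distance from i to j: in the expansion of M² a nonzero first factor moves to
  -- an index k of larger order, hence nearer to j.
  have key : ∀ N : ℕ, ∀ i j, ord j ≤ ord i + N → M i j = 0 := by
    intro N
    induction N with
    | zero => exact fun i j h => h0 i j (by omega)
    | succ N ih =>
      intro i j h
      rw [← hM i j]
      refine Finset.sum_eq_zero fun k _ => ?_
      by_cases hk : ord i < ord k
      · rw [ih k j (by omega), mul_zero]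
      · rw [h0 i k hk, zero_mul]
  exact fun i j => key (ord j) i j (by omega)

/-- If the diagonal is 0, then M is a strictly triangular idempotent; if it is 1, then 1 - M is one.
-/
theorem scalar_of_idempotent_of_triangular {m : ℕ} {M : Fin m → Fin m → ℂ} {ord : Fin m → ℕ}
    (hM : ∀ i j, ∑ k, M i k * M k j = M i j) {c : ℂ} (hc : ∀ i, M i i = c)
    (h0 : ∀ i j, i ≠ j → ¬ ord i < ord j → M i j = 0) (hcc : c = 0 ∨ c = 1) :
    ∀ i j, M i j = if i = j then c else 0 := by
  rcases hcc with rfl | rfl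
  · intro i j
    rw [ite_self]
    refine eq_zero_of_idempotent_of_strict hM (ord := ord) (fun i j h => ?_) i j
    by_cases hij : i = j
    · rw [← hij, hc i]
    · exact h0 i j hij h
  · intro i j
    have key := eq_zero_of_idempotent_of_strict (ord := ord)
      (M := fun i j => (if i = j then 1 else 0) - M i j) (fun i j => ?_) (fun i j h => ?_) i j
    · exact (sub_eq_zero.1 key).symm
    · simp only [mul_sub, sub_mul, Finset.sum_sub_distrib, hM]
      simp
    · by_cases hij : i = j
      · simp [← hij, hc i]
      · simp [hij, h0 i j hij h]

theorem diag_of_idempotent_of_triangular {m : ℕ} {M : Fin m → Fin m → ℂ} {ord : Fin m → ℕ}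
    (hM : ∀ i j, ∑ k, M i k * M k j = M i j)
    (h0 : ∀ i j, i ≠ j → ¬ ord i < ord j → M i j = 0) (i : Fin m) : M i i = 0 ∨ M i i = 1 := by
  have h := hM i i
  rw [Fintype.sum_eq_single i] at h
  · rcases eq_or_ne (M i i) 0 with h1 | h1
    · exact Or.inl h1
    · exact Or.inr (mul_left_cancel₀ h1 (by rw [h, mul_one]))
  · intro k hk
    by_cases hik : ord i < ord k
    · rw [h0 k i hk (by omega), mul_zero]
    · rw [h0 i k hk.symm hik, zero_mul]

/-- Coordinate 0 of x is the scalar on the odd part, and the matrix entries follow it, hence the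
successors. If the odd part is zero, the scalar is subject to no equation. -/
theorem mem_solutions_centroidRows {m : ℕ} (t : IntTable m) (n : ℕ) (x : Fin (m * m + 1) → ℂ)
    (h1 : ∀ i j k, ∑ l, (t.half n).even i j l * x (finProdFinEquiv (l, k)).succ =
      ∑ l, (t.half n).even l j k * x (finProdFinEquiv (i, l)).succ)
    (h2 : n ≠ 0 → ∀ i, (t.half n).act i * x 0 =
      ∑ l, (t.half n).act l * x (finProdFinEquiv (i, l)).succ) :
    x ∈ solutions (m * m + 1) (t.centroidRows n) := by
  rw [mem_solutions, IntTable.centroidRows, List.forall_mem_append]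
  constructor
  · rw [List.forall_mem_map]
    rintro ⟨i, j, k⟩ -
    rw [rowForm_succ, List.tail_cons, rowForm_matrixRow]
    push_cast
    simp only [sub_mul, Finset.sum_sub_distrib]
    rw [sum_ite_col (fun l => (t.even i j l : ℂ)) fun l k => x (finProdFinEquiv (l, k)).succ,
      sum_ite_row (fun l => (t.even l j k : ℂ)) fun l k => x (finProdFinEquiv (l, k)).succ]
    have h := h1 i j k
    simp only [IntTable.half, halfEven, div_mul_eq_mul_div, ← Finset.sum_div] at h
    rw [List.headD_cons, Int.cast_zero]
    linear_combination 2 * h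
  · split_ifs with hn
    · simp
    · rw [List.forall_mem_map]
      intro i _
      rw [rowForm_succ, List.tail_cons, rowForm_matrixRow]
      push_cast
      rw [sum_ite_row (fun l => -(t.act l : ℂ)) fun l k => x (finProdFinEquiv (l, k)).succ]
      have h := h2 hn i
      simp only [IntTable.half, halfAct, div_mul_eq_mul_div, ← Finset.sum_div] at h
      simp only [List.headD_cons, neg_mul, Finset.sum_neg_distrib]
      linear_combination 2 * h

theorem of_mem_solutions_scalarRows {m n : ℕ} {ord : Fin m → ℕ} {x : Fin (m * m + 1) → ℂ}
    (hx : x ∈ solutions (m * m + 1) (IntTable.scalarRows m n ord)) :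
    (∀ i j, i ≠ j → ¬ ord i < ord j → x (finProdFinEquiv (i, j)).succ = 0) ∧
    (∀ i j, x (finProdFinEquiv (i, i)).succ = x (finProdFinEquiv (j, j)).succ) ∧
    (n ≠ 0 → ∀ i, x (finProdFinEquiv (i, i)).succ = x 0) := by
  have hsum : ∀ i j : Fin m, ∑ l, ∑ k, (if l = i ∧ k = j then (1 : ℂ) else 0) *
      x (finProdFinEquiv (l, k)).succ = x (finProdFinEquiv (i, j)).succ := by
    intro i j
    rw [Fintype.sum_eq_single i fun l hl => by simp [hl],
      Fintype.sum_eq_single j fun l hl => by simp [hl]]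
    simp
  rw [mem_solutions, IntTable.scalarRows, List.forall_mem_append, List.forall_mem_append,
    List.forall_mem_flatMap, List.forall_mem_flatMap] at hx
  obtain ⟨h1, h2, h3⟩ := hx
  simp only [List.forall_mem_map, List.mem_finRange, forall_const, rowForm_succ, List.tail_cons,
    rowForm_matrixRow, List.headD_cons, Int.cast_zero, zero_mul, zero_add] at h1 h2
  refine ⟨fun i j hij ho => ?_, fun i j => ?_, fun hn i => ?_⟩
  · have h := h1 i j
    simp only [hij, ho, or_self, if_false] at h
    push_cast at h
    rwa [hsum] at h
  · have h := h2 i j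
    push_cast at h
    simp only [sub_mul, Finset.sum_sub_distrib, hsum] at h
    exact sub_eq_zero.1 h
  · rw [if_neg hn, List.forall_mem_map] at h3
    have h := h3 i (List.mem_finRange i)
    rw [rowForm_succ, List.tail_cons, rowForm_matrixRow, List.headD_cons] at h
    push_cast at h
    simp only [neg_mul, Finset.sum_neg_distrib, hsum] at h
    linear_combination -h

/-- The projection onto I along K commutes with multiplications because I and K are both ideals, and
it preserves parity because both are graded. It is thus an idempotent of the even centroid. -/
theorem exists_projection {A : Type*} [AddCommGroup A] [Module ℂ A] (S : Superalgebra A)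
    {I K : Submodule ℂ A} (hI : S.IsGradedIdeal I) (hK : S.IsGradedIdeal K) (h : IsCompl I K) :
    ∃ P : A →ₗ[ℂ] A, (∀ x, x ∈ I → P x = x) ∧ (∀ x, x ∈ K → P x = 0) ∧
      (∀ x, P (P x) = P x) ∧ (∀ x y, P (S.mul x y) = S.mul (P x) y) ∧
      ∀ i x, x ∈ S.grade i → P x ∈ S.grade i := by
  have hl : ∀ x, x ∈ I → I.projection K h x = x := fun x hx =>
    Submodule.projection_apply_left h ⟨x, hx⟩
  have hr : ∀ x, x ∈ K → I.projection K h x = 0 := fun x hx =>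
    Submodule.projection_apply_right h ⟨x, hx⟩
  have hmem : ∀ x, I.projection K h x ∈ I := Submodule.projection_apply_mem h
  refine ⟨I.projection K h, hl, hr, fun x => hl _ (hmem x), fun x y => ?_, fun i x hx => ?_⟩
  · obtain ⟨a, ha, b, hb, rfl⟩ := Submodule.mem_sup.1 (h.sup_eq_top.ge (Submodule.mem_top (x := x)))
    rw [map_add, map_add, hl a ha, hr b hb, add_zero, LinearMap.add_apply, map_add,
      hl _ (hI.1 a ha y).1, hr _ (hK.1 b hb y).1, add_zero]
  · obtain ⟨a, ha, b, hb, rfl⟩ := Submodule.mem_sup.1 (h.sup_eq_top.ge (Submodule.mem_top (x := x)))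
    rw [map_add, hl a ha, hr b hb, add_zero]
    have ha' := ha
    have hb' := hb
    rw [hI.2] at ha'
    rw [hK.2] at hb'
    obtain ⟨a0, ⟨ha0, ga0⟩, a1, ⟨ha1, ga1⟩, rfl⟩ := Submodule.mem_sup.1 ha'
    obtain ⟨b0, ⟨hb0, gb0⟩, b1, ⟨hb1, gb1⟩, rfl⟩ := Submodule.mem_sup.1 hb'
    rcases zmod_two_cases i with rfl | rfl
    -- The odd component a₁ + b₁ of an even element vanishes, so a₁ = -b₁ lies in I ∩ K = 0.
    · have h1 : a1 + b1 = 0 := by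
        refine Submodule.disjoint_def.1 S.isCompl.disjoint _ ?_ (add_mem ga1 gb1)
        have h2 := sub_mem (sub_mem hx ga0) gb0
        convert h2 using 1
        abel
      have h3 : a1 = 0 := Submodule.disjoint_def.1 h.disjoint _ ha1
        (by rw [eq_neg_of_add_eq_zero_left h1]; exact neg_mem hb1)
      rw [h3, add_zero]
      exact ga0
    · have h1 : a0 + b0 = 0 := by
        refine Submodule.disjoint_def.1 S.isCompl.disjoint _ (add_mem ga0 gb0) ?_
        have h2 := sub_mem (sub_mem hx ga1) gb1
        convert h2 using 1
        abel
      have h3 : a0 = 0 := Submodule.disjoint_def.1 h.disjoint _ ha0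
        (by rw [eq_neg_of_add_eq_zero_left h1]; exact neg_mem hb0)
      rw [h3, zero_add]
      exact ga1

/-- The projection belonging to a decomposition solves the centroid equations, hence is triangular
with constant diagonal and the same scalar on f. Being idempotent, it is 0 or 1. -/
theorem isIndecomposable_of_isLocal {s : IntSummand} {ord : Fin s.m → ℕ} (hn : s.n ≤ 1)
    (hmn : 1 ≤ s.m + s.n) (hs : s.isLocal ord = true) : s.half.table.alg.IsIndecomposable := by
  obtain ⟨m, n, t⟩ := s
  simp only at hn hmn ord
  have hs' := solutions_le_of_implies hs
  simp only at hs'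
  change (t.half n).alg.IsIndecomposable
  constructor
  · rcases Nat.eq_zero_or_pos n with rfl | hn'
    · have : Nonempty (Fin m) := ⟨⟨0, by omega⟩⟩
      infer_instance
    · have : Nonempty (Fin n) := ⟨⟨0, hn'⟩⟩
      infer_instance
  intro I K hI hK hIK
  obtain ⟨P, hPI, hPK, hPP, hmul, hgr⟩ := exists_projection _ hI hK hIK
  have hsub : ∀ j k : Fin n, j = k := fun j k => by
    have := j.2
    have := k.2
    exact Fin.ext (by omega)
  set X : Fin m → Fin m → ℂ := fun i k => (P (Pi.single i 1, 0)).1 k with hX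
  -- As n ≤ 1, this sum is the scalar by which P acts on f, or the empty sum 0 if there is no odd
  -- part.
  set ν : ℂ := ∑ j : Fin n, (P (0, fun _ => 1)).2 j with hν
  have hPe : ∀ v : Fin m → ℂ, P (v, 0) = (fun k => ∑ i, v i * X i k, 0) := by
    intro v
    have h1 : (v, (0 : Fin n → ℂ)) = ∑ i, v i • ((Pi.single i 1 : Fin m → ℂ), (0 : Fin n → ℂ)) := by
      ext k
      · simp [Prod.fst_sum, Pi.single_apply]
      · simp [Prod.snd_sum]
    refine Prod.ext ?_ ((mem_grade_zero _).1 (hgr 0 (v, 0) ((mem_grade_zero _).2 rfl)))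
    simp_rw [h1, map_sum, map_smul]
    ext k
    simp [Prod.fst_sum, hX]
  have hPo : ∀ w : Fin n → ℂ, P (0, w) = (0, ν • w) := by
    intro w
    have h2 := (mem_grade_one _).1 (hgr 1 (0, w) ((mem_grade_one _).2 rfl))
    refine Prod.ext h2 (funext fun k => ?_)
    have h3 : ((0 : Fin m → ℂ), w) = w k • ((0 : Fin m → ℂ), fun _ => (1 : ℂ)) := by
      ext j
      · simp
      · simp [hsub j k]
    rw [h3, map_smul, hν, Fintype.sum_eq_single k fun j hj => absurd (hsub j k) hj]
    simp [mul_comm]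
  have hP : ∀ v w, P (v, w) = (fun k => ∑ i, v i * X i k, ν • w) := by
    intro v w
    have h : (v, w) = (v, (0 : Fin n → ℂ)) + ((0 : Fin m → ℂ), w) := by simp
    rw [h, map_add, hPe, hPo]
    simp
  set x : Fin (m * m + 1) → ℂ := Fin.cons ν fun p => X (finProdFinEquiv.symm p).1
    (finProdFinEquiv.symm p).2 with hx
  have hx0 : x 0 = ν := rfl
  have hx1 : ∀ i j, x (finProdFinEquiv (i, j)).succ = X i j := fun i j => by
    simp only [hx, Fin.cons_succ, Equiv.symm_apply_apply]
  have hx2 : x ∈ solutions (m * m + 1) (t.centroidRows n) := by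
    refine mem_solutions_centroidRows t n x (fun i j k => ?_) fun hn i => ?_
    · have h := congrArg (fun v => v.1 k) (hmul (Pi.single i 1, 0) (Pi.single j 1, 0))
      -- The product is displayed as a pair, since the formula for P is stated on pairs.
      rw [← Prod.mk.eta (p := (t.half n).alg.mul (Pi.single i 1, 0) (Pi.single j 1, 0))] at h
      simpa [hP, hx1, alg_mul_fst, Pi.single_apply] using h
    · have h := congrArg (fun v => v.2 ⟨0, by omega⟩) (hmul (Pi.single i 1, 0) (0, fun _ => 1))
      rw [← Prod.mk.eta (p := (t.half n).alg.mul (Pi.single i 1, 0) (0, fun _ => 1))] at h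
      simpa [hP, hx0, hx1, alg_mul_snd, Pi.single_apply, mul_comm] using h
  obtain ⟨h1, h2, h3⟩ := of_mem_solutions_scalarRows (hs' hx2)
  simp only [hx0, hx1] at h1 h2 h3
  have hXX : ∀ i j, ∑ k, X i k * X k j = X i j := by
    intro i j
    have h := congrArg (fun v => v.1 j) (hPP (Pi.single i 1, 0))
    simpa [hPe, Pi.single_apply] using h
  have hνν : n ≠ 0 → ν = 0 ∨ ν = 1 := by
    intro hn
    have h := congrArg (fun v => v.2 ⟨0, by omega⟩) (hPP (0, fun _ => 1))
    simp only [hPo, Pi.smul_apply, smul_eq_mul, mul_one] at h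
    rcases eq_or_ne ν 0 with h0 | h0
    · exact Or.inl h0
    · exact Or.inr (mul_left_cancel₀ h0 (by rw [h, mul_one]))
  -- The common scalar is read off f if there is an odd part, and otherwise off the first diagonal
  -- entry, which exists because m + n ≥ 1.
  obtain ⟨c, hcc, hXc, hνc⟩ : ∃ c : ℂ, (c = 0 ∨ c = 1) ∧ (∀ i, X i i = c) ∧ (n ≠ 0 → ν = c) := by
    rcases eq_or_ne n 0 with rfl | hn'
    · refine ⟨X ⟨0, by omega⟩ ⟨0, by omega⟩, diag_of_idempotent_of_triangular hXX h1 _,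
        fun i => h2 _ _, fun h => absurd rfl h⟩
    · exact ⟨ν, hνν hn', h3 hn', fun _ => rfl⟩
  have hXc' := scalar_of_idempotent_of_triangular hXX hXc h1 hcc
  have hPc : ∀ y, P y = c • y := by
    rintro ⟨v, w⟩
    rw [hP]
    refine Prod.ext (funext fun k => ?_) (funext fun k => ?_)
    · simp [hXc', mul_comm]
    · simp [hνc (by have := k.2; omega)]
  rcases hcc with rfl | rfl
  · exact Or.inl ((Submodule.eq_bot_iff _).2 fun y hy => by rw [← hPI y hy, hPc, zero_smul])
  · exact Or.inr ((Submodule.eq_bot_iff _).2 fun y hy => by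
      rw [← one_smul ℂ y, ← hPc, hPK y hy])

theorem isIndecomposable_of_mem_summands (i : Fin 59) {s : Summand} (hs : s ∈ (rows i).summands) :
    s.table.alg.IsIndecomposable := by
  rw [rows_eq, IntRow.half, List.mem_map] at hs
  obtain ⟨s, hs, rfl⟩ := hs
  obtain ⟨h1, h2, h3 | h3⟩ := summands_isLocal i s hs
  · exact isIndecomposable_of_isLocal h1 h2 h3
  · exact isIndecomposable_of_isLocal h1 h2 h3

end Superalgebra

end

namespace Superalgebra

/-! ### Jordan products and their one-dimensional modules -/

section product
variable {V : Type*} [AddCommGroup V] [Module ℂ V]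

/-- Commutative products that satisfy the linearized Jordan identity. -/
structure IsJordanProduct (μ : V →ₗ[ℂ] V →ₗ[ℂ] V) : Prop where
  comm : ∀ x y, μ x y = μ y x
  jordan : ∀ x y z t, μ (μ (μ x y) z) t + μ (μ (μ x t) z) y + μ (μ (μ y t) z) x =
    μ (μ x y) (μ z t) + μ (μ x t) (μ y z) + μ (μ x z) (μ y t)

/-- The functionals by which a Jordan algebra acts on a one-dimensional bimodule. -/
def IsJordanAction (μ : V →ₗ[ℂ] V →ₗ[ℂ] V) (a : V →ₗ[ℂ] ℂ) : Prop :=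
  ∀ x y z, a (μ (μ x y) z) + 2 * (a x * a y * a z) =
    a (μ x y) * a z + a (μ y z) * a x + a (μ x z) * a y

/-- By commutativity the identity is symmetric in x, y, t. Linear extension is therefore carried out
only in x and in z, and a cyclic exchange of x, y, t supplies the other variables. -/
theorem IsJordanProduct.of_basis {ι : Type*} (b : Module.Basis ι ℂ V) {μ : V →ₗ[ℂ] V →ₗ[ℂ] V}
    (hc : ∀ i j, μ (b i) (b j) = μ (b j) (b i))
    (hj : ∀ i j k l, μ (μ (μ (b i) (b j)) (b k)) (b l) + μ (μ (μ (b i) (b l)) (b k)) (b j) +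
      μ (μ (μ (b j) (b l)) (b k)) (b i) = μ (μ (b i) (b j)) (μ (b k) (b l)) +
      μ (μ (b i) (b l)) (μ (b j) (b k)) + μ (μ (b i) (b k)) (μ (b j) (b l))) :
    IsJordanProduct μ := by
  have comm : ∀ x y, μ x y = μ y x := by
    have h : μ = μ.flip := b.ext fun i => b.ext fun j => hc i j
    exact fun x y => LinearMap.congr_fun (LinearMap.congr_fun h x) y
  refine ⟨comm, ?_⟩
  have hx : ∀ y z t, (∀ i, μ (μ (μ (b i) y) z) t + μ (μ (μ (b i) t) z) y + μ (μ (μ y t) z) (b i) =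
      μ (μ (b i) y) (μ z t) + μ (μ (b i) t) (μ y z) + μ (μ (b i) z) (μ y t)) → ∀ x,
      μ (μ (μ x y) z) t + μ (μ (μ x t) z) y + μ (μ (μ y t) z) x =
      μ (μ x y) (μ z t) + μ (μ x t) (μ y z) + μ (μ x z) (μ y t) := by
    intro y z t h x
    have h' : μ.flip t ∘ₗ μ.flip z ∘ₗ μ.flip y + μ.flip y ∘ₗ μ.flip z ∘ₗ μ.flip t +
        μ (μ (μ y t) z) = μ.flip (μ z t) ∘ₗ μ.flip y + μ.flip (μ y z) ∘ₗ μ.flip t +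
        μ.flip (μ y t) ∘ₗ μ.flip z := b.ext fun i => by simpa using h i
    simpa using LinearMap.congr_fun h' x
  have hz : ∀ x y t, (∀ k, μ (μ (μ x y) (b k)) t + μ (μ (μ x t) (b k)) y + μ (μ (μ y t) (b k)) x =
      μ (μ x y) (μ (b k) t) + μ (μ x t) (μ y (b k)) + μ (μ x (b k)) (μ y t)) → ∀ z,
      μ (μ (μ x y) z) t + μ (μ (μ x t) z) y + μ (μ (μ y t) z) x =
      μ (μ x y) (μ z t) + μ (μ x t) (μ y z) + μ (μ x z) (μ y t) := by
    intro x y t h z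
    have h' : μ.flip t ∘ₗ μ (μ x y) + μ.flip y ∘ₗ μ (μ x t) + μ.flip x ∘ₗ μ (μ y t) =
        μ (μ x y) ∘ₗ μ.flip t + μ (μ x t) ∘ₗ μ y + μ.flip (μ y t) ∘ₗ μ x :=
      b.ext fun i => by simpa using h i
    simpa using LinearMap.congr_fun h' z
  have hswap : ∀ x y z t, (μ (μ (μ x y) z) t + μ (μ (μ x t) z) y + μ (μ (μ y t) z) x =
      μ (μ x y) (μ z t) + μ (μ x t) (μ y z) + μ (μ x z) (μ y t)) →
      (μ (μ (μ y t) z) x + μ (μ (μ y x) z) t + μ (μ (μ t x) z) y =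
      μ (μ y t) (μ z x) + μ (μ y x) (μ t z) + μ (μ y z) (μ t x)) := by
    intro x y z t h
    rw [comm y x, comm t x, comm t z, comm z x, comm (μ y t) (μ x z), comm (μ y z) (μ x t)]
    linear_combination (norm := module) h
  intro x y z t
  refine hswap t x z y (hx _ _ _ (fun i => ?_) t)
  refine hswap y _ z x (hx _ _ _ (fun j => ?_) y)
  refine hswap x _ z _ (hx _ _ _ (fun k => ?_) x)
  exact hz _ _ _ (fun l => hj _ _ _ _) z

theorem IsJordanAction.of_basis {ι : Type*} (b : Module.Basis ι ℂ V) {μ : V →ₗ[ℂ] V →ₗ[ℂ] V}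
    {a : V →ₗ[ℂ] ℂ} (h : ∀ i j k, a (μ (μ (b i) (b j)) (b k)) + 2 * (a (b i) * a (b j) * a (b k)) =
      a (μ (b i) (b j)) * a (b k) + a (μ (b j) (b k)) * a (b i) + a (μ (b i) (b k)) * a (b j)) :
    IsJordanAction μ a := by
  have hz : ∀ i j z, a (μ (μ (b i) (b j)) z) + 2 * (a (b i) * a (b j) * a z) =
      a (μ (b i) (b j)) * a z + a (μ (b j) z) * a (b i) + a (μ (b i) z) * a (b j) := by
    intro i j z
    have h' : a ∘ₗ μ (μ (b i) (b j)) + (2 * (a (b i) * a (b j))) • a =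
        a (μ (b i) (b j)) • a + a (b i) • (a ∘ₗ μ (b j)) + a (b j) • (a ∘ₗ μ (b i)) :=
      b.ext fun k => by
        simp only [LinearMap.add_apply, LinearMap.comp_apply, LinearMap.smul_apply, smul_eq_mul]
        linear_combination h i j k
    have h2 := LinearMap.congr_fun h' z
    simp only [LinearMap.add_apply, LinearMap.comp_apply, LinearMap.smul_apply, smul_eq_mul] at h2
    linear_combination h2
  have hy : ∀ i y z, a (μ (μ (b i) y) z) + 2 * (a (b i) * a y * a z) =
      a (μ (b i) y) * a z + a (μ y z) * a (b i) + a (μ (b i) z) * a y := by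
    intro i y z
    have h' : a ∘ₗ μ.flip z ∘ₗ μ (b i) + (2 * (a (b i) * a z)) • a =
        a z • (a ∘ₗ μ (b i)) + a (b i) • (a ∘ₗ μ.flip z) + a (μ (b i) z) • a :=
      b.ext fun k => by
        simp only [LinearMap.add_apply, LinearMap.comp_apply, LinearMap.smul_apply, smul_eq_mul,
          LinearMap.flip_apply]
        linear_combination hz i k z
    have h2 := LinearMap.congr_fun h' y
    simp only [LinearMap.add_apply, LinearMap.comp_apply, LinearMap.smul_apply, smul_eq_mul,
      LinearMap.flip_apply] at h2
    linear_combination h2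
  intro x y z
  have h' : a ∘ₗ μ.flip z ∘ₗ μ.flip y + (2 * (a y * a z)) • a =
      a z • (a ∘ₗ μ.flip y) + a (μ y z) • a + a y • (a ∘ₗ μ.flip z) :=
    b.ext fun k => by
      simp only [LinearMap.add_apply, LinearMap.comp_apply, LinearMap.smul_apply, smul_eq_mul,
        LinearMap.flip_apply]
      linear_combination hy k y z
  have h2 := LinearMap.congr_fun h' x
  simp only [LinearMap.add_apply, LinearMap.comp_apply, LinearMap.smul_apply, smul_eq_mul,
    LinearMap.flip_apply] at h2
  linear_combination h2

end product

namespace Table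
variable {m n : ℕ} (t : Table m n)

/-- The product of the even part. -/
noncomputable def evenProduct : (Fin m → ℂ) →ₗ[ℂ] (Fin m → ℂ) →ₗ[ℂ] (Fin m → ℂ) :=
  (t.alg.mul.compl₁₂ (LinearMap.inl ℂ _ _) (LinearMap.inl ℂ _ _)).compr₂ (LinearMap.fst ℂ _ _)

/-- The action of the even part on the odd part. -/
noncomputable def actForm : (Fin m → ℂ) →ₗ[ℂ] ℂ := ∑ i, t.act i • LinearMap.proj i

theorem evenProduct_apply (x y : Fin m → ℂ) (k : Fin m) :
    t.evenProduct x y k = ∑ i, ∑ j, t.even i j k * (x i * y j) := rfl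

theorem actForm_apply (x : Fin m → ℂ) : t.actForm x = ∑ i, t.act i * x i := by simp [actForm]

theorem evenProduct_basis (i j : Fin m) :
    t.evenProduct (Pi.single i 1) (Pi.single j 1) = t.even i j := by
  ext k
  simp [evenProduct_apply, Pi.single_apply]

theorem evenProduct_single_right (x : Fin m → ℂ) (j k : Fin m) :
    t.evenProduct x (Pi.single j 1) k = ∑ i, t.even i j k * x i := by
  simp [evenProduct_apply, Pi.single_apply]

theorem actForm_basis (i : Fin m) : t.actForm (Pi.single i 1) = t.act i := by
  simp [actForm_apply, Pi.single_apply]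

theorem mul_eq (x y : Fin m → ℂ) (u v : Fin n → ℂ) : t.alg.mul (x, u) (y, v) =
    (t.evenProduct x y, t.actForm x • v + t.actForm y • u) := by
  refine Prod.ext rfl ?_
  rw [alg_mul_snd, actForm_apply, actForm_apply]

end Table

/-- With at least two odd arguments every term contains a product of two odd elements and is zero,
so at most one odd argument has to be considered. -/
theorem isJordan_alg {t : Table 3 1} (h : IsJordanProduct t.evenProduct)
    (ha : IsJordanAction t.evenProduct t.actForm) : t.alg.IsJordan := by
  constructor
  · intro a b x y hx hy
    obtain ⟨x, u⟩ := x
    obtain ⟨y, v⟩ := y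
    have hxy := h.comm x y
    rcases zmod_two_cases a with rfl | rfl <;> rcases zmod_two_cases b with rfl | rfl <;>
    simp only [mem_grade_zero, mem_grade_one] at hx hy <;> subst hx <;> subst hy <;>
    simp [Table.mul_eq, sign_zero, sign_one, hxy]
  · intro a b c d x y z t hx hy hz ht
    obtain ⟨x, u⟩ := x
    obtain ⟨y, v⟩ := y
    obtain ⟨z, w⟩ := z
    obtain ⟨t, s⟩ := t
    have hh := h.jordan x y z t
    have h1 := ha x y z
    have h2 := ha x t z
    have h3 := ha y t z
    rw [h.comm t z] at h2 h3
    rcases zmod_two_cases a with rfl | rfl <;> rcases zmod_two_cases b with rfl | rfl <;>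
    rcases zmod_two_cases c with rfl | rfl <;> rcases zmod_two_cases d with rfl | rfl <;>
    simp only [mem_grade_zero, mem_grade_one] at hx hy hz ht <;> subst hx <;> subst hy <;>
    subst hz <;> subst ht <;>
    simp only [Table.mul_eq, sign_zero, sign_one, one_add_one_zmod, map_zero,
      LinearMap.zero_apply, zero_smul, smul_zero, mul_zero, zero_mul, add_zero, zero_add, mul_one,
      one_smul, neg_smul, Prod.mk_add_mk, Prod.smul_mk, smul_smul, neg_zero, Prod.neg_mk,
      Prod.mk_zero_zero]
    · rw [hh]
    all_goals simp only [← add_smul]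
    all_goals congr 2
    -- The odd argument is t, z, y and x in turn. For odd z both sides agree termwise; the other
    -- three cases are the cubic condition on a.
    · linear_combination h1
    · ring
    · linear_combination h2
    · linear_combination h3

/-! ### The listed superalgebras are Jordan superalgebras of type `(3, 1)` -/

/-- The integer form of the Jordan identity. -/
def JordanEven (c : Fin 3 → Fin 3 → Fin 3 → ℤ) : Prop :=
  (∀ i j k, c i j k = c j i k) ∧ ∀ x y z t k : Fin 3,
    ∑ p, ∑ q, (c x y p * c p z q * c q t k + c x t p * c p z q * c q y k +
      c y t p * c p z q * c q x k) =
    ∑ p, ∑ q, (c x y p * c z t q * c p q k + c x t p * c y z q * c p q k +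
      c x z p * c y t q * c p q k)

instance (c : Fin 3 → Fin 3 → Fin 3 → ℤ) : Decidable (JordanEven c) := by
  unfold JordanEven
  infer_instance

/-- The integer form of the identity for the action on the odd part. -/
def IntTable.JordanAct (t : IntTable 3) : Prop :=
  ∀ x y z : Fin 3, ∑ p, ∑ q, t.even x y p * t.even p z q * t.act q +
      2 * (t.act x * t.act y * t.act z) =
    (∑ p, t.even x y p * t.act p) * t.act z + (∑ p, t.even y z p * t.act p) * t.act x +
      (∑ p, t.even x z p * t.act p) * t.act y

instance (t : IntTable 3) : Decidable t.JordanAct := by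
  unfold IntTable.JordanAct
  infer_instance

/-- The even multiplications on `e₁, e₂, e₃`. -/
def intEvens : Fin 19 → Fin 3 → Fin 3 → Fin 3 → ℤ :=
  ![intEvenUUU, intEvenUUN, intEvenUNN, intEvenB₁U, intEvenB₁N, intEvenB₂U, intEvenB₂N, intEvenB₃U,
    intEvenB₃N, intEvenT₁, intEvenT₂, intEvenT₃, intEvenT₄, intEvenT₅, intEvenT₆, intEvenT₇,
    intEvenT₈, intEvenT₉, intEvenT₁₀]

/-- The even multiplication in each line. -/
def evenIndex : Fin 59 → Fin 19 :=
  ![0, 0, 0, 0, 1, 1, 1, 1, 2, 2, 2, 3, 3, 3, 3, 3, 3, 4, 4, 4, 5, 5, 5, 5, 5, 5, 6, 6, 6, 7, 7, 7,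
    8, 9, 9, 9, 10, 10, 10, 11, 12, 13, 13, 14, 14, 14, 15, 15, 15, 16, 16, 16, 17, 17, 17, 18, 18,
    18, 18]

theorem intRows_even (i : Fin 59) : (intRows i).table.even = intEvens (evenIndex i) := by
  fin_cases i <;> rfl

theorem jordanEven_intEvens : ∀ k, JordanEven (intEvens k) := by
  decide +kernel

theorem jordanAct_intRows : ∀ i, (intRows i).table.JordanAct := by
  decide +kernel

theorem intEvens_ne_zero : ∀ k, ∃ i j l, intEvens k i j l ≠ 0 := by
  decide +kernel

theorem jordanEven_intRows (i : Fin 59) : JordanEven (intRows i).table.even := by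
  rw [intRows_even]
  exact jordanEven_intEvens _

theorem classified_eq (i : Fin 59) : classified i = ((intRows i).table.half 1).alg := by
  rw [classified, rows_eq, IntRow.half]

theorem isJordanProduct_half {t : IntTable 3} {n : ℕ} (h : JordanEven t.even) :
    IsJordanProduct (t.half n).evenProduct := by
  obtain ⟨hc, hj⟩ := h
  refine IsJordanProduct.of_basis (Pi.basisFun ℂ (Fin 3)) (fun i j => ?_) fun x y z t' => ?_
  · ext k
    simp only [Pi.basisFun_apply, Table.evenProduct_basis, IntTable.half, halfEven, hc i j k]
  · ext k
    have h : ((_ : ℤ) : ℂ) = ((_ : ℤ) : ℂ) := congrArg _ (hj x y z t' k)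
    push_cast at h
    simp only [Fin.sum_univ_three] at h
    simp only [Pi.basisFun_apply, Pi.add_apply, Table.evenProduct_basis]
    simp only [Table.evenProduct_single_right]
    simp only [Table.evenProduct_apply, IntTable.half, halfEven, Fin.sum_univ_three]
    -- The identity is cubic in structure constants that are halves of the integer entries.
    linear_combination h / 8

theorem isJordanAction_half {t : IntTable 3} {n : ℕ} (h : t.JordanAct) :
    IsJordanAction (t.half n).evenProduct (t.half n).actForm := by
  refine IsJordanAction.of_basis (Pi.basisFun ℂ (Fin 3)) fun i j k => ?_
  have h : ((_ : ℤ) : ℂ) = ((_ : ℤ) : ℂ) := congrArg _ (h i j k)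
  push_cast at h
  simp only [Fin.sum_univ_three] at h
  simp only [Pi.basisFun_apply, Table.actForm_basis, Table.evenProduct_basis]
  simp only [Table.actForm_apply, Table.evenProduct_single_right, IntTable.half, halfEven, halfAct,
    Fin.sum_univ_three]
  linear_combination h / 8

theorem isJordan_classified (i : Fin 59) : (classified i).IsJordan := by
  rw [classified_eq]
  exact isJordan_alg (isJordanProduct_half (jordanEven_intRows i))
    (isJordanAction_half (jordanAct_intRows i))

theorem hasType_alg (t : Table 3 1) : t.alg.HasType 3 1 := by
  constructor
  · refine (LinearEquiv.finrank_eq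
      { toFun := fun x : t.alg.grade 0 => x.1.1
        map_add' := fun x y => rfl
        map_smul' := fun c x => rfl
        invFun := fun x => ⟨(x, 0), (mem_grade_zero t).2 rfl⟩
        left_inv := fun x => Subtype.ext (Prod.ext rfl ((mem_grade_zero t).1 x.2).symm)
        right_inv := fun x => rfl }).trans (by simp)
  · refine (LinearEquiv.finrank_eq
      { toFun := fun x : t.alg.grade 1 => x.1.2
        map_add' := fun x y => rfl
        map_smul' := fun c x => rfl
        invFun := fun x => ⟨(0, x), (mem_grade_one t).2 rfl⟩
        left_inv := fun x => Subtype.ext (Prod.ext ((mem_grade_one t).1 x.2).symm rfl)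
        right_inv := fun x => rfl }).trans (by simp)

theorem classified_mul_ne_zero (i : Fin 59) : (classified i).mul ≠ 0 := by
  intro h
  obtain ⟨a, b, c, hne⟩ := intEvens_ne_zero (evenIndex i)
  have h1 := mul_evenUnit_evenUnit ((intRows i).table.half 1) a b
  rw [← classified_eq, h] at h1
  have h2 := congrArg (fun v => v.1 c) h1
  simp only [LinearMap.zero_apply, Prod.fst_zero, Pi.zero_apply, IntTable.half, halfEven,
    intRows_even] at h2
  exact hne (by simpa using h2.symm)

theorem orbit_add_finrank_derivations (i : Fin 59) :
    (rows i).orbit + Module.finrank ℂ (classified i).derivations = 4 ^ 2 := by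
  rw [classified_eq, finrank_derivations _ (jordanEven_intRows i).1, rows_eq]
  exact orbit_add_nullity i

end Superalgebra

namespace Superalgebra

/-! ### Isomorphism invariants -/

section iso
variable {A B : Type*} [AddCommGroup A] [Module ℂ A] [AddCommGroup B] [Module ℂ B]
  {S : Superalgebra A} {T : Superalgebra B}

theorem conj_mem_derivationsOfParity {φ : A ≃ₗ[ℂ] B}
    (hφ : ∀ x y, φ (S.mul x y) = T.mul (φ x) (φ y))
    (hg : ∀ (i : ZMod 2) (x : A), x ∈ S.grade i ↔ φ x ∈ T.grade i) (p : ZMod 2) (D : A →ₗ[ℂ] A) :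
    φ.conj D ∈ T.derivationsOfParity p ↔ D ∈ S.derivationsOfParity p := by
  constructor
  · rintro ⟨h1, h2⟩
    refine ⟨fun i x hx => ?_, fun i x y hx => φ.injective ?_⟩
    · have h := h1 i _ ((hg i x).1 hx)
      rwa [LinearEquiv.conj_apply_apply, φ.symm_apply_apply, ← hg] at h
    · have h := h2 i _ (φ y) ((hg i x).1 hx)
      simpa only [LinearEquiv.conj_apply_apply, φ.symm_apply_apply, ← hφ, map_add, map_smul] using h
  · rintro ⟨h1, h2⟩
    refine ⟨fun i x hx => ?_, fun i x y hx => ?_⟩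
    · rw [LinearEquiv.conj_apply_apply, ← hg]
      exact h1 i _ (by rwa [hg, φ.apply_symm_apply])
    · obtain ⟨x, rfl⟩ := φ.surjective x
      obtain ⟨y, rfl⟩ := φ.surjective y
      simp only [LinearEquiv.conj_apply_apply, φ.symm_apply_apply, ← hφ, ← map_add, ← map_smul,
        h2 i x y ((hg i x).2 hx)]

theorem IsIsomorphic.finrank_derivations_eq (h : S.IsIsomorphic T) :
    Module.finrank ℂ S.derivations = Module.finrank ℂ T.derivations := by
  obtain ⟨φ, hφ, hg⟩ := h
  have key : ∀ p, (S.derivationsOfParity p).map (φ.conj : (A →ₗ[ℂ] A) →ₗ[ℂ] (B →ₗ[ℂ] B)) =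
      T.derivationsOfParity p := by
    intro p
    ext D
    rw [Submodule.mem_map]
    constructor
    · rintro ⟨E, hE, rfl⟩
      exact (conj_mem_derivationsOfParity hφ hg p E).2 hE
    · intro hD
      refine ⟨φ.conj.symm D, ?_, by simp⟩
      rw [← conj_mem_derivationsOfParity hφ hg]
      simpa using hD
  rw [derivations, derivations, ← key 0, ← key 1, ← Submodule.map_sup]
  exact (LinearEquiv.finrank_map_eq φ.conj _).symm

end iso

namespace Table

/-- The form `p 0 * τ (x y) + p 1 * τ x * τ y + p 2 * a (x y) + p 3 * a x * a y`, where `τ` is the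
trace of the multiplication on the even part and `a` its action on the odd part. -/
noncomputable def form (t : Table 3 1) (p : Fin 4 → ℤ) (x y : Fin 3 → ℂ) : ℂ :=
  p 0 * LinearMap.trace ℂ _ (t.evenProduct (t.evenProduct x y)) +
    p 1 * (LinearMap.trace ℂ _ (t.evenProduct x) * LinearMap.trace ℂ _ (t.evenProduct y)) +
    p 2 * t.actForm (t.evenProduct x y) + p 3 * (t.actForm x * t.actForm y)

/-- The radical of a form. -/
noncomputable def radical (t : Table 3 1) (p : Fin 4 → ℤ) : Submodule ℂ (Fin 3 → ℂ) where
  carrier := {y | ∀ x, t.form p x y = 0}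
  zero_mem' := fun x => by simp [form]
  add_mem' := by
    intro y z hy hz x
    have h1 := hy x
    have h2 := hz x
    simp only [form, map_add] at h1 h2 ⊢
    linear_combination h1 + h2
  smul_mem' := by
    intro c y hy x
    have h1 := hy x
    simp only [form, map_smul, smul_eq_mul] at h1 ⊢
    linear_combination c * h1

theorem mem_radical {t : Table 3 1} {p : Fin 4 → ℤ} {y : Fin 3 → ℂ} :
    y ∈ t.radical p ↔ ∀ x, t.form p x y = 0 := Iff.rfl

theorem trace_evenProduct (t : Table 3 1) (x : Fin 3 → ℂ) :
    LinearMap.trace ℂ _ (t.evenProduct x) = ∑ i, (∑ j, t.even i j j) * x i := by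
  rw [LinearMap.trace_eq_matrix_trace ℂ (Pi.basisFun ℂ (Fin 3)), Matrix.trace]
  simp only [Matrix.diag_apply, LinearMap.toMatrix_apply, Pi.basisFun_apply,
    Table.evenProduct_single_right, Pi.basisFun_repr, Finset.sum_mul]
  exact Finset.sum_comm

end Table

/-- An isomorphism restricts to the even parts and sends f to a nonzero multiple of f. This multiple
cancels in φ(xf) = φ(x)φ(f), so the functionals correspond exactly. -/
theorem exists_even_equiv {t t' : Table 3 1} (h : t.alg.IsIsomorphic t'.alg) :
    ∃ g : (Fin 3 → ℂ) ≃ₗ[ℂ] (Fin 3 → ℂ),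
      (∀ x y, g (t.evenProduct x y) = t'.evenProduct (g x) (g y)) ∧
        ∀ x, t'.actForm (g x) = t.actForm x := by
  obtain ⟨φ, hφ, hg⟩ := h
  have h0 : ∀ x, φ (x, 0) = ((φ (x, 0)).1, 0) := fun x =>
    Prod.ext rfl ((mem_grade_zero _).1 ((hg 0 _).1 ((mem_grade_zero t).2 rfl)))
  have h0' : ∀ x, φ.symm (x, 0) = ((φ.symm (x, 0)).1, 0) := fun x =>
    Prod.ext rfl ((mem_grade_zero _).1 ((hg 0 _).2 (by
      rw [φ.apply_symm_apply]
      exact (mem_grade_zero t').2 rfl)))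
  refine ⟨
    { toFun := fun x => (φ (x, 0)).1
      map_add' := fun x y => by rw [← Prod.fst_add, ← map_add]; simp
      map_smul' := fun c x => by rw [RingHom.id_apply, ← Prod.smul_fst, ← map_smul]; simp
      invFun := fun x => (φ.symm (x, 0)).1
      left_inv := fun x => by simp only [← h0, φ.symm_apply_apply]
      right_inv := fun x => by simp only [← h0', φ.apply_symm_apply] }, fun x y => ?_, fun x => ?_⟩
  · have h := hφ (x, 0) (y, 0)
    rw [Table.mul_eq, h0 x, h0 y, Table.mul_eq] at h
    simpa using congrArg Prod.fst h
  · have hc : φ oddUnit = (0, (φ oddUnit).2) :=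
      Prod.ext ((mem_grade_one _).1 ((hg 1 _).1 (oddUnit_mem t))) rfl
    have hc0 : (φ oddUnit).2 0 ≠ 0 := by
      intro h
      have h1 : φ oddUnit = 0 := by
        rw [hc]
        refine Prod.ext rfl (funext fun k => ?_)
        rw [Subsingleton.elim k 0]
        exact h
      have h2 := congrArg (fun v => v.2 0) (φ.map_eq_zero_iff.1 h1)
      simp [oddUnit] at h2
    have h := hφ (x, 0) oddUnit
    rw [hc, h0 x, oddUnit, Table.mul_eq, Table.mul_eq] at h
    have h3 : ((t.evenProduct x) 0, t.actForm x • (fun _ : Fin 1 => (1 : ℂ)) +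
        t.actForm 0 • (0 : Fin 1 → ℂ)) = t.actForm x • oddUnit := by
      simp [oddUnit]
    rw [h3, map_smul] at h
    have h4 := congrArg (fun v => v.2 0) h
    simp only [Prod.smul_snd, Pi.smul_apply, smul_eq_mul, smul_zero, add_zero] at h4
    exact (mul_right_cancel₀ hc0 h4).symm

theorem finrank_radical_eq {t t' : Table 3 1} (h : t.alg.IsIsomorphic t'.alg) (p : Fin 4 → ℤ) :
    Module.finrank ℂ (t.radical p) = Module.finrank ℂ (t'.radical p) := by
  obtain ⟨g, hg, ha⟩ := exists_even_equiv h
  have htr : ∀ x, LinearMap.trace ℂ _ (t'.evenProduct (g x)) =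
      LinearMap.trace ℂ _ (t.evenProduct x) := by
    intro x
    -- Multiplication by g x is the conjugate by g of multiplication by x.
    rw [← LinearMap.trace_conj' (t.evenProduct x) g]
    congr 1
    refine LinearMap.ext fun y => ?_
    obtain ⟨y, rfl⟩ := g.surjective y
    rw [LinearEquiv.conj_apply_apply, g.symm_apply_apply, hg]
  have hform : ∀ x y, t'.form p (g x) (g y) = t.form p x y := by
    intro x y
    simp only [Table.form, ← hg, htr, ha]
  have hmap : (t.radical p).map (g : (Fin 3 → ℂ) →ₗ[ℂ] (Fin 3 → ℂ)) = t'.radical p := by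
    ext y
    rw [Submodule.mem_map]
    constructor
    · rintro ⟨y, hy, rfl⟩ x
      obtain ⟨x, rfl⟩ := g.surjective x
      exact (hform x y).trans (hy x)
    · intro hy
      obtain ⟨y, rfl⟩ := g.surjective y
      exact ⟨y, fun x => (hform x y).symm.trans (hy (g x)), rfl⟩
  rw [← hmap]
  exact (LinearEquiv.finrank_map_eq g _).symm

theorem finrank_radical (t : IntTable 3) (p : Fin 4 → ℤ) :
    Module.finrank ℂ ((t.half 1).radical p) = nullity 3 (t.gramRows p) := by
  -- All four terms of a form are quadratic in the structure constants, so doubling multiplies the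
  -- form by 4 and keeps its radical.
  have key : ∀ x y, (t.half 1).form p x y = 1 / 4 * ∑ i, x i * rowForm 3 (List.ofFn fun j =>
      p 0 * (∑ k, t.even i j k * t.trace k) + p 1 * (t.trace i * t.trace j) +
        p 2 * (∑ k, t.even i j k * t.act k) + p 3 * (t.act i * t.act j)) y := by
    intro x y
    simp only [rowForm_ofFn, Table.form, Table.trace_evenProduct, Table.actForm_apply,
      Table.evenProduct_apply, IntTable.half, halfEven, halfAct, IntTable.trace, Fin.sum_univ_three]
    push_cast
    ring
  have h : (t.half 1).radical p = solutions 3 (t.gramRows p) := by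
    ext y
    simp only [mem_solutions, IntTable.gramRows, List.forall_mem_map, List.mem_finRange,
      forall_const, Table.mem_radical, key]
    constructor
    · intro h i
      simpa [Pi.single_apply] using h (Pi.single i 1)
    · intro h x
      simp only [h, mul_zero, Finset.sum_const_zero]
  rw [h, finrank_solutions]

theorem eq_of_isIsomorphic (i j : Fin 59) (h : (classified i).IsIsomorphic (classified j)) :
    i = j := by
  have h1 := orbit_add_finrank_derivations i
  have h2 := orbit_add_finrank_derivations j
  rw [← h.finrank_derivations_eq] at h2
  have h3 : (intRows i).orbit = (intRows j).orbit := by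
    rw [rows_eq] at h1 h2
    exact Nat.add_right_cancel (h1.trans h2.symm)
  rw [classified_eq, classified_eq] at h
  refine code_injective i j ?_
  rw [IntRow.code, IntRow.code, h3]
  congr 2
  funext k
  rw [← finrank_radical, ← finrank_radical, finrank_radical_eq h]

end Superalgebra

namespace Superalgebra

/-! ### Decompositions -/

/-- The summand `k` of a line is spanned by consecutive basis vectors (cyclically), beginning with
the vector `start` for the first summand; this is the index of its basis vector `j`. -/
def IntRow.position (r : IntRow) (start : ℕ) (k : Fin r.summands.length)
    (j : Fin (r.summands.get k).m) : Fin 3 :=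
  Fin.ofNat 3 (start + ((r.summands.take k).map IntSummand.m).sum + j)

/-- The multiplication table of a line is composed of those of its summands. -/
structure IntRow.Decomposes (r : IntRow) (start : ℕ) : Prop where
  even_bijective : Function.Bijective fun p : Σ k : Fin r.summands.length,
    Fin (r.summands.get k).m => r.position start p.1 p.2
  odd_bijective : Function.Bijective fun _ : Σ k : Fin r.summands.length,
    Fin (r.summands.get k).n => (0 : Fin 1)
  even : ∀ k l i j, r.table.even i j (r.position start k l) =
    ∑ i', ∑ j', if r.position start k i' = i ∧ r.position start k j' = j then
      (r.summands.get k).table.even i' j' l else 0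
  act : ∀ k, (r.summands.get k).n ≠ 0 → ∀ i, r.table.act i =
    ∑ i', if r.position start k i' = i then (r.summands.get k).table.act i' else 0

theorem IntRow.decomposes_iff (r : IntRow) (start : ℕ) : r.Decomposes start ↔
    (Function.Bijective fun p : Σ k : Fin r.summands.length,
      Fin (r.summands.get k).m => r.position start p.1 p.2) ∧
    (Function.Bijective fun _ : Σ k : Fin r.summands.length,
      Fin (r.summands.get k).n => (0 : Fin 1)) ∧
    (∀ k l i j, r.table.even i j (r.position start k l) =
      ∑ i', ∑ j', if r.position start k i' = i ∧ r.position start k j' = j then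
        (r.summands.get k).table.even i' j' l else 0) ∧
    ∀ k, (r.summands.get k).n ≠ 0 → ∀ i, r.table.act i =
      ∑ i', if r.position start k i' = i then (r.summands.get k).table.act i' else 0 :=
  ⟨fun h => ⟨h.1, h.2, h.3, h.4⟩, fun h => ⟨h.1, h.2.1, h.2.2.1, h.2.2.2⟩⟩

instance (r : IntRow) (start : ℕ) : Decidable (r.Decomposes start) :=
  decidable_of_iff' _ (r.decomposes_iff start)

/-- Indices 30 and 31 are the two lines that list the summand on e₃ and f before B₃; counting
cyclically from e₃ puts their summands in the listed order. -/
theorem decomposes_intRows :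
    ∀ i : Fin 59, (intRows i).Decomposes (if i = 30 ∨ i = 31 then 2 else 0) := by
  decide +kernel

theorem sum_sum_comm {α β : Type*} [Fintype α] [Fintype β] (f : α → α → β → β → ℂ) :
    ∑ i, ∑ j, ∑ i', ∑ j', f i j i' j' = ∑ i', ∑ j', ∑ i, ∑ j, f i j i' j' := by
  have h := Finset.sum_comm (s := Finset.univ) (t := Finset.univ)
    (f := fun (p : α × α) (q : β × β) => f p.1 p.2 q.1 q.2)
  simpa only [Fintype.sum_prod_type] using h

section
variable {ι : Type*} [Fintype ι] {s : ι → Summand} {t : Table 3 1}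

/-- The isomorphism only regroups coordinates into blocks along σ. The hypotheses say that a product
has a component in block k only through the block k components of its factors, and that f is acted
on only by its own block. -/
theorem isIsomorphic_directSum (σ : ∀ k, Fin (s k).m → Fin 3)
    (hσ : Function.Bijective fun p : Σ k, Fin (s k).m => σ p.1 p.2)
    (hτ : Function.Bijective fun _ : Σ k, Fin (s k).n => (0 : Fin 1))
    (he : ∀ k l i j, t.even i j (σ k l) =
      ∑ i', ∑ j', if σ k i' = i ∧ σ k j' = j then (s k).table.even i' j' l else 0)
    (ha : ∀ k, (s k).n ≠ 0 → ∀ i, t.act i =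
      ∑ i', if σ k i' = i then (s k).table.act i' else 0) :
    t.alg.IsIsomorphic (directSum fun k => (s k).table.alg) := by
  let e := Equiv.ofBijective _ hσ
  let e' := Equiv.ofBijective _ hτ
  have he1 : ∀ k l, e.symm (σ k l) = ⟨k, l⟩ := fun k l => e.symm_apply_apply ⟨k, l⟩
  have he2 : ∀ p, σ (e.symm p).1 (e.symm p).2 = p := e.apply_symm_apply
  have he3 : ∀ k l, e'.symm 0 = ⟨k, l⟩ := fun k l => e'.symm_apply_apply ⟨k, l⟩
  refine ⟨
    { toFun := fun x k => (fun l => x.1 (σ k l), fun _ => x.2 0)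
      map_add' := fun x y => rfl
      map_smul' := fun c x => rfl
      -- The odd coordinate is read in the unique block that has one; in all other blocks the odd
      -- component is a function on an empty type.
      invFun := fun y => (fun i => (y (e.symm i).1).1 (e.symm i).2,
        fun _ => (y (e'.symm 0).1).2 (e'.symm 0).2)
      left_inv := fun x => ?_
      right_inv := fun y => ?_ }, fun x y => ?_, fun i x => ?_⟩
  · refine Prod.ext (funext fun i => ?_) (funext fun i => ?_)
    · simp only [he2]
    · rw [Subsingleton.elim i 0]
  · refine funext fun k => Prod.ext (funext fun l => ?_) (funext fun l => ?_)
    · exact congrArg (fun p : Σ k, Fin (s k).m => (y p.1).1 p.2) (he1 k l)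
    · exact congrArg (fun p : Σ k, Fin (s k).n => (y p.1).2 p.2) (he3 k l)
  · refine funext fun k => Prod.ext (funext fun l => ?_) (funext fun l => ?_)
    · change ∑ i, ∑ j, t.even i j (σ k l) * (x.1 i * y.1 j) =
        ∑ i, ∑ j, (s k).table.even i j l * (x.1 (σ k i) * y.1 (σ k j))
      simp only [he, Finset.sum_mul, ite_mul, zero_mul]
      rw [sum_sum_comm]
      refine Finset.sum_congr rfl fun i' _ => Finset.sum_congr rfl fun j' _ => ?_
      rw [Fintype.sum_eq_single (σ k i') fun i hi => by simp [hi.symm],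
        Fintype.sum_eq_single (σ k j') fun j hj => by simp [hj.symm]]
      simp
    · have hk : (s k).n ≠ 0 := by
        have := l.2
        omega
      change (∑ i, t.act i * x.1 i) * y.2 0 + (∑ i, t.act i * y.1 i) * x.2 0 =
        (∑ i, (s k).table.act i * x.1 (σ k i)) * y.2 0 +
          (∑ i, (s k).table.act i * y.1 (σ k i)) * x.2 0
      have key : ∀ x : Fin 3 → ℂ, ∑ i, t.act i * x i = ∑ i, (s k).table.act i * x (σ k i) := by
        intro x
        simp only [ha k hk, Finset.sum_mul, ite_mul, zero_mul]
        rw [Finset.sum_comm]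
        simp
      rw [key, key]
  · rcases zmod_two_cases i with rfl | rfl
    · rw [mem_grade_zero]
      change _ ↔ _ ∈ Submodule.pi _ _
      simp only [Submodule.mem_pi, Set.mem_univ, forall_const, mem_grade_zero]
      refine ⟨fun h k => funext fun l => congrFun h 0, fun h => funext fun i => ?_⟩
      rw [Subsingleton.elim i 0]
      exact congrFun (h (e'.symm 0).1) (e'.symm 0).2
    · rw [mem_grade_one]
      change _ ↔ _ ∈ Submodule.pi _ _
      simp only [Submodule.mem_pi, Set.mem_univ, forall_const, mem_grade_one]
      refine ⟨fun h k => funext fun l => congrFun h _, fun h => funext fun i => ?_⟩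
      have h' : x.1 (σ (e.symm i).1 (e.symm i).2) = 0 := congrFun (h (e.symm i).1) (e.symm i).2
      rwa [he2] at h'

end

/-- The underlying space of the sum depends on the list of summands. Transport along an equality of
lists is done here once, in a form in which it can be substituted. -/
theorem IsIsomorphic.directSum_list {A : Type*} [AddCommGroup A] [Module ℂ A] {S : Superalgebra A}
    {l : List Summand} {n : ℕ} {s : Fin n → Summand} (hl : l = List.ofFn s)
    (h : S.IsIsomorphic (directSum fun k => (s k).table.alg)) :
    S.IsIsomorphic (directSum fun k : Fin l.length => (l.get k).table.alg) := by
  obtain rfl : l.length = n := by rw [hl, List.length_ofFn]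
  obtain rfl : s = l.get := List.ofFn_injective (hl.symm.trans (List.ofFn_get l).symm)
  exact h

theorem isIsomorphic_summandSum (i : Fin 59) : (classified i).IsIsomorphic (summandSum i) := by
  obtain ⟨h1, h2, h3, h4⟩ := decomposes_intRows i
  refine IsIsomorphic.directSum_list (n := (intRows i).summands.length)
    (s := fun k => ((intRows i).summands.get k).half) ?_ ?_
  · rw [rows_eq, IntRow.half]
    conv_lhs => rw [← List.ofFn_get (intRows i).summands]
    rw [List.map_ofFn]
    rfl
  · rw [classified_eq]
    refine isIsomorphic_directSum _ h1 h2 (fun k l a b => ?_) fun k hk a => ?_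
    · have h : ((_ : ℤ) : ℂ) = ((_ : ℤ) : ℂ) := congrArg _ (h3 k l a b)
      push_cast at h
      simp only [IntTable.half, halfEven, IntSummand.half]
      rw [h]
      simp only [Finset.sum_div, ite_div, zero_div]
      rfl
    · have h : ((_ : ℤ) : ℂ) = ((_ : ℤ) : ℂ) := congrArg _ (h4 k hk a)
      push_cast at h
      simp only [IntTable.half, halfAct, IntSummand.half]
      rw [h]
      simp only [Finset.sum_div, ite_div, zero_div]
      rfl

end Superalgebra

namespace Superalgebra

/-! ### Power associativity and idempotents -/

namespace IsJordanProduct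
variable {V : Type*} [AddCommGroup V] [Module ℂ V] {μ : V →ₗ[ℂ] V →ₗ[ℂ] V}

/-- The linearized Jordan identity read as an equation of operators applied to t. It expresses
multiplication by a longer product through multiplications by shorter ones. -/
theorem mul_op_mul_mul (h : IsJordanProduct μ) (x y z : V) : μ (μ (μ x y) z) =
    μ (μ x y) * μ z + μ (μ y z) * μ x + μ (μ x z) * μ y - μ y * μ z * μ x - μ x * μ z * μ y := by
  ext t
  have hj := h.jordan x y z t
  simp only [LinearMap.sub_apply, LinearMap.add_apply, Module.End.mul_apply]
  rw [h.comm (μ y z), h.comm y (μ z (μ x t)), h.comm z (μ x t), h.comm x (μ z (μ y t)),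
    h.comm z (μ y t)]
  linear_combination (norm := module) hj

/-- With x in three of the four places the linearized identity becomes three times (x²t)x = x²(tx).
-/
theorem commute_sq (h : IsJordanProduct μ) (x : V) :
    Commute (μ x : Module.End ℂ V) (μ (μ x x)) := by
  ext t
  have hj := h.jordan x x t x
  simp only [Module.End.mul_apply]
  rw [h.comm x, h.comm x t]
  have h3 : (3 : ℂ) • μ (μ (μ x x) t) x = (3 : ℂ) • μ (μ x x) (μ t x) := by
    rw [h.comm x t, h.comm (μ t x) (μ x x)] at hj
    linear_combination (norm := module) hj
  exact smul_right_injective V (three_ne_zero' ℂ) h3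

/-- The vector is the power x^(n+1). By the operator identity, multiplication by the next power is a
polynomial in multiplications that commute with that by x. -/
theorem commute_pow (h : IsJordanProduct μ) (x : V) (n : ℕ) :
    Commute (μ x : Module.End ℂ V) (μ (((μ x : Module.End ℂ V) ^ n) x)) := by
  induction n using Nat.twoStepInduction with
  | zero => exact Commute.refl _
  | one => simpa using h.commute_sq x
  | more n ih1 ih2 =>
    have hs : ∀ m, ((μ x : Module.End ℂ V) ^ (m + 1)) x = μ x (((μ x : Module.End ℂ V) ^ m) x) :=
      fun m => by rw [pow_succ', Module.End.mul_apply]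
    have key := h.mul_op_mul_mul x (((μ x : Module.End ℂ V) ^ n) x) x
    rw [h.comm (μ x (((μ x : Module.End ℂ V) ^ n) x)) x, h.comm _ x, ← hs, ← hs] at key
    rw [key]
    have c0 : Commute (μ x : Module.End ℂ V) (μ x) := Commute.refl _
    exact ((((ih2.mul_right c0).add_right (ih2.mul_right c0)).add_right
      ((h.commute_sq x).mul_right ih1)).sub_right ((ih1.mul_right c0).mul_right c0)).sub_right
      ((c0.mul_right c0).mul_right ih1)

open Polynomial in
theorem commute_aeval (h : IsJordanProduct μ) (x : V) (q : ℂ[X]) :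
    Commute (μ x : Module.End ℂ V) (μ (aeval (μ x : Module.End ℂ V) q x)) := by
  induction q using Polynomial.induction_on' with
  | add p q hp hq =>
    rw [map_add, LinearMap.add_apply, map_add]
    exact hp.add_right hq
  | monomial n a =>
    rw [aeval_monomial, Module.End.mul_apply, Module.algebraMap_end_apply, map_smul]
    exact (h.commute_pow x n).smul_right a

open Polynomial in
theorem commute_aeval_aeval (h : IsJordanProduct μ) (x : V) (q r : ℂ[X]) :
    Commute (aeval (μ x : Module.End ℂ V) r) (μ (aeval (μ x : Module.End ℂ V) q x)) := by
  induction r using Polynomial.induction_on' with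
  | add p r hp hr =>
    rw [map_add]
    exact hp.add_left hr
  | monomial n a =>
    rw [aeval_monomial, Algebra.algebraMap_eq_smul_one, smul_mul_assoc, one_mul]
    exact ((h.commute_aeval x q).pow_left n).smul_left a

-- Power associativity. The operator r(L) commutes with multiplication by q(L)x and can be pulled
-- out, leaving (q(L)x)·x = Lq(L)x; the factor X accounts for this L.
open Polynomial in
theorem aeval_mul_aeval (h : IsJordanProduct μ) (x : V) (q r : ℂ[X]) :
    μ (aeval (μ x : Module.End ℂ V) q x) (aeval (μ x : Module.End ℂ V) r x) =
      aeval (μ x : Module.End ℂ V) (X * q * r) x := by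
  have h1 := LinearMap.congr_fun (h.commute_aeval_aeval x q r).eq x
  simp only [Module.End.mul_apply] at h1
  rw [← h1, h.comm _ x, mul_comm, map_mul, map_mul, aeval_X, Module.End.mul_apply,
    Module.End.mul_apply]

theorem pow_mul_pow (h : IsJordanProduct μ) (x : V) (m n : ℕ) :
    μ (((μ x : Module.End ℂ V) ^ m) x) (((μ x : Module.End ℂ V) ^ n) x) =
      ((μ x : Module.End ℂ V) ^ (m + n + 1)) x := by
  have key := h.aeval_mul_aeval x (Polynomial.X ^ m) (Polynomial.X ^ n)
  simp only [map_pow, map_mul, Polynomial.aeval_X] at key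
  rw [key, ← pow_succ', ← pow_add]
  congr 2
  omega

open Polynomial in
/-- An element is nilpotent or some polynomial in it without constant term is a nonzero
idempotent. -/
theorem nilpotent_or_exists_idempotent [FiniteDimensional ℂ V] (h : IsJordanProduct μ) (x : V) :
    (∃ k, ((μ x : Module.End ℂ V) ^ k) x = 0) ∨
      ∃ q : ℂ[X], aeval (μ x : Module.End ℂ V) q x ≠ 0 ∧
        μ (aeval (μ x : Module.End ℂ V) q x) (aeval (μ x : Module.End ℂ V) q x) =
          aeval (μ x : Module.End ℂ V) q x := by
  set L : Module.End ℂ V := μ x with hL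
  have hm : minpoly ℂ L ≠ 0 := minpoly.ne_zero (Algebra.IsIntegral.isIntegral L)
  -- Fitting decomposition of L: the minimal polynomial is X^k·r with r prime to X, and sX^(k+1) +
  -- wr = 1. The candidate for the idempotent is (X^k·s)(L)x.
  obtain ⟨r, hr, hndvd⟩ := Polynomial.exists_eq_pow_rootMultiplicity_mul_and_not_dvd _ hm 0
  set k := rootMultiplicity 0 (minpoly ℂ L)
  rw [C_0, sub_zero] at hr hndvd
  have hcop : IsCoprime (X ^ (k + 1) : ℂ[X]) r :=
    ((Polynomial.irreducible_X.coprime_iff_not_dvd).2 hndvd).pow_left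
  obtain ⟨s, w, hsw⟩ := hcop
  have hmin : aeval L (X ^ k * r) = 0 := by
    rw [← hr]
    exact minpoly.aeval ℂ L
  by_cases he : aeval L (X ^ k * s) x = 0
  · left
    refine ⟨k, ?_⟩
    -- If the candidate vanishes, the Bézout relation times X^k exhibits L^k x as zero.
    have h1 : (X ^ k : ℂ[X]) = X ^ (k + 1) * (X ^ k * s) + w * (X ^ k * r) := by
      linear_combination (-X ^ k) * hsw
    have h2 : L ^ k = aeval L (X ^ k : ℂ[X]) := by simp
    rw [h2, h1, map_add, map_mul, map_mul _ w, hmin, mul_zero, add_zero, Module.End.mul_apply, he,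
      map_zero]
  · right
    refine ⟨X ^ k * s, he, ?_⟩
    rw [h.aeval_mul_aeval]
    -- The square of X^k·s, in the sense of `aeval_mul_aeval`, equals X^k·s modulo the minimal
    -- polynomial.
    have h1 : X * (X ^ k * s) * (X ^ k * s) = X ^ k * s - s * w * (X ^ k * r) := by
      linear_combination (X ^ k * s) * hsw
    rw [h1, map_sub, map_mul _ (s * w), hmin, mul_zero, sub_zero]

open Polynomial in
/-- In a unital Jordan algebra without further idempotents each element is a scalar plus a nilpotent
element. -/
theorem exists_sub_smul_nilpotent [FiniteDimensional ℂ V] (h : IsJordanProduct μ) {e : V}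
    (he : e ≠ 0) (hunit : ∀ x, μ e x = x) (hid : ∀ f, μ f f = f → f = 0 ∨ f = e) (x : V) :
    ∃ (c : ℂ) (k : ℕ), ((μ (x - c • e) : Module.End ℂ V) ^ k) (x - c • e) = 0 := by
  set L : Module.End ℂ V := μ x with hL
  -- U = ℂ[L]e is stable under L. The scalar c is an eigenvalue of L on U, with an eigenvector of
  -- the form u = g(L)e.
  let U : Submodule ℂ V := LinearMap.range
    ((LinearMap.applyₗ e : (V →ₗ[ℂ] V) →ₗ[ℂ] V) ∘ₗ (aeval L).toLinearMap)
  have hmemU : ∀ u, u ∈ U ↔ ∃ g : ℂ[X], aeval L g e = u := fun u => Iff.rfl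
  have hLU : ∀ u ∈ U, L u ∈ U := by
    rintro u hu
    obtain ⟨g, rfl⟩ := (hmemU u).1 hu
    exact (hmemU _).2 ⟨X * g, by simp⟩
  have hU : Nontrivial U := ⟨⟨⟨e, (hmemU e).2 ⟨1, by simp⟩⟩, 0, fun h => he (congrArg Subtype.val h)⟩⟩
  obtain ⟨c, hc⟩ := Module.End.exists_eigenvalue (L.restrict hLU)
  obtain ⟨⟨u, hu⟩, hu1, hu2⟩ := hc.exists_hasEigenvector
  rw [Module.End.mem_eigenspace_iff] at hu1
  have hu3 : L u = c • u := congrArg Subtype.val hu1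
  have hu0 : u ≠ 0 := fun h => hu2 (Subtype.ext h)
  refine ⟨c, (h.nilpotent_or_exists_idempotent (x - c • e)).resolve_right ?_⟩
  rintro ⟨q, hq0, hq⟩
  set M : Module.End ℂ V := μ (x - c • e) with hM
  have hML : M = L - c • 1 := by
    ext v
    simp [hM, hL, hunit]
  have hqe := (hid _ hq).resolve_left hq0
  have hy : x - c • e = M e := by
    rw [hM, h.comm, hunit]
  obtain ⟨g, rfl⟩ := (hmemU u).1 hu
  have hcomm : Commute (aeval L g) (aeval M q * M) := by
    have h1 : Commute L M := by
      rw [hML]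
      exact (Commute.refl L).sub_right ((Commute.one_right L).smul_right c)
    have h2 : Commute (aeval L g) M :=
      Algebra.commute_of_mem_adjoin_singleton_of_commute (aeval_mem_adjoin_singleton ℂ L) h1.symm |>.symm
    exact (Algebra.commute_of_mem_adjoin_singleton_of_commute (aeval_mem_adjoin_singleton ℂ M) h2).mul_right h2
  refine hu0 ?_
  -- If x - ce were not nilpotent, then the idempotent q(M)(x - ce) = q(M)Me would be e. As g(L)
  -- commutes with q(M)M, applying it gives u = q(M)Mu, while Mu = Lu - cu = 0.
  have hfin : aeval L g e = aeval M q (M (aeval L g e)) := by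
    conv_lhs => rw [← hqe, hy]
    exact LinearMap.congr_fun hcomm.eq e
  rw [hfin, hML, LinearMap.sub_apply, hu3]
  simp

end IsJordanProduct

end Superalgebra

namespace Superalgebra

/-! ### Bases of three-dimensional spaces -/

section basis
variable {V : Type*} [AddCommGroup V] [Module ℂ V] {x y z : V}

theorem linearIndependent_triple_iff : LinearIndependent ℂ ![x, y, z] ↔
    ∀ a b c : ℂ, a • x + b • y + c • z = 0 → a = 0 ∧ b = 0 ∧ c = 0 := by
  rw [Fintype.linearIndependent_iff]
  constructor
  · intro h a b c habc
    have h1 := h ![a, b, c] (by simpa [Fin.sum_univ_three] using habc)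
    exact ⟨h1 0, h1 1, h1 2⟩
  · intro h g hg
    obtain ⟨h0, h1, h2⟩ := h (g 0) (g 1) (g 2) (by simpa [Fin.sum_univ_three] using hg)
    intro i
    fin_cases i
    exacts [h0, h1, h2]

theorem exists_coordinates (hV : Module.finrank ℂ V = 3) (h : LinearIndependent ℂ ![x, y, z]) :
    ∃ f g k : V →ₗ[ℂ] ℂ, (f x = 1 ∧ f y = 0 ∧ f z = 0) ∧ (g x = 0 ∧ g y = 1 ∧ g z = 0) ∧
      (k x = 0 ∧ k y = 0 ∧ k z = 1) ∧ ∀ v, v = f v • x + g v • y + k v • z := by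
  let b := basisOfLinearIndependentOfCardEqFinrank h (by simp [hV])
  have hb : ∀ i, b i = ![x, y, z] i := fun i => by simp [b]
  have hx : b 0 = x := hb 0
  have hy : b 1 = y := hb 1
  have hz : b 2 = z := hb 2
  refine ⟨b.coord 0, b.coord 1, b.coord 2, ?_, ?_, ?_, fun v => ?_⟩
  · rw [← hx, ← hy, ← hz]
    simp
  · rw [← hx, ← hy, ← hz]
    simp
  · rw [← hx, ← hy, ← hz]
    simp
  · conv_lhs => rw [← b.sum_repr v]
    rw [Fin.sum_univ_three, hx, hy, hz]
    rfl

theorem exists_coefficients (hV : Module.finrank ℂ V = 3) (h : LinearIndependent ℂ ![x, y, z])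
    (v : V) : ∃ a b c : ℂ, v = a • x + b • y + c • z := by
  obtain ⟨f, g, k, -, -, -, hv⟩ := exists_coordinates hV h
  exact ⟨_, _, _, hv v⟩

theorem linearIndependent_triple_change (h : LinearIndependent ℂ ![x, y, z]) {x' y' z' : V}
    (a b c a' b' c' a'' b'' c'' : ℂ) (hx : x' = a • x + b • y + c • z)
    (hy : y' = a' • x + b' • y + c' • z) (hz : z' = a'' • x + b'' • y + c'' • z)
    (hdet : a * (b' * c'' - c' * b'') - b * (a' * c'' - c' * a'') + c * (a' * b'' - b' * a'') ≠ 0) :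
    LinearIndependent ℂ ![x', y', z'] := by
  rw [linearIndependent_triple_iff] at h ⊢
  intro r s t hrst
  obtain ⟨h1, h2, h3⟩ := h (r * a + s * a' + t * a'') (r * b + s * b' + t * b'')
    (r * c + s * c' + t * c'') (by rw [← hrst, hx, hy, hz]; module)
  refine ⟨(mul_eq_zero.1 ?_).resolve_right hdet, (mul_eq_zero.1 ?_).resolve_right hdet,
    (mul_eq_zero.1 ?_).resolve_right hdet⟩
  -- Cramer's rule: the coefficients are the cofactors of the change of basis matrix.
  · linear_combination h1 * (b' * c'' - c' * b'') - h2 * (a' * c'' - c' * a'') +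
      h3 * (a' * b'' - b' * a'')
  · linear_combination -h1 * (b * c'' - c * b'') + h2 * (a * c'' - c * a'') -
      h3 * (a * b'' - b * a'')
  · linear_combination h1 * (b * c' - c * b') - h2 * (a * c' - c * a') + h3 * (a * b' - b * a')

theorem linearIndependent_triple_swap (h : LinearIndependent ℂ ![x, y, z]) :
    LinearIndependent ℂ ![x, z, y] :=
  linearIndependent_triple_change h 1 0 0 0 0 1 0 1 0 (by module) (by module) (by module) (by simp)

theorem linearIndependent_triple_rotate (h : LinearIndependent ℂ ![x, y, z]) :
    LinearIndependent ℂ ![y, z, x] :=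
  linearIndependent_triple_change h 0 1 0 0 0 1 1 0 0 (by module) (by module) (by module) (by simp)

theorem linearIndependent_triple_of_notMem (hx : x ≠ 0) (hy : y ∉ Submodule.span ℂ {x})
    (hz : z ∉ Submodule.span ℂ {x, y}) : LinearIndependent ℂ ![x, y, z] := by
  rw [linearIndependent_triple_iff]
  intro a b c h
  have hc : c = 0 := by
    by_contra hc
    refine hz (Submodule.mem_span_pair.2 ⟨-c⁻¹ * a, -c⁻¹ * b, ?_⟩)
    apply smul_right_injective V hc
    simp only [smul_add, smul_smul, mul_assoc, mul_neg, neg_mul, mul_inv_cancel_left₀ hc]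
    linear_combination (norm := module) -h
  subst hc
  have hb : b = 0 := by
    by_contra hb
    refine hy (Submodule.mem_span_singleton.2 ⟨-b⁻¹ * a, ?_⟩)
    apply smul_right_injective V hb
    simp only [smul_add, smul_smul, mul_assoc, mul_neg, neg_mul, mul_inv_cancel_left₀ hb]
    linear_combination (norm := module) -h
  subst hb
  simpa [hx] using h

theorem exists_mem_notMem {E : Set V} (hE : Submodule.span ℂ E = ⊤) {W : Submodule ℂ V}
    (hW : W ≠ ⊤) : ∃ v ∈ E, v ∉ W := by
  by_contra! h
  exact hW (top_le_iff.1 (hE ▸ Submodule.span_le.2 h))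

theorem span_singleton_ne_top (hV : Module.finrank ℂ V = 3) (x : V) :
    Submodule.span ℂ {x} ≠ ⊤ := by
  intro h
  have h1 := finrank_span_le_card (R := ℂ) ({x} : Set V)
  rw [h, finrank_top, hV] at h1
  simp at h1

theorem span_pair_ne_top (hV : Module.finrank ℂ V = 3) (x y : V) :
    Submodule.span ℂ {x, y} ≠ ⊤ := by
  classical
  intro h
  have h1 := finrank_span_finset_le_card (R := ℂ) ({x, y} : Finset V)
  rw [Finset.coe_pair, Set.finrank, h, finrank_top, hV] at h1
  exact absurd (h1.trans Finset.card_le_two) (by norm_num)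

/-- A spanning set contains a basis that starts with a given nonzero vector and then stays in the
set. -/
theorem exists_linearIndependent_triple (hV : Module.finrank ℂ V = 3) (hx : x ≠ 0) {E : Set V}
    (hE : Submodule.span ℂ E = ⊤) : ∃ y ∈ E, ∃ z ∈ E, LinearIndependent ℂ ![x, y, z] := by
  obtain ⟨y, hyE, hy⟩ := exists_mem_notMem hE (span_singleton_ne_top hV x)
  obtain ⟨z, hzE, hz⟩ := exists_mem_notMem hE (span_pair_ne_top hV x y)
  exact ⟨y, hyE, z, hzE, linearIndependent_triple_of_notMem hx hy hz⟩

theorem linearIndependent_iterate {L : Module.End ℂ V} (h2 : L (L x) ≠ 0) (h3 : L (L (L x)) = 0) :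
    LinearIndependent ℂ ![x, L x, L (L x)] := by
  rw [linearIndependent_triple_iff]
  intro a b c h
  have ha : a = 0 := by
    have := congrArg (fun v => L (L v)) h
    simpa [h3, h2] using this
  subst ha
  have hb : b = 0 := by
    have := congrArg L h
    simpa [h3, h2] using this
  subst hb
  simpa [h2] using h

/-- The kernels of the powers of L become stationary at the exponent dim V = 3 at the latest. -/
theorem pow_three_eq_zero (hV : Module.finrank ℂ V = 3) {L : Module.End ℂ V} {k : ℕ}
    (h : (L ^ k) x = 0) : (L ^ 3) x = 0 := by
  have : Module.Finite ℂ V := Module.finite_of_finrank_pos (by omega)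
  have h1 := Module.End.ker_pow_le_ker_pow_finrank L k
  rw [hV] at h1
  exact h1 h

end basis

end Superalgebra

namespace Superalgebra

/-! ### Three-dimensional Jordan algebras -/

/-- The even multiplications on `e₁, e₂, e₃`. -/
noncomputable def evens : Fin 19 → Fin 3 → Fin 3 → Fin 3 → ℂ :=
  ![evenUUU, evenUUN, evenUNN, evenB₁U, evenB₁N, evenB₂U, evenB₂N, evenB₃U, evenB₃N, evenT₁, evenT₂,
    evenT₃, evenT₄, evenT₅, evenT₆, evenT₇, evenT₈, evenT₉, evenT₁₀]

section
variable {V : Type*} [AddCommGroup V] [Module ℂ V]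

/-- The product `μ` has the structure constants `c` in the basis `x, y, z`. -/
structure Realizes (μ : V →ₗ[ℂ] V →ₗ[ℂ] V) (c : Fin 3 → Fin 3 → Fin 3 → ℂ) (x y z : V) :
    Prop where
  linearIndependent : LinearIndependent ℂ ![x, y, z]
  mul_xx : μ x x = c 0 0 0 • x + c 0 0 1 • y + c 0 0 2 • z
  mul_xy : μ x y = c 0 1 0 • x + c 0 1 1 • y + c 0 1 2 • z
  mul_xz : μ x z = c 0 2 0 • x + c 0 2 1 • y + c 0 2 2 • z
  mul_yy : μ y y = c 1 1 0 • x + c 1 1 1 • y + c 1 1 2 • z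
  mul_yz : μ y z = c 1 2 0 • x + c 1 2 1 • y + c 1 2 2 • z
  mul_zz : μ z z = c 2 2 0 • x + c 2 2 1 • y + c 2 2 2 • z

/-- The product has one of the listed multiplication tables in some basis. -/
def IsListed (μ : V →ₗ[ℂ] V →ₗ[ℂ] V) : Prop := ∃ k x y z, Realizes μ (evens k) x y z

variable {μ : V →ₗ[ℂ] V →ₗ[ℂ] V}

theorem isListed_UUU {x y z : V} (hi : LinearIndependent ℂ ![x, y, z]) (hxx : μ x x = x)
    (hxy : μ x y = 0) (hxz : μ x z = 0) (hyy : μ y y = y) (hyz : μ y z = 0) (hzz : μ z z = z) :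
    IsListed μ := by
  refine ⟨0, x, y, z, hi, ?_, ?_, ?_, ?_, ?_, ?_⟩ <;> simp [evens, evenUUU, rule, *]

theorem isListed_UUN {x y z : V} (hi : LinearIndependent ℂ ![x, y, z]) (hxx : μ x x = x)
    (hxy : μ x y = 0) (hxz : μ x z = 0) (hyy : μ y y = y) (hyz : μ y z = 0) (hzz : μ z z = 0) :
    IsListed μ := by
  refine ⟨1, x, y, z, hi, ?_, ?_, ?_, ?_, ?_, ?_⟩ <;> simp [evens, evenUUN, rule, *]

theorem isListed_UNN {x y z : V} (hi : LinearIndependent ℂ ![x, y, z]) (hxx : μ x x = x)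
    (hxy : μ x y = 0) (hxz : μ x z = 0) (hyy : μ y y = 0) (hyz : μ y z = 0) (hzz : μ z z = 0) :
    IsListed μ := by
  refine ⟨2, x, y, z, hi, ?_, ?_, ?_, ?_, ?_, ?_⟩ <;> simp [evens, evenUNN, rule, *]

theorem isListed_B₁U {x y z : V} (hi : LinearIndependent ℂ ![x, y, z]) (hxx : μ x x = x)
    (hxy : μ x y = y) (hxz : μ x z = 0) (hyy : μ y y = 0) (hyz : μ y z = 0) (hzz : μ z z = z) :
    IsListed μ := by
  refine ⟨3, x, y, z, hi, ?_, ?_, ?_, ?_, ?_, ?_⟩ <;> simp [evens, evenB₁U, rule, *]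

theorem isListed_B₁N {x y z : V} (hi : LinearIndependent ℂ ![x, y, z]) (hxx : μ x x = x)
    (hxy : μ x y = y) (hxz : μ x z = 0) (hyy : μ y y = 0) (hyz : μ y z = 0) (hzz : μ z z = 0) :
    IsListed μ := by
  refine ⟨4, x, y, z, hi, ?_, ?_, ?_, ?_, ?_, ?_⟩ <;> simp [evens, evenB₁N, rule, *]

theorem isListed_B₂U {x y z : V} (hi : LinearIndependent ℂ ![x, y, z]) (hxx : μ x x = x)
    (hxy : μ x y = (1 / 2 : ℂ) • y) (hxz : μ x z = 0) (hyy : μ y y = 0) (hyz : μ y z = 0)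
    (hzz : μ z z = z) : IsListed μ := by
  refine ⟨5, x, y, z, hi, ?_, ?_, ?_, ?_, ?_, ?_⟩ <;> simp [evens, evenB₂U, rule, *]

theorem isListed_B₂N {x y z : V} (hi : LinearIndependent ℂ ![x, y, z]) (hxx : μ x x = x)
    (hxy : μ x y = (1 / 2 : ℂ) • y) (hxz : μ x z = 0) (hyy : μ y y = 0) (hyz : μ y z = 0)
    (hzz : μ z z = 0) : IsListed μ := by
  refine ⟨6, x, y, z, hi, ?_, ?_, ?_, ?_, ?_, ?_⟩ <;> simp [evens, evenB₂N, rule, *]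

theorem isListed_B₃U {x y z : V} (hi : LinearIndependent ℂ ![x, y, z]) (hxx : μ x x = y)
    (hxy : μ x y = 0) (hxz : μ x z = 0) (hyy : μ y y = 0) (hyz : μ y z = 0)
    (hzz : μ z z = z) : IsListed μ := by
  refine ⟨7, x, y, z, hi, ?_, ?_, ?_, ?_, ?_, ?_⟩ <;> simp [evens, evenB₃U, rule, *]

theorem isListed_B₃N {x y z : V} (hi : LinearIndependent ℂ ![x, y, z]) (hxx : μ x x = y)
    (hxy : μ x y = 0) (hxz : μ x z = 0) (hyy : μ y y = 0) (hyz : μ y z = 0)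
    (hzz : μ z z = 0) : IsListed μ := by
  refine ⟨8, x, y, z, hi, ?_, ?_, ?_, ?_, ?_, ?_⟩ <;> simp [evens, evenB₃N, rule, *]

theorem isListed_T₁ {x y z : V} (hi : LinearIndependent ℂ ![x, y, z]) (hxx : μ x x = x)
    (hxy : μ x y = y) (hxz : μ x z = z) (hyy : μ y y = z) (hyz : μ y z = 0) (hzz : μ z z = 0) :
    IsListed μ := by
  refine ⟨9, x, y, z, hi, ?_, ?_, ?_, ?_, ?_, ?_⟩ <;> simp [evens, evenT₁, rule, *]

theorem isListed_T₂ {x y z : V} (hi : LinearIndependent ℂ ![x, y, z]) (hxx : μ x x = x)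
    (hxy : μ x y = y) (hxz : μ x z = z) (hyy : μ y y = 0) (hyz : μ y z = 0) (hzz : μ z z = 0) :
    IsListed μ := by
  refine ⟨10, x, y, z, hi, ?_, ?_, ?_, ?_, ?_, ?_⟩ <;> simp [evens, evenT₂, rule, *]

theorem isListed_T₃ {x y z : V} (hi : LinearIndependent ℂ ![x, y, z]) (hxx : μ x x = y)
    (hxy : μ x y = z) (hxz : μ x z = 0) (hyy : μ y y = 0) (hyz : μ y z = 0) (hzz : μ z z = 0) :
    IsListed μ := by
  refine ⟨11, x, y, z, hi, ?_, ?_, ?_, ?_, ?_, ?_⟩ <;> simp [evens, evenT₃, rule, *]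

theorem isListed_T₄ {x y z : V} (hi : LinearIndependent ℂ ![x, y, z]) (hxx : μ x x = y)
    (hxy : μ x y = 0) (hxz : μ x z = y) (hyy : μ y y = 0) (hyz : μ y z = 0) (hzz : μ z z = 0) :
    IsListed μ := by
  refine ⟨12, x, y, z, hi, ?_, ?_, ?_, ?_, ?_, ?_⟩ <;> simp [evens, evenT₄, rule, *]

theorem isListed_T₅ {x y z : V} (hi : LinearIndependent ℂ ![x, y, z]) (hxx : μ x x = x)
    (hxy : μ x y = 0) (hxz : μ x z = (1 / 2 : ℂ) • z) (hyy : μ y y = y)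
    (hyz : μ y z = (1 / 2 : ℂ) • z) (hzz : μ z z = x + y) : IsListed μ := by
  refine ⟨13, x, y, z, hi, ?_, ?_, ?_, ?_, ?_, ?_⟩ <;> simp [evens, evenT₅, rule, *]

theorem isListed_T₆ {x y z : V} (hi : LinearIndependent ℂ ![x, y, z]) (hxx : μ x x = x)
    (hxy : μ x y = (1 / 2 : ℂ) • y) (hxz : μ x z = z) (hyy : μ y y = 0) (hyz : μ y z = 0)
    (hzz : μ z z = 0) : IsListed μ := by
  refine ⟨14, x, y, z, hi, ?_, ?_, ?_, ?_, ?_, ?_⟩ <;> simp [evens, evenT₆, rule, *]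

theorem isListed_T₇ {x y z : V} (hi : LinearIndependent ℂ ![x, y, z]) (hxx : μ x x = x)
    (hxy : μ x y = (1 / 2 : ℂ) • y) (hxz : μ x z = (1 / 2 : ℂ) • z) (hyy : μ y y = 0)
    (hyz : μ y z = 0) (hzz : μ z z = 0) : IsListed μ := by
  refine ⟨15, x, y, z, hi, ?_, ?_, ?_, ?_, ?_, ?_⟩ <;> simp [evens, evenT₇, rule, *]

theorem isListed_T₈ {x y z : V} (hi : LinearIndependent ℂ ![x, y, z]) (hxx : μ x x = x)
    (hxy : μ x y = (1 / 2 : ℂ) • y) (hxz : μ x z = 0) (hyy : μ y y = z)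
    (hyz : μ y z = 0) (hzz : μ z z = 0) : IsListed μ := by
  refine ⟨16, x, y, z, hi, ?_, ?_, ?_, ?_, ?_, ?_⟩ <;> simp [evens, evenT₈, rule, *]

theorem isListed_T₉ {x y z : V} (hi : LinearIndependent ℂ ![x, y, z]) (hxx : μ x x = x)
    (hxy : μ x y = (1 / 2 : ℂ) • y) (hxz : μ x z = z) (hyy : μ y y = z)
    (hyz : μ y z = 0) (hzz : μ z z = 0) : IsListed μ := by
  refine ⟨17, x, y, z, hi, ?_, ?_, ?_, ?_, ?_, ?_⟩ <;> simp [evens, evenT₉, rule, *]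

theorem isListed_T₁₀ {x y z : V} (hi : LinearIndependent ℂ ![x, y, z]) (hxx : μ x x = x)
    (hxy : μ x y = 0) (hxz : μ x z = (1 / 2 : ℂ) • z) (hyy : μ y y = y)
    (hyz : μ y z = (1 / 2 : ℂ) • z) (hzz : μ z z = 0) : IsListed μ := by
  refine ⟨18, x, y, z, hi, ?_, ?_, ?_, ?_, ?_, ?_⟩ <;> simp [evens, evenT₁₀, rule, *]

/-! #### Algebras without idempotents -/

namespace IsJordanProduct

theorem nilpotent_of_no_idempotent (hV : Module.finrank ℂ V = 3) (h : IsJordanProduct μ)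
    (hid : ∀ f, μ f f = f → f = 0) (x : V) : μ x (μ x (μ x x)) = 0 := by
  have : Module.Finite ℂ V := Module.finite_of_finrank_pos (by omega)
  rcases h.nilpotent_or_exists_idempotent x with ⟨k, hk⟩ | ⟨q, hq0, hq⟩
  · have := pow_three_eq_zero hV hk
    simpa [pow_succ] using this
  · exact absurd (hid _ hq) hq0

/-- Polarizing x³ = 0 makes all multiplications nilpotent. Given u = x² ≠ 0, a third basis vector w
can be chosen with xw = uw = 0, and then w² = qu; only q = 0 and q ≠ 0 have to be distinguished. -/
theorem isListed_or_eq_zero_of_cube_eq_zero (hV : Module.finrank ℂ V = 3) (h : IsJordanProduct μ)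
    (hc : ∀ x, μ x (μ x x) = 0) : IsListed μ ∨ μ = 0 := by
  -- The difference of the cubes of x + y and x - y, up to the vanishing cube of y, is twice x²y +
  -- 2x(xy).
  have lin : ∀ x y, μ (μ x x) y = (-2 : ℂ) • μ x (μ x y) := by
    intro x y
    have h1 := hc (x + y)
    have h2 := hc (x - y)
    simp only [map_add, map_sub, LinearMap.add_apply, LinearMap.sub_apply, hc] at h1 h2
    rw [h.comm y x, h.comm y (μ x x)] at h1 h2
    have h3 : (2 : ℂ) • μ (μ x x) y = (2 : ℂ) • (-2 : ℂ) • μ x (μ x y) := by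
      linear_combination (norm := module) h1 - h2
    exact smul_right_injective V two_ne_zero h3
  -- The operator identity for x³ reads 3L_{x²}L_x - 2L_x³ = 0, and L_{x²} = -2L_x² turns the left
  -- side into -8L_x³.
  have hL : ∀ x y, μ x (μ x (μ x y)) = 0 := by
    intro x y
    have h1 := LinearMap.congr_fun (h.mul_op_mul_mul x x x) y
    rw [h.comm (μ x x) x, hc] at h1
    simp only [map_zero, LinearMap.zero_apply, LinearMap.sub_apply, LinearMap.add_apply,
      Module.End.mul_apply, lin] at h1
    have h3 : (-8 : ℂ) • μ x (μ x (μ x y)) = (-8 : ℂ) • 0 := by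
      rw [smul_zero]
      linear_combination (norm := module) -h1
    exact smul_right_injective V (by norm_num) h3
  by_cases hsq : ∀ x, μ x x = 0
  · right
    ext x y
    have h1 := hsq (x + y)
    simp only [map_add, LinearMap.add_apply, hsq, h.comm y x, zero_add, add_zero] at h1
    have h3 : (2 : ℂ) • μ x y = (2 : ℂ) • 0 := by
      rw [smul_zero]
      linear_combination (norm := module) h1
    simpa using smul_right_injective V two_ne_zero h3
  left
  push Not at hsq
  obtain ⟨x, hx⟩ := hsq
  obtain ⟨u, hu⟩ : ∃ u, μ x x = u := ⟨_, rfl⟩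
  rw [hu] at hx
  have hxu : μ x u = 0 := hu ▸ hc x
  have hux : μ u x = 0 := by rw [h.comm, hxu]
  have huu : μ u u = 0 := by
    have := lin x u
    rwa [hu, hxu, map_zero, smul_zero] at this
  obtain ⟨y, -, hy⟩ := exists_mem_notMem (E := Set.univ) (by simp) (span_pair_ne_top hV x u)
  have hxu' : u ∉ Submodule.span ℂ {x} := by
    rw [Submodule.mem_span_singleton]
    rintro ⟨c, rfl⟩
    rw [map_smul, hu, smul_smul] at hxu
    rcases smul_eq_zero.1 hxu with h0 | h0
    · simp [mul_self_eq_zero.1 h0] at hx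
    · simp [h0] at hx
  have hx0 : x ≠ 0 := fun h0 => hx (by rw [← hu, h0, map_zero])
  have hi := linearIndependent_triple_of_notMem hx0 hxu' hy
  obtain ⟨f, g, k, ⟨hf1, hf2, hf3⟩, ⟨hg1, hg2, hg3⟩, ⟨hk1, hk2, hk3⟩, -⟩ := exists_coordinates hV hi
  obtain ⟨a, b, c, hxy⟩ := exists_coefficients hV hi (μ x y)
  -- A nilpotent multiplication has no nonzero eigenvalue; here the third coordinate of L_x³y is c³.
  -- The same argument for L_y on u gives a = 0 below.
  have hc0 : c = 0 := by
    have h1 := congrArg k (hL x y)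
    simpa [hxy, hu, hxu, hk1, hk2, hk3] using h1
  subst hc0
  rw [zero_smul, add_zero] at hxy
  have huy : μ u y = (-2 * a) • u := by
    rw [← hu, lin, hxy, map_add, map_smul, map_smul, hxu, hu, smul_zero, add_zero, smul_smul]
  have ha0 : a = 0 := by
    have h1 := congrArg g (hL y u)
    simpa [h.comm y u, huy, hg2] using h1
  subst ha0
  rw [zero_smul, zero_add] at hxy
  rw [mul_zero, zero_smul] at huy
  obtain ⟨w, hw⟩ : ∃ w, w = y - b • x := ⟨_, rfl⟩
  have hxw : μ x w = 0 := by
    rw [hw, map_sub, map_smul, hxy, hu, sub_self]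
  have huw : μ u w = 0 := by
    rw [hw, map_sub, map_smul, huy, hux, smul_zero, sub_self]
  have hi2 : LinearIndependent ℂ ![x, u, w] := linearIndependent_triple_change hi 1 0 0 0 1 0 (-b) 0 1
    (by module) (by module) (by rw [hw]; module) (by simp)
  clear hf1 hf2 hf3 hg1 hg2 hg3 hk1 hk2 hk3 f g k
  obtain ⟨f, g, k, ⟨hf1, hf2, hf3⟩, ⟨hg1, hg2, hg3⟩, ⟨hk1, hk2, hk3⟩, -⟩ :=
    exists_coordinates hV hi2
  obtain ⟨p, q, r, hww⟩ := exists_coefficients hV hi2 (μ w w)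
  have hr : r = 0 := by
    have h1 := congrArg k (hc w)
    have hwx : μ w x = 0 := by rw [h.comm, hxw]
    have hwu : μ w u = 0 := by rw [h.comm, huw]
    simpa [hww, hwx, hwu, hk1, hk2, hk3] using h1
  have hp : p = 0 := by
    have h1 := lin w x
    rw [hww, h.comm w x, hxw] at h1
    have h2 := congrArg g h1
    simpa [hu, hux, hr, hg2] using h2
  rw [hr, hp, zero_smul, zero_smul, zero_add, add_zero] at hww
  by_cases hq : q = 0
  · subst hq
    rw [zero_smul] at hww
    exact isListed_B₃N hi2 hu hxu hxw huu huw hww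
  -- With s² = -1/q the vector x + sw has square u + s²qu = 0 and product u with x, as in T₄.
  · obtain ⟨s, hs⟩ := IsAlgClosed.exists_pow_nat_eq (-q⁻¹) two_pos
    have hs0 : s ≠ 0 := by
      rintro rfl
      simp [hq] at hs
    refine isListed_T₄ (z := x + s • w) (linearIndependent_triple_change hi2 1 0 0 0 1 0 1 0 s
      (by module) (by module) (by module) (by simpa using hs0)) hu hxu ?_ huu ?_ ?_
    · rw [map_add, map_smul, hu, hxw, smul_zero, add_zero]
    · rw [map_add, map_smul, hux, huw, smul_zero, add_zero]
    · simp only [map_add, map_smul, LinearMap.add_apply, LinearMap.smul_apply, hu, hxw, hww,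
        h.comm w x, smul_smul, smul_zero, add_zero, zero_add]
      rw [show s * (s * q) = -1 by rw [← mul_assoc, ← sq, hs, neg_mul, inv_mul_cancel₀ hq]]
      module

theorem isListed_or_eq_zero_of_no_idempotent (hV : Module.finrank ℂ V = 3) (h : IsJordanProduct μ)
    (hid : ∀ f, μ f f = f → f = 0) : IsListed μ ∨ μ = 0 := by
  by_cases hc : ∀ x, μ x (μ x x) = 0
  · exact h.isListed_or_eq_zero_of_cube_eq_zero hV hc
  left
  push Not at hc
  obtain ⟨x, hx⟩ := hc
  have h4 := h.nilpotent_of_no_idempotent hV hid x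
  have h11 := h.pow_mul_pow x 1 1
  have h12 := h.pow_mul_pow x 1 2
  have h22 := h.pow_mul_pow x 2 2
  simp only [pow_succ, pow_zero, one_mul, Module.End.mul_apply, h4, map_zero] at h11 h12 h22
  exact isListed_T₃ (linearIndependent_iterate hx h4) rfl rfl h4 h11 h12 h22

end IsJordanProduct
end
end Superalgebra

namespace Superalgebra

/-! #### Peirce decompositions -/

namespace IsJordanProduct
variable {V : Type*} [AddCommGroup V] [Module ℂ V] {μ : V →ₗ[ℂ] V →ₗ[ℂ] V} {e : V}

/-- The linearized identity at e, e, x, y reads (2d - 1)e(xy) = (2d - 1)c·xy. Hence multiplication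
by an element of eigenvalue 0 or 1 preserves the Peirce spaces. -/
theorem peirce_mul (h : IsJordanProduct μ) (he : μ e e = e) {x y : V} {c d : ℂ}
    (hx : μ e x = c • x) (hy : μ e y = d • y) (hd : 2 * d - 1 ≠ 0) :
    μ e (μ x y) = c • μ x y := by
  have hj := h.jordan e e x y
  simp only [he, hx, hy, map_smul, LinearMap.smul_apply, h.comm y x, h.comm (μ x y) e] at hj
  refine smul_right_injective V hd ?_
  linear_combination (norm := module) hj

/-- The square of the Peirce space of eigenvalue 1/2 has no component in that space: on it,
multiplication by e is idempotent. -/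
theorem peirce_half_mul (h : IsJordanProduct μ) (he : μ e e = e) {x y : V}
    (hx : μ e x = (1 / 2 : ℂ) • x) (hy : μ e y = (1 / 2 : ℂ) • y) :
    μ e (μ e (μ x y)) = μ e (μ x y) := by
  have hj := h.jordan x y e e
  simp only [he, h.comm _ e, hx, hy, map_smul, LinearMap.smul_apply, h.comm y x] at hj
  linear_combination (norm := module) hj

theorem fourth_power (h : IsJordanProduct μ) (x : V) :
    μ x (μ x (μ x x)) = μ (μ x x) (μ x x) := by
  simpa [pow_succ] using (h.pow_mul_pow x 1 1).symm

theorem peirce_span (h : IsJordanProduct μ) (he : μ e e = e) :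
    Submodule.span ℂ {x | ∃ c : ℂ, (c = 0 ∨ c = 1 / 2 ∨ c = 1) ∧ μ e x = c • x} = ⊤ := by
  have key : ∀ x, (2 : ℂ) • μ e (μ e (μ e x)) = (3 : ℂ) • μ e (μ e x) - μ e x := by
    intro x
    have hj := h.jordan x e e e
    simp only [he, h.comm _ e] at hj
    linear_combination (norm := module) hj
  rw [eq_top_iff]
  rintro x -
  -- Multiplication by e satisfies 2E³ - 3E² + E = 0, with roots 0, 1/2, 1. The summands are the
  -- Lagrange interpolation projections (1 - E)(1 - 2E), 4E(1 - E) and E(2E - 1).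
  have hx : x = (x - (3 : ℂ) • μ e x + (2 : ℂ) • μ e (μ e x)) +
      ((4 : ℂ) • μ e x - (4 : ℂ) • μ e (μ e x)) + ((2 : ℂ) • μ e (μ e x) - μ e x) := by module
  rw [hx]
  refine Submodule.add_mem _ (Submodule.add_mem _ ?_ ?_) ?_ <;> refine Submodule.subset_span ?_
  · refine ⟨0, by simp, ?_⟩
    simp only [map_add, map_sub, map_smul]
    linear_combination (norm := module) key x
  · refine ⟨1 / 2, by simp, ?_⟩
    simp only [map_add, map_sub, map_smul]
    linear_combination (norm := module) (-2 : ℂ) • key x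
  · refine ⟨1, by simp, ?_⟩
    simp only [map_add, map_sub, map_smul]
    linear_combination (norm := module) key x

/-- Computing x⁴ as x·x³ gives c²/2·e, but as x²·x² it gives c²·e. -/
theorem square_eq_zero_of_half (h : IsJordanProduct μ) (he0 : e ≠ 0) (he : μ e e = e) {x : V}
    (hx : μ e x = (1 / 2 : ℂ) • x) {c : ℂ} (hc : μ x x = c • e) : c = 0 := by
  have h4 := h.fourth_power x
  rw [hc, map_smul, h.comm x e, hx, map_smul, map_smul, hc, map_smul, map_smul,
    LinearMap.smul_apply, he] at h4
  have h5 : (c * c) • e = 0 := by linear_combination (norm := module) (-2 : ℂ) • h4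
  simpa [he0] using h5

variable {p q : V}

/-- The Peirce spaces of 1 and 0 are ideals with product zero. The first is two-dimensional with
unit e, so it is ℂ × ℂ or the dual numbers; the second is a line, spanned by an idempotent or by an
element of square zero. -/
theorem isListed_one_zero (hV : Module.finrank ℂ V = 3) (h : IsJordanProduct μ) (he : μ e e = e)
    (hi : LinearIndependent ℂ ![e, p, q]) (hp : μ e p = p) (hq : μ e q = 0) : IsListed μ := by
  obtain ⟨f, g, k, ⟨hf1, hf2, hf3⟩, ⟨hg1, hg2, hg3⟩, ⟨hk1, hk2, hk3⟩, -⟩ := exists_coordinates hV hi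
  have hp' : μ e p = (1 : ℂ) • p := by rw [hp, one_smul]
  have hq' : μ e q = (0 : ℂ) • q := by rw [hq, zero_smul]
  have hpq : μ p q = 0 := by
    have h1 := h.peirce_mul he hp' hq' (by norm_num)
    have h2 := h.peirce_mul he hq' hp' (by norm_num)
    rw [h.comm q p] at h2
    rw [h2] at h1
    simpa using h1.symm
  obtain ⟨a, b, c, hpp⟩ := exists_coefficients hV hi (μ p p)
  have hc : c = 0 := by
    have h1 := congrArg k (h.peirce_mul he hp' hp' (by norm_num))
    simpa [hpp, he, hp, hq, hk1, hk2, hk3] using h1.symm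
  obtain ⟨a', b', κ, hqq⟩ := exists_coefficients hV hi (μ q q)
  have h1 := h.peirce_mul he hq' hq' (by norm_num)
  have ha' : a' = 0 := by
    simpa [hqq, he, hp, hq, hf1, hf2, hf3] using congrArg f h1
  have hb' : b' = 0 := by
    simpa [hqq, he, hp, hq, hg1, hg2, hg3] using congrArg g h1
  subst hc ha' hb'
  rw [zero_smul, zero_smul, zero_add, zero_add] at hqq
  rw [zero_smul, add_zero] at hpp
  -- Completing the square: p² = ae + bp becomes n² = δe.
  obtain ⟨n, hn⟩ : ∃ n, n = p - (b / 2) • e := ⟨_, rfl⟩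
  have hen : μ e n = n := by rw [hn, map_sub, map_smul, hp, he]
  obtain ⟨δ, hδ⟩ : ∃ δ, δ = a + b * b / 4 := ⟨_, rfl⟩
  have hnn : μ n n = δ • e := by
    simp only [hn, map_sub, map_smul, LinearMap.sub_apply, LinearMap.smul_apply, h.comm p e, hp, he,
      hpp, hδ]
    module
  have hnq : μ n q = 0 := by simp [hn, hpq, hq]
  have hi2 : LinearIndependent ℂ ![e, n, q] := linearIndependent_triple_change hi
    1 0 0 (-(b / 2)) 1 0 0 0 1 (by module) (by rw [hn]; module) (by module) (by simp)
  clear! p f g k a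
  obtain ⟨r, hr0, hr⟩ : ∃ r : ℂ, r ≠ 0 ∧ (κ = 0 ∨ r * κ = 1) := by
    by_cases hκ : κ = 0
    · exact ⟨1, one_ne_zero, Or.inl hκ⟩
    · exact ⟨κ⁻¹, inv_ne_zero hκ, Or.inr (inv_mul_cancel₀ hκ)⟩
  obtain ⟨m, hm⟩ : ∃ m, m = r • q := ⟨_, rfl⟩
  have hem : μ e m = 0 := by simp [hm, hq]
  have hnm : μ n m = 0 := by simp [hm, hnq]
  have hmm : μ m m = 0 ∨ μ m m = m := by
    rw [hm, map_smul, map_smul, LinearMap.smul_apply, hqq, smul_smul, smul_smul]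
    rcases hr with hr | hr
    · left; simp [hr]
    · right; rw [mul_assoc, hr, mul_one]
  have hi3 : LinearIndependent ℂ ![e, n, m] := linearIndependent_triple_change hi2
    1 0 0 0 1 0 0 0 r (by module) (by module) (by rw [hm]; module) (by simpa using hr0)
  by_cases hδ0 : δ = 0
  · rw [hδ0, zero_smul] at hnn
    rcases hmm with hmm | hmm
    · exact isListed_B₁N hi3 he hen hem hnn hnm hmm
    · exact isListed_B₁U hi3 he hen hem hnn hnm hmm
  -- Since (sn)² = e, the elements (e ± sn)/2 are orthogonal idempotents.
  · obtain ⟨s, hs⟩ := IsAlgClosed.exists_pow_nat_eq (δ⁻¹) two_pos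
    have hs0 : s ≠ 0 := by
      rintro rfl
      exact hδ0 (by simpa using hs.symm)
    have hs1 : s * s * δ = 1 := by rw [← sq, hs, inv_mul_cancel₀ hδ0]
    have hne : μ n e = n := by rw [h.comm, hen]
    have hi4 : LinearIndependent ℂ ![(1 / 2 : ℂ) • e + (s / 2) • n, (1 / 2 : ℂ) • e - (s / 2) • n, m] :=
      linearIndependent_triple_change hi3 (1 / 2) (s / 2) 0 (1 / 2) (-(s / 2)) 0 0 0 1
        (by module) (by module) (by module) (by ring_nf; simpa using hs0)
    have hss : (s / 2) • (s / 2) • δ • e = (1 / 4 : ℂ) • e := by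
      rw [smul_smul, smul_smul, show s / 2 * (s / 2) * δ = 1 / 4 by linear_combination hs1 / 4]
    have h11 : μ ((1 / 2 : ℂ) • e + (s / 2) • n) ((1 / 2 : ℂ) • e + (s / 2) • n) =
        (1 / 2 : ℂ) • e + (s / 2) • n := by
      simp only [map_add, map_smul, LinearMap.add_apply, LinearMap.smul_apply, smul_add, he, hen,
        hne, hnn, hss]
      module
    have h12 : μ ((1 / 2 : ℂ) • e + (s / 2) • n) ((1 / 2 : ℂ) • e - (s / 2) • n) = 0 := by
      simp only [map_add, map_sub, map_smul, LinearMap.add_apply, LinearMap.smul_apply, smul_add,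
        he, hen, hne, hnn, hss]
      module
    have h22 : μ ((1 / 2 : ℂ) • e - (s / 2) • n) ((1 / 2 : ℂ) • e - (s / 2) • n) =
        (1 / 2 : ℂ) • e - (s / 2) • n := by
      simp only [map_sub, map_smul, LinearMap.sub_apply, LinearMap.smul_apply, smul_sub, he, hen,
        hne, hnn, hss]
      module
    have h13 : μ ((1 / 2 : ℂ) • e + (s / 2) • n) m = 0 := by simp [hem, hnm]
    have h23 : μ ((1 / 2 : ℂ) • e - (s / 2) • n) m = 0 := by simp [hem, hnm]
    rcases hmm with hmm | hmm
    · exact isListed_UUN hi4 h11 h12 h13 h22 h23 hmm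
    · exact isListed_UUU hi4 h11 h12 h13 h22 h23 hmm

/-- Products of elements of eigenvalue 1/2 lie in ℂe, so `square_eq_zero_of_half` kills all squares
and, by polarization, all products. -/
theorem isListed_half_half (hV : Module.finrank ℂ V = 3) (h : IsJordanProduct μ) (he : μ e e = e)
    (hi : LinearIndependent ℂ ![e, p, q]) (hp : μ e p = (1 / 2 : ℂ) • p)
    (hq : μ e q = (1 / 2 : ℂ) • q) : IsListed μ := by
  have he0 : e ≠ 0 := hi.ne_zero 0
  have key : ∀ x y, μ e x = (1 / 2 : ℂ) • x → μ e y = (1 / 2 : ℂ) • y → ∃ c : ℂ, μ x y = c • e := by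
    intro x y hx hy
    obtain ⟨f, g, k, ⟨hf1, hf2, hf3⟩, ⟨hg1, hg2, hg3⟩, ⟨hk1, hk2, hk3⟩, hfgk⟩ :=
      exists_coordinates hV hi
    obtain ⟨a, b, c, hxy⟩ := exists_coefficients hV hi (μ x y)
    have h1 := h.peirce_half_mul he hx hy
    have hb : b = 0 := by
      simpa [hxy, he, hp, hq, hg1, hg2, hg3] using congrArg g h1
    have hc : c = 0 := by
      simpa [hxy, he, hp, hq, hk1, hk2, hk3] using congrArg k h1
    exact ⟨a, by rw [hxy, hb, hc]; module⟩
  have sq0 : ∀ x, μ e x = (1 / 2 : ℂ) • x → μ x x = 0 := by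
    intro x hx
    obtain ⟨c, hc⟩ := key x x hx hx
    rw [hc, h.square_eq_zero_of_half he0 he hx hc, zero_smul]
  have hpq : μ p q = 0 := by
    have h1 := sq0 (p + q) (by rw [map_add, hp, hq, smul_add])
    simp only [map_add, LinearMap.add_apply, sq0 p hp, sq0 q hq, h.comm q p] at h1
    have h2 : (2 : ℂ) • μ p q = (2 : ℂ) • 0 := by
      rw [smul_zero]
      linear_combination (norm := module) h1
    exact smul_right_injective V two_ne_zero h2
  exact isListed_T₇ hi he hp hq (sq0 p hp) hpq (sq0 q hq)

/-- The Peirce rules leave q² = κq, pq = lp and p² = ae + cq. The Jordan identity gives l² = κl/2,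
and p·p³ = p²·p² gives a(a/2 + cl) = a² and c(a/2 + cl) = κc². After scaling q, only κ = 0 and κ = 1
remain. -/
theorem isListed_half_zero (hV : Module.finrank ℂ V = 3) (h : IsJordanProduct μ) (he : μ e e = e)
    (hi : LinearIndependent ℂ ![e, p, q]) (hp : μ e p = (1 / 2 : ℂ) • p) (hq : μ e q = 0) :
    IsListed μ := by
  obtain ⟨κ, hqq⟩ : ∃ κ : ℂ, μ q q = κ • q := by
    obtain ⟨f, g, k, ⟨hf1, hf2, hf3⟩, ⟨hg1, hg2, hg3⟩, ⟨hk1, hk2, hk3⟩, -⟩ :=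
      exists_coordinates hV hi
    have hq' : μ e q = (0 : ℂ) • q := by rw [hq, zero_smul]
    obtain ⟨a', b', κ, hqq⟩ := exists_coefficients hV hi (μ q q)
    have h1 := h.peirce_mul he hq' hq' (by norm_num)
    have ha' : a' = 0 := by
      simpa [hqq, he, hp, hq, hf1, hf2, hf3] using congrArg f h1
    have hb' : b' = 0 := by
      simpa [hqq, he, hp, hq, hg1, hg2, hg3] using congrArg g h1
    exact ⟨κ, by rw [hqq, ha', hb']; module⟩
  wlog hκ : κ = 0 ∨ κ = 1 generalizing q κ
  · push Not at hκ
    refine this (q := κ⁻¹ • q) (linearIndependent_triple_change hi 1 0 0 0 1 0 0 0 κ⁻¹ (by module)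
      (by module) (by module) (by simpa using hκ.1)) (by simp [hq]) 1 ?_ (Or.inr rfl)
    rw [map_smul, map_smul, LinearMap.smul_apply, hqq, smul_smul, smul_smul, one_smul,
      mul_assoc, inv_mul_cancel₀ hκ.1, mul_one]
  obtain ⟨f, g, k, ⟨hf1, hf2, hf3⟩, ⟨hg1, hg2, hg3⟩, ⟨hk1, hk2, hk3⟩, -⟩ := exists_coordinates hV hi
  have hqe : μ q e = 0 := by rw [h.comm, hq]
  have hpe : μ p e = (1 / 2 : ℂ) • p := by rw [h.comm, hp]
  obtain ⟨l, hpq⟩ : ∃ l : ℂ, μ p q = l • p := by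
    obtain ⟨a, l, c, hpq⟩ := exists_coefficients hV hi (μ p q)
    have h1 := h.peirce_mul he hp (hq.trans (zero_smul ℂ q).symm) (by norm_num)
    have ha : a = 0 := by
      have h2 := congrArg f h1
      simp [hpq, he, hp, hq, hf1, hf2, hf3] at h2
      linear_combination 2 * h2
    have hc : c = 0 := by
      simpa [hpq, he, hp, hq, hk1, hk2, hk3] using congrArg k h1
    exact ⟨l, by rw [hpq, ha, hc]; module⟩
  have hqp : μ q p = l • p := by rw [h.comm, hpq]
  have hl : l * l = κ * l / 2 := by
    have h1 := congrArg g (h.jordan q q e p)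
    simp only [hqq, hqe, hqp, hpq, hpe, hp, hg2, map_add, map_smul, map_zero,
      LinearMap.smul_apply, LinearMap.zero_apply, smul_zero, smul_eq_mul, mul_one] at h1
    linear_combination h1
  obtain ⟨a, b, c, hpp⟩ := exists_coefficients hV hi (μ p p)
  have hb : b = 0 := by
    simpa [hpp, he, hp, hq, hg1, hg2, hg3] using congrArg g (h.peirce_half_mul he hp hp)
  subst hb
  rw [zero_smul, add_zero] at hpp
  have h4 := h.fourth_power p
  simp only [hpp, map_add, map_smul, LinearMap.add_apply, LinearMap.smul_apply, he, hpe, hpq, hq,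
    hqe, hqq] at h4
  have h4f := congrArg f h4
  have h4k := congrArg k h4
  simp [hf1, hf2, hf3] at h4f
  simp [hk1, hk2, hk3] at h4k
  rcases hκ with rfl | rfl
  · have hl0 : l = 0 := by simpa using hl
    subst hl0
    have ha : a = 0 := by
      have : a * a = 0 := by linear_combination (-2) * h4f
      simpa using this
    subst ha
    rw [zero_smul] at hqq hpq
    rw [zero_smul, zero_add] at hpp
    by_cases hc : c = 0
    · rw [hc, zero_smul] at hpp
      exact isListed_B₂N hi he hp hq hpp hpq hqq
    · exact isListed_T₈ (linearIndependent_triple_change hi 1 0 0 0 1 0 0 0 c (by module)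
        (by module) (by module) (by simpa using hc)) he hp (by simp [hq]) hpp (by simp [hpq])
        (by simp [hqq])
  · rw [one_smul] at hqq
    have hl' : l = 0 ∨ l = 1 / 2 := by
      have : l * (l - 1 / 2) = 0 := by linear_combination hl
      exact (mul_eq_zero.1 this).imp id sub_eq_zero.1
    rcases hl' with rfl | rfl
    · have ha : a = 0 := by
        have : a * a = 0 := by linear_combination (-2) * h4f
        simpa using this
      subst ha
      have hc : c = 0 := by
        have : c * c = 0 := by linear_combination (-1) * h4k
        simpa using this
      subst hc
      rw [zero_smul] at hpq
      exact isListed_B₂U hi he hp hq (by rw [hpp]; module) hpq hqq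
    -- For κ = 1 and l = 1/2 the idempotents e and q are orthogonal and p has eigenvalue 1/2 for
    -- both. The equations become ac = a² and ac = c², so p² is a multiple of e + q.
    · have hac : c = a := by
        by_cases ha : a = 0
        · subst ha
          have : c * c = 0 := by linear_combination (-2) * h4k
          simpa using this
        · apply mul_left_cancel₀ ha
          linear_combination 2 * h4f
      subst hac
      have hi2 := linearIndependent_triple_swap hi
      by_cases hc : c = 0
      · exact isListed_T₁₀ hi2 he hq hp hqq hqp (by rw [hpp, hc]; module)
      · obtain ⟨s, hs⟩ := IsAlgClosed.exists_pow_nat_eq (c⁻¹) two_pos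
        have hs1 : s * s * c = 1 := by rw [← sq, hs, inv_mul_cancel₀ hc]
        have hs0 : s ≠ 0 := by
          rintro rfl
          simp at hs1
        refine isListed_T₅ (z := s • p) (linearIndependent_triple_change hi2 1 0 0 0 1 0 0 0 s
          (by module) (by module) (by module) (by simpa using hs0)) he hq ?_ hqq ?_ ?_
        · rw [map_smul, hp, smul_comm]
        · rw [map_smul, hqp, smul_comm]
        · rw [map_smul, map_smul, LinearMap.smul_apply, hpp, smul_smul, ← smul_add, smul_smul, hs1,
            one_smul]

/-- The Peirce space of 1 has a basis e, n with n² = δe, and n acts on p by a scalar l with l² =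
δ/4. If δ ≠ 0, then e splits into orthogonal idempotents and `isListed_half_zero` applies to one of
them. -/
theorem isListed_one_half (hV : Module.finrank ℂ V = 3) (h : IsJordanProduct μ) (he : μ e e = e)
    (hi : LinearIndependent ℂ ![e, p, q]) (hp : μ e p = (1 / 2 : ℂ) • p) (hq : μ e q = q) :
    IsListed μ := by
  obtain ⟨n, b', δ, hn, hen, hnn⟩ : ∃ (n : V) (b δ : ℂ), n = q - b • e ∧ μ e n = n ∧
      μ n n = δ • e := by
    obtain ⟨f, g, k, ⟨hf1, hf2, hf3⟩, ⟨hg1, hg2, hg3⟩, ⟨hk1, hk2, hk3⟩, -⟩ :=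
      exists_coordinates hV hi
    have hq' : μ e q = (1 : ℂ) • q := by rw [hq, one_smul]
    have hqe : μ q e = q := by rw [h.comm, hq]
    obtain ⟨a, b, c, hqq⟩ := exists_coefficients hV hi (μ q q)
    have h1 := h.peirce_mul he hq' hq' (by norm_num)
    have hb : b = 0 := by
      have h2 := congrArg g h1
      simp [hqq, he, hp, hq, hg1, hg2, hg3] at h2
      linear_combination (-2) * h2
    refine ⟨_, c / 2, a + c * c / 4, rfl, ?_, ?_⟩
    · rw [map_sub, map_smul, he, hq]
    · simp only [map_sub, map_smul, LinearMap.sub_apply, LinearMap.smul_apply, he, hq, hqe, hqq, hb]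
      module
  have hi2 : LinearIndependent ℂ ![e, p, n] := linearIndependent_triple_change hi
    1 0 0 0 1 0 (-b') 0 1 (by module) (by module) (by rw [hn]; module) (by simp)
  clear! q
  obtain ⟨f, g, k, ⟨hf1, hf2, hf3⟩, ⟨hg1, hg2, hg3⟩, ⟨hk1, hk2, hk3⟩, -⟩ := exists_coordinates hV hi2
  have hne : μ n e = n := by rw [h.comm, hen]
  have hpe : μ p e = (1 / 2 : ℂ) • p := by rw [h.comm, hp]
  obtain ⟨l, hpn⟩ : ∃ l : ℂ, μ p n = l • p := by
    obtain ⟨a, l, c, hpq⟩ := exists_coefficients hV hi2 (μ p n)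
    have h1 := h.peirce_mul he hp (hen.trans (one_smul ℂ n).symm) (by norm_num)
    have ha : a = 0 := by
      have h2 := congrArg f h1
      simp [hpq, he, hp, hen, hf1, hf2, hf3] at h2
      linear_combination 2 * h2
    have hc : c = 0 := by
      have h2 := congrArg k h1
      simp [hpq, he, hp, hen, hk1, hk2, hk3] at h2
      linear_combination 2 * h2
    exact ⟨l, by rw [hpq, ha, hc]; module⟩
  have hnp : μ n p = l • p := by rw [h.comm, hpn]
  have hl : l * l = δ / 4 := by
    have h1 := congrArg g (h.jordan n n e p)
    simp only [hnn, hne, hnp, hpn, hpe, hp, hg2, he, map_add, map_smul,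
      LinearMap.smul_apply, smul_eq_mul, mul_one] at h1
    linear_combination -h1
  by_cases hδ : δ = 0
  · subst hδ
    have hl0 : l = 0 := by simpa using hl
    subst hl0
    rw [zero_smul] at hnn hpn
    obtain ⟨a, b, c, hpp⟩ := exists_coefficients hV hi2 (μ p p)
    have hb : b = 0 := by
      simpa [hpp, he, hp, hen, hg1, hg2, hg3] using congrArg g (h.peirce_half_mul he hp hp)
    subst hb
    rw [zero_smul, add_zero] at hpp
    have ha : a = 0 := by
      have h4 := congrArg f (h.fourth_power p)
      simp [hpp, he, hpe, hpn, hen, hne, hnn, hf1, hf3] at h4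
      rcases h4 with h4 | h4
      · linear_combination (-2) * h4
      · exact h4
    subst ha
    rw [zero_smul, zero_add] at hpp
    by_cases hc : c = 0
    · exact isListed_T₆ hi2 he hp hen (by rw [hpp, hc, zero_smul]) hpn hnn
    · exact isListed_T₉ (linearIndependent_triple_change hi2 1 0 0 0 1 0 0 0 c (by module)
        (by module) (by module) (by simpa using hc)) he hp (by rw [map_smul, hen]) hpp
        (by simp [hpn]) (by simp [hnn])
  · have hl0 : l ≠ 0 := by
      rintro rfl
      exact hδ (by linear_combination (-4) * hl)
    -- This choice gives s²δ = 1/4, so that e/2 ± sn are idempotents, and sl = 1/4, so that e/2 + sn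
    -- acts on p by 1/4 + 1/4 = 1/2.
    obtain ⟨s, hs⟩ : ∃ s : ℂ, s = l⁻¹ / 4 := ⟨_, rfl⟩
    have hs0 : s ≠ 0 := by simp [hs, hl0]
    have hsl : s * l = 1 / 4 := by rw [hs]; field_simp
    have hss : s • s • δ • e = (1 / 4 : ℂ) • e := by
      rw [smul_smul, smul_smul, show s * s * δ = 1 / 4 by
        linear_combination (-4 * s * s) * hl + (4 * s * l + 1) * hsl]
    refine h.isListed_half_zero hV (e := (1 / 2 : ℂ) • e + s • n) (p := p)
      (q := (1 / 2 : ℂ) • e - s • n) ?_ (linearIndependent_triple_change hi2 (1 / 2) 0 s 0 1 0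
        (1 / 2) 0 (-s) (by module) (by module) (by module) (by ring_nf; simpa using hs0)) ?_ ?_
    · simp only [map_add, map_smul, LinearMap.add_apply, LinearMap.smul_apply, smul_add, he, hen,
        hne, hnn, hss]
      module
    · simp only [map_add, map_smul, LinearMap.add_apply, LinearMap.smul_apply, hp, hnp, smul_smul,
        hsl]
      module
    · simp only [map_sub, map_add, map_smul, LinearMap.add_apply, LinearMap.smul_apply, smul_add,
        he, hen, hne, hnn, hss]
      module

end IsJordanProduct
end Superalgebra

namespace Superalgebra

/-! ### Idempotents with a two-dimensional annihilator, units, and the full list -/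

namespace IsJordanProduct
variable {V : Type*} [AddCommGroup V] [Module ℂ V] {μ : V →ₗ[ℂ] V →ₗ[ℂ] V} {e p q : V}

/-- The annihilator of e is a two-dimensional Jordan subalgebra. If it contains an idempotent f,
then the Peirce decomposition of f leads to ℂf, ℂe and one more eigenvector, hence to a direct
computation or an earlier case. Otherwise it is nil. -/
theorem isListed_zero_zero (hV : Module.finrank ℂ V = 3) (h : IsJordanProduct μ) (he : μ e e = e)
    (hi : LinearIndependent ℂ ![e, p, q]) (hp : μ e p = 0) (hq : μ e q = 0) : IsListed μ := by
  have : Module.Finite ℂ V := Module.finite_of_finrank_pos (by omega)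
  have he0 : e ≠ 0 := hi.ne_zero 0
  have hclosed : ∀ x y, μ e x = 0 → μ e y = 0 → μ e (μ x y) = 0 := by
    intro x y hx hy
    rw [h.peirce_mul he (c := 0) (d := 0) (by rw [hx, zero_smul]) (by rw [hy, zero_smul])
      (by norm_num), zero_smul]
  have hspan : ∀ x y, μ e x = 0 → μ e y = 0 → e ∉ Submodule.span ℂ {x, y} := by
    intro x y hx hy hmem
    obtain ⟨a, b, hab⟩ := Submodule.mem_span_pair.1 hmem
    refine he0 ?_
    rw [← he]
    nth_rewrite 2 [← hab]
    simp [hx, hy]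
  by_cases hid : ∃ f, f ≠ 0 ∧ μ f f = f ∧ μ e f = 0
  · obtain ⟨f, hf0, hf, hef⟩ := hid
    have hfe : μ f e = 0 := by rw [h.comm, hef]
    obtain ⟨r, ⟨c, hc, hr⟩, hrfe⟩ := exists_mem_notMem (h.peirce_span hf) (span_pair_ne_top hV f e)
    obtain ⟨a, b, b', hab⟩ := exists_coefficients hV hi r
    obtain ⟨w, hw⟩ : ∃ w, w = b • p + b' • q := ⟨_, rfl⟩
    have hrw : r = a • e + w := by rw [hab, hw, add_assoc]
    have hew : μ e w = 0 := by simp [hw, hp, hq]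
    have hfw' : μ f w = c • (a • e + w) := by rw [← hrw, ← hr, hrw]; simp [hfe]
    -- The product fw stays in the annihilator of e, so its component along e vanishes and w itself
    -- is an eigenvector of f.
    have hca : (c * a) • e = 0 := by
      have h1 := hclosed f w hef hew
      rw [hfw'] at h1
      simpa [he, hew, smul_smul] using h1
    have hfw : μ f w = c • w := by rw [hfw', smul_add, smul_smul, hca, zero_add]
    have hi2 : LinearIndependent ℂ ![f, e, w] := by
      refine linearIndependent_triple_of_notMem hf0 (fun hmem => ?_) fun hmem => hrfe ?_
      · exact hspan f f hef hef (by simpa using hmem)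
      · rw [hrw]
        exact Submodule.add_mem _ (Submodule.smul_mem _ _ (Submodule.subset_span (by simp))) hmem
    have hi3 := linearIndependent_triple_swap hi2
    rcases hc with rfl | rfl | rfl
    · rw [zero_smul] at hfw
      obtain ⟨f', g, k, ⟨hf1, hf2, hf3⟩, ⟨hg1, hg2, hg3⟩, -, -⟩ := exists_coordinates hV hi2
      obtain ⟨x, y, κ, hww⟩ := exists_coefficients hV hi2 (μ w w)
      have hx : x = 0 := by
        have h1 := h.peirce_mul hf (hfw.trans (zero_smul ℂ w).symm) (hfw.trans (zero_smul ℂ w).symm)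
          (by norm_num)
        simpa [hww, hf, hfe, hfw, hf1] using congrArg f' h1
      have hy : y = 0 := by
        simpa [hww, he, hef, hew, he0] using hclosed w w hew hew
      rw [hx, hy, zero_smul, zero_smul, zero_add, zero_add] at hww
      by_cases hκ : κ = 0
      · rw [hκ, zero_smul] at hww
        exact isListed_UUN hi2 hf hfe hfw he hew hww
      · refine isListed_UUU (z := κ⁻¹ • w) (linearIndependent_triple_change hi2 1 0 0 0 1 0 0 0 κ⁻¹
          (by module) (by module) (by module) (by simpa using hκ)) hf hfe (by simp [hfw]) he
          (by simp [hew]) ?_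
        rw [map_smul, map_smul, LinearMap.smul_apply, hww, smul_smul, smul_smul, mul_assoc,
          inv_mul_cancel₀ hκ, mul_one]
    · exact h.isListed_half_zero hV hf hi3 hfw hfe
    · exact h.isListed_one_zero hV hf hi3 (by rw [hfw, one_smul]) hfe
  · push Not at hid
    by_cases hsq : ∀ x, μ e x = 0 → μ x x = 0
    · have h1 := hsq (p + q) (by rw [map_add, hp, hq, add_zero])
      simp only [map_add, LinearMap.add_apply, hsq p hp, hsq q hq, h.comm q p] at h1
      have hpq : (2 : ℂ) • μ p q = (2 : ℂ) • 0 := by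
        linear_combination (norm := module) h1
      exact isListed_UNN hi he hp hq (hsq p hp) (smul_right_injective V two_ne_zero hpq) (hsq q hq)
    · push Not at hsq
      obtain ⟨x, hex, hxx⟩ := hsq
      have h4 : μ x (μ x (μ x x)) = 0 := by
        rcases h.nilpotent_or_exists_idempotent x with ⟨k, hk⟩ | ⟨r, hr0, hr⟩
        · simpa [pow_succ] using pow_three_eq_zero hV hk
        · refine absurd ?_ (hid _ hr0 hr)
          clear hr hr0
          -- The idempotent is a polynomial in x without constant term, and all powers of x stay in
          -- the annihilator of e.
          induction r using Polynomial.induction_on' with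
          | add r s hr hs => rw [map_add, LinearMap.add_apply, map_add, hr, hs, add_zero]
          | monomial n a =>
            rw [Polynomial.aeval_monomial, Module.End.mul_apply, Module.algebraMap_end_apply,
              map_smul]
            suffices μ e (((μ x : Module.End ℂ V) ^ n) x) = 0 by rw [this, smul_zero]
            induction n with
            | zero => simpa using hex
            | succ n ih =>
              rw [pow_succ', Module.End.mul_apply]
              exact hclosed _ _ hex ih
      have hexx := hclosed x x hex hex
      -- Otherwise x, x², x³ would be a basis killed by e, and then e = ee = 0.
      have hx3 : μ x (μ x x) = 0 := by
        by_contra hne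
        obtain ⟨a, b, c, habc⟩ := exists_coefficients hV (linearIndependent_iterate hne h4) e
        refine he0 ?_
        rw [← he]
        nth_rewrite 2 [habc]
        simp [hex, hexx, hclosed _ _ hex hexx]
      have hx0 : x ≠ 0 := by
        rintro rfl
        simp at hxx
      refine isListed_B₃U (linearIndependent_triple_of_notMem hx0 (fun hmem => ?_)
        (hspan x _ hex hexx)) rfl hx3 (by rw [h.comm, hex]) (by rw [← h.fourth_power, h4])
        (by rw [h.comm, hexx]) he
      obtain ⟨c, hc⟩ := Submodule.mem_span_singleton.1 hmem
      rw [← hc, map_smul, ← hc, smul_smul] at hx3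
      rcases smul_eq_zero.1 hx3 with h0 | h0
      · exact hxx (by rw [← hc, mul_self_eq_zero.1 h0, zero_smul])
      · exact hx0 h0

theorem isListed_of_not_unit (hV : Module.finrank ℂ V = 3) (h : IsJordanProduct μ) (he0 : e ≠ 0)
    (he : μ e e = e) (hu : ¬ ∀ x, μ e x = x) : IsListed μ := by
  obtain ⟨p, ⟨c, hc, hp⟩, q, ⟨d, hd, hq⟩, hi⟩ := exists_linearIndependent_triple hV he0
    (h.peirce_span he)
  have hi' := linearIndependent_triple_swap hi
  rcases hc with rfl | rfl | rfl <;> rcases hd with rfl | rfl | rfl <;>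
    try simp only [zero_smul, one_smul] at hp hq
  · exact h.isListed_zero_zero hV he hi hp hq
  · exact h.isListed_half_zero hV he hi' hq hp
  · exact h.isListed_one_zero hV he hi' hq hp
  · exact h.isListed_half_zero hV he hi hp hq
  · exact h.isListed_half_half hV he hi hp hq
  · exact h.isListed_one_half hV he hi hp hq
  · exact h.isListed_one_zero hV he hi hp hq
  · exact h.isListed_one_half hV he hi' hq hp
  · refine absurd (fun x => ?_) hu
    obtain ⟨a, b, c, rfl⟩ := exists_coefficients hV hi x
    simp only [map_add, map_smul, he, hp, hq]

/-- Another nonzero idempotent is not a unit and leads back to the non-unital case. Otherwise each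
element is a scalar plus a nilpotent n; some n with n² ≠ 0 gives the basis e, n, n², and if there is
none, the nilpotent elements multiply to zero. -/
theorem isListed_of_unit (hV : Module.finrank ℂ V = 3) (h : IsJordanProduct μ) (he0 : e ≠ 0)
    (hu : ∀ x, μ e x = x) : IsListed μ := by
  have : Module.Finite ℂ V := Module.finite_of_finrank_pos (by omega)
  by_cases hid : ∀ f, μ f f = f → f = 0 ∨ f = e
  swap
  · push Not at hid
    obtain ⟨f, hf, hf0, hfe⟩ := hid
    refine h.isListed_of_not_unit hV hf0 hf fun h1 => hfe ?_
    rw [← h1 e, h.comm, hu]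
  have hux : ∀ x, μ x e = x := fun x => by rw [h.comm, hu]
  have hnil : ∀ x, ∃ c : ℂ, μ (x - c • e) (μ (x - c • e) (x - c • e)) = 0 := by
    intro x
    obtain ⟨c, k, hk⟩ := h.exists_sub_smul_nilpotent he0 hu hid x
    refine ⟨c, ?_⟩
    -- Starting the iteration at e instead of at the element gains one step: the bound 3 on the
    -- exponent yields a vanishing cube.
    have h1 : ((μ (x - c • e) : Module.End ℂ V) ^ (k + 1)) e = 0 := by
      rw [pow_succ, Module.End.mul_apply, hux, hk]
    have h2 := pow_three_eq_zero hV h1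
    simpa only [pow_succ, pow_zero, one_mul, Module.End.mul_apply, hux] using h2
  by_cases hsq : ∃ n, μ n (μ n n) = 0 ∧ μ n n ≠ 0
  · obtain ⟨n, hn3, hn2⟩ := hsq
    have h2 : (μ n : Module.End ℂ V) (μ n e) = μ n n := by rw [hux]
    have hi := linearIndependent_iterate (L := μ n) (x := e) (by rwa [h2]) (by rw [h2, hn3])
    rw [h2, hux] at hi
    refine isListed_T₁ hi (hu e) (hu n) (hu _) rfl hn3 ?_
    rw [← h.fourth_power, hn3, map_zero]
  · push Not at hsq
    obtain ⟨x, -, y, -, hi⟩ := exists_linearIndependent_triple hV he0 (E := Set.univ) (by simp)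
    obtain ⟨a, ha⟩ := hnil x
    obtain ⟨b, hb⟩ := hnil y
    obtain ⟨m, hm⟩ : ∃ m, m = x - a • e := ⟨_, rfl⟩
    obtain ⟨n, hn⟩ : ∃ n, n = y - b • e := ⟨_, rfl⟩
    rw [← hm] at ha
    rw [← hn] at hb
    have hmm := hsq m ha
    have hnn := hsq n hb
    have hi2 : LinearIndependent ℂ ![e, m, n] := linearIndependent_triple_change hi
      1 0 0 (-a) 1 0 (-b) 0 1 (by module) (by rw [hm]; module) (by rw [hn]; module) (by simp)
    have key : ∀ x, ∃ c : ℂ, μ x x = (2 * c) • x - (c * c) • e := by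
      intro x
      obtain ⟨c, hc⟩ := hnil x
      have h1 := hsq _ hc
      simp only [map_sub, map_smul, LinearMap.sub_apply, LinearMap.smul_apply, hu, hux] at h1
      exact ⟨c, by linear_combination (norm := module) h1⟩
    obtain ⟨c, hc⟩ := key (m + n)
    obtain ⟨d, hd⟩ := key (m - n)
    simp only [map_add, map_sub, LinearMap.add_apply, LinearMap.sub_apply, hmm, hnn,
      h.comm n m] at hc hd
    -- The squares of m + n and m - n are 2mn and -2mn. Their sum is zero, which gives a linear
    -- relation between e, m, n that forces c = 0 and hence mn = 0.
    obtain ⟨-, h2, h3⟩ := linearIndependent_triple_iff.1 hi2 (-c * c - d * d) (2 * c + 2 * d)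
      (2 * c - 2 * d) (by linear_combination (norm := module) -hc - hd)
    have hc0 : c = 0 := by linear_combination h2 / 4 + h3 / 4
    have hmn : (2 : ℂ) • μ m n = (2 : ℂ) • 0 := by
      rw [hc0] at hc
      linear_combination (norm := module) hc
    exact isListed_T₂ hi2 (hu e) (hu m) (hu n) hmm (smul_right_injective V two_ne_zero hmn) hnn

/-- Three-dimensional complex Jordan algebras with nonzero product are listed. -/
theorem isListed_or_eq_zero (hV : Module.finrank ℂ V = 3) (h : IsJordanProduct μ) :
    IsListed μ ∨ μ = 0 := by
  by_cases hid : ∀ f, μ f f = f → f = 0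
  · exact h.isListed_or_eq_zero_of_no_idempotent hV hid
  push Not at hid
  obtain ⟨e, he, he0⟩ := hid
  left
  by_cases hu : ∀ x, μ e x = x
  · exact h.isListed_of_unit hV he0 hu
  · exact h.isListed_of_not_unit hV he0 he hu

end IsJordanProduct
end Superalgebra

namespace Superalgebra

/-! ### Actions on the odd part -/

section
variable {V : Type*} [AddCommGroup V] [Module ℂ V]

/-- The product and the action have a listed table in some basis. -/
def IsRow (μ : V →ₗ[ℂ] V →ₗ[ℂ] V) (a : V →ₗ[ℂ] ℂ) : Prop := ∃ i x y z,
  Realizes μ (rows i).table.even x y z ∧ a x = (rows i).table.act 0 ∧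
    a y = (rows i).table.act 1 ∧ a z = (rows i).table.act 2

variable {μ : V →ₗ[ℂ] V →ₗ[ℂ] V} {a : V →ₗ[ℂ] ℂ} {x y z : V} {c : Fin 3 → Fin 3 → Fin 3 → ℂ}

theorem Realizes.isRow (r : Realizes μ c x y z) (i : Fin 59) {p q s : ℂ}
    (hi : (rows i).table = ⟨c, ![p, q, s]⟩) (hx : a x = p) (hy : a y = q) (hz : a z = s) :
    IsRow μ a := by
  refine ⟨i, x, y, z, ?_⟩
  rw [hi]
  exact ⟨r, hx, hy, hz⟩

namespace IsJordanAction

/-- With all three arguments equal to x the cubic condition is 2λ³ - 3λ² + λ = 0 for λ = a(x), the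
polynomial of the Peirce eigenvalues. -/
theorem idempotent (ha : IsJordanAction μ a) (hx : μ x x = x) : a x = 0 ∨ a x = 1 ∨ a x = 1 / 2 := by
  have h := ha x x x
  rw [hx, hx] at h
  have h1 : a x * ((a x - 1) * (a x - 1 / 2)) = 0 := by linear_combination h / 2
  simpa [sub_eq_zero] using h1

theorem square_zero (ha : IsJordanAction μ a) (hx : μ x x = 0) : a x = 0 := by
  have h := ha x x x
  rw [hx] at h
  simpa using h

theorem cube_zero (ha : IsJordanAction μ a) (hy : a (μ x x) = 0) (h3 : μ (μ x x) x = 0) :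
    a x = 0 := by
  have h := ha x x x
  rw [hy, h3] at h
  simpa using h

/-- The condition at x, x, y is 2a(x)²a(y) = a(x)a(y), and likewise with x and y exchanged; if
neither value is zero, both equal 1/2. -/
theorem orthogonal (ha : IsJordanAction μ a) (hx : μ x x = x) (hy : μ y y = y) (hxy : μ x y = 0)
    (hyx : μ y x = 0) : a y = 0 ∨ a x = 0 ∨ a x = 1 / 2 ∧ a y = 1 / 2 := by
  have h1 := ha x x y
  have h2 := ha y y x
  rw [hx, hxy] at h1
  rw [hy, hyx] at h2
  simp only [map_zero, zero_mul, add_zero, zero_add] at h1 h2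
  by_cases hy0 : a y = 0
  · exact Or.inl hy0
  by_cases hx0 : a x = 0
  · exact Or.inr (Or.inl hx0)
  have hxy0 := mul_ne_zero hx0 hy0
  refine Or.inr (Or.inr ⟨?_, ?_⟩) <;> apply mul_left_cancel₀ hxy0
  · linear_combination h1 / 2
  · linear_combination h2 / 2

theorem three_orthogonal (ha : IsJordanAction μ a) (hxy : μ x y = 0) (hyz : μ y z = 0)
    (hxz : μ x z = 0) : a x = 0 ∨ a y = 0 ∨ a z = 0 := by
  have h := ha x y z
  rw [hxy, hyz, hxz] at h
  simpa [or_assoc] using h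

/-- The pairs of values on two orthogonal idempotents. -/
theorem orthogonal_cases (ha : IsJordanAction μ a) (hx : μ x x = x) (hy : μ y y = y)
    (hxy : μ x y = 0) (hyx : μ y x = 0) : a x = 0 ∧ (a y = 0 ∨ a y = 1 ∨ a y = 1 / 2) ∨
      a y = 0 ∧ (a x = 1 ∨ a x = 1 / 2) ∨ a x = 1 / 2 ∧ a y = 1 / 2 := by
  have h1 := ha.idempotent hx
  have h2 := ha.idempotent hy
  have h3 := ha.orthogonal hx hy hxy hyx
  tauto

theorem isRow_of_idempotent (ha : IsJordanAction μ a) (r : Realizes μ c x y z) (hx : μ x x = x)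
    (hy : a y = 0) (hz : a z = 0) (i j k : Fin 59) (hi : (rows i).table = ⟨c, ![0, 0, 0]⟩)
    (hj : (rows j).table = ⟨c, ![1, 0, 0]⟩) (hk : (rows k).table = ⟨c, ![1 / 2, 0, 0]⟩) :
    IsRow μ a := by
  rcases ha.idempotent hx with h | h | h
  exacts [r.isRow i hi h hy hz, r.isRow j hj h hy hz, r.isRow k hk h hy hz]

theorem isRow_UUU (ha : IsJordanAction μ a) (h : IsJordanProduct μ)
    (r : Realizes μ evenUUU x y z) : IsRow μ a := by
  -- The table is symmetric in the three idempotents, so one on which a vanishes can be moved to the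
  -- last place.
  have hp : ∀ {x y z}, Realizes μ evenUUU x y z → Realizes μ evenUUU x z y ∧
      Realizes μ evenUUU y z x := by
    rintro x y z ⟨hi, h1, h2, h3, h4, h5, h6⟩
    simp [evenUUU, rule] at h1 h2 h3 h4 h5 h6
    constructor
    · refine ⟨linearIndependent_triple_swap hi, ?_, ?_, ?_, ?_, ?_, ?_⟩ <;>
        simp [evenUUU, rule, h.comm z y, *]
    · refine ⟨linearIndependent_triple_rotate hi, ?_, ?_, ?_, ?_, ?_, ?_⟩ <;>
        simp [evenUUU, rule, h.comm z x, h.comm y x, *]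
  have key : ∀ {x y z}, Realizes μ evenUUU x y z → a z = 0 → IsRow μ a := by
    intro x y z r hz
    obtain ⟨hi, h1, h2, h3, h4, h5, h6⟩ := id r
    simp [evenUUU, rule] at h1 h2 h3 h4 h5 h6
    have r' := (hp (hp r).2).1
    rcases ha.orthogonal_cases h1 h4 h2 (by rw [h.comm, h2]) with
      ⟨hx, hy | hy | hy⟩ | ⟨hy, hx | hx⟩ | ⟨hx, hy⟩
    · exact r.isRow 0 rfl hx hy hz
    · exact r'.isRow 1 rfl hy hx hz
    · exact r'.isRow 2 rfl hy hx hz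
    · exact r.isRow 1 rfl hx hy hz
    · exact r.isRow 2 rfl hx hy hz
    · exact r.isRow 3 rfl hx hy hz
  obtain ⟨hi, h1, h2, h3, h4, h5, h6⟩ := id r
  simp [evenUUU, rule] at h2 h3 h5
  rcases ha.three_orthogonal h2 h5 h3 with h0 | h0 | h0
  exacts [key (hp r).2 h0, key (hp r).1 h0, key r h0]

theorem isRow_T₁₀ (ha : IsJordanAction μ a) (h : IsJordanProduct μ)
    (r : Realizes μ evenT₁₀ x y z) : IsRow μ a := by
  obtain ⟨hi, h1, h2, h3, h4, h5, h6⟩ := id r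
  simp [evenT₁₀, rule] at h1 h2 h3 h4 h5 h6
  have r' : Realizes μ evenT₁₀ y x z := by
    refine ⟨linearIndependent_triple_change hi 0 1 0 1 0 0 0 0 1 (by module) (by module) (by module)
      (by simp), ?_, ?_, ?_, ?_, ?_, ?_⟩ <;> simp [evenT₁₀, rule, h.comm y x, *]
  have hz := ha.square_zero h6
  rcases ha.orthogonal_cases h1 h4 h2 (by rw [h.comm, h2]) with
    ⟨hx, hy | hy | hy⟩ | ⟨hy, hx | hx⟩ | ⟨hx, hy⟩
  · exact r.isRow 55 rfl hx hy hz
  · exact r'.isRow 56 rfl hy hx hz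
  · exact r'.isRow 57 rfl hy hx hz
  · exact r.isRow 56 rfl hx hy hz
  · exact r.isRow 57 rfl hx hy hz
  · exact r.isRow 58 rfl hx hy hz

theorem isRow_UUN (ha : IsJordanAction μ a) (h : IsJordanProduct μ)
    (r : Realizes μ evenUUN x y z) : IsRow μ a := by
  obtain ⟨hi, h1, h2, h3, h4, h5, h6⟩ := id r
  simp [evenUUN, rule] at h1 h2 h3 h4 h5 h6
  have r' : Realizes μ evenUUN y x z := by
    refine ⟨linearIndependent_triple_change hi 0 1 0 1 0 0 0 0 1 (by module) (by module) (by module)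
      (by simp), ?_, ?_, ?_, ?_, ?_, ?_⟩ <;> simp [evenUUN, rule, h.comm y x, *]
  have hz := ha.square_zero h6
  rcases ha.orthogonal_cases h1 h4 h2 (by rw [h.comm, h2]) with
    ⟨hx, hy | hy | hy⟩ | ⟨hy, hx | hx⟩ | ⟨hx, hy⟩
  · exact r.isRow 4 rfl hx hy hz
  · exact r'.isRow 5 rfl hy hx hz
  · exact r'.isRow 6 rfl hy hx hz
  · exact r.isRow 5 rfl hx hy hz
  · exact r.isRow 6 rfl hx hy hz
  · exact r.isRow 7 rfl hx hy hz

theorem isRow_T₅ (ha : IsJordanAction μ a) (h : IsJordanProduct μ)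
    (r : Realizes μ evenT₅ x y z) : IsRow μ a := by
  obtain ⟨hi, h1, h2, h3, h4, h5, h6⟩ := id r
  simp [evenT₅, rule] at h1 h2 h3 h4 h5 h6
  have hzy : μ z y = (2⁻¹ : ℂ) • z := by rw [h.comm, h5]
  have hzx : μ z x = (2⁻¹ : ℂ) • z := by rw [h.comm, h3]
  -- With equal values on x and y, the condition at x, z, y gives a(z) = 0. If exactly one value is
  -- zero, `e2` or `e3` gives a(z) = 0; then z² = x + y makes the condition at z, x, z read (a(x) +
  -- a(y))(a(x) - 1/2) = 0, which fails for a(x) = 0, and z, y, z excludes a(y) = 0.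
  have e1 := ha x z y
  have e2 := ha x x z
  have e3 := ha y y z
  have e4 := ha z x z
  have e5 := ha z y z
  simp only [h1, h2, h3, h4, h5, h6, hzx, hzy, map_add, map_smul, map_zero, LinearMap.smul_apply,
    smul_eq_mul] at e1 e2 e3 e4 e5
  rcases ha.orthogonal_cases h1 h4 h2 (by rw [h.comm, h2]) with
    ⟨hx, hy | hy | hy⟩ | ⟨hy, hx | hx⟩ | ⟨hx, hy⟩ <;>
    simp only [hx, hy] at e1 e2 e3 e4 e5
  · exact r.isRow 41 rfl hx hy (by linear_combination 4 * e1)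
  · have hz : a z = 0 := by linear_combination 2 * e2
    rw [hz] at e4
    norm_num at e4
  · have hz : a z = 0 := by linear_combination 2 * e2
    rw [hz] at e4
    norm_num at e4
  · have hz : a z = 0 := by linear_combination 2 * e3
    rw [hz] at e5
    norm_num at e5
  · have hz : a z = 0 := by linear_combination 2 * e3
    rw [hz] at e5
    norm_num at e5
  · exact r.isRow 42 rfl hx hy (by linear_combination 4 * e1)

theorem isRow_B₁U (ha : IsJordanAction μ a) (h : IsJordanProduct μ)
    (r : Realizes μ evenB₁U x y z) : IsRow μ a := by
  obtain ⟨hi, h1, h2, h3, h4, h5, h6⟩ := id r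
  simp [evenB₁U, rule] at h1 h2 h3 h4 h5 h6
  have hy := ha.square_zero h4
  rcases ha.orthogonal_cases h1 h6 h3 (by rw [h.comm, h3]) with
    ⟨hx, hz | hz | hz⟩ | ⟨hz, hx | hx⟩ | ⟨hx, hz⟩
  · exact r.isRow 11 rfl hx hy hz
  · exact r.isRow 12 rfl hx hy hz
  · exact r.isRow 13 rfl hx hy hz
  · exact r.isRow 14 rfl hx hy hz
  · exact r.isRow 15 rfl hx hy hz
  · exact r.isRow 16 rfl hx hy hz

theorem isRow_B₂U (ha : IsJordanAction μ a) (h : IsJordanProduct μ)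
    (r : Realizes μ evenB₂U x y z) : IsRow μ a := by
  obtain ⟨hi, h1, h2, h3, h4, h5, h6⟩ := id r
  simp [evenB₂U, rule] at h1 h2 h3 h4 h5 h6
  have hy := ha.square_zero h4
  rcases ha.orthogonal_cases h1 h6 h3 (by rw [h.comm, h3]) with
    ⟨hx, hz | hz | hz⟩ | ⟨hz, hx | hx⟩ | ⟨hx, hz⟩
  · exact r.isRow 20 rfl hx hy hz
  · exact r.isRow 21 rfl hx hy hz
  · exact r.isRow 22 rfl hx hy hz
  · exact r.isRow 23 rfl hx hy hz
  · exact r.isRow 24 rfl hx hy hz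
  · exact r.isRow 25 rfl hx hy hz

theorem isRow (ha : IsJordanAction μ a) (h : IsJordanProduct μ) (hμ : IsListed μ) : IsRow μ a := by
  obtain ⟨k, x, y, z, r⟩ := hμ
  have r' := r
  obtain ⟨-, h1, h2, h3, h4, h5, h6⟩ := r'
  have hc := h.comm
  fin_cases k
  · exact ha.isRow_UUU h r
  · exact ha.isRow_UUN h r
  · simp [evens, evenUNN, rule] at h1 h4 h6
    exact ha.isRow_of_idempotent r h1 (ha.square_zero h4) (ha.square_zero h6) 8 9 10 rfl rfl rfl
  · exact ha.isRow_B₁U h r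
  · simp [evens, evenB₁N, rule] at h1 h4 h6
    exact ha.isRow_of_idempotent r h1 (ha.square_zero h4) (ha.square_zero h6) 17 18 19 rfl rfl rfl
  · exact ha.isRow_B₂U h r
  · simp [evens, evenB₂N, rule] at h1 h4 h6
    exact ha.isRow_of_idempotent r h1 (ha.square_zero h4) (ha.square_zero h6) 26 27 28 rfl rfl rfl
  · simp [evens, evenB₃U, rule] at h1 h2 h4 h6
    have hy := ha.square_zero h4
    have hx : a x = 0 := ha.cube_zero (by rw [h1, hy]) (by rw [h1, hc, h2])
    rcases ha.idempotent h6 with hz | hz | hz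
    exacts [r.isRow 29 rfl hx hy hz, r.isRow 30 rfl hx hy hz, r.isRow 31 rfl hx hy hz]
  · simp [evens, evenB₃N, rule] at h1 h2 h4 h6
    have hy := ha.square_zero h4
    exact r.isRow 32 rfl (ha.cube_zero (by rw [h1, hy]) (by rw [h1, hc, h2])) hy
      (ha.square_zero h6)
  · simp [evens, evenT₁, rule] at h1 h4 h5 h6
    have hz := ha.square_zero h6
    exact ha.isRow_of_idempotent r h1 (ha.cube_zero (by rw [h4, hz]) (by rw [h4, hc, h5])) hz
      33 34 35 rfl rfl rfl
  · simp [evens, evenT₂, rule] at h1 h4 h6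
    exact ha.isRow_of_idempotent r h1 (ha.square_zero h4) (ha.square_zero h6) 36 37 38 rfl rfl rfl
  · simp [evens, evenT₃, rule] at h1 h2 h4 h6
    have hz := ha.square_zero h6
    have hy := ha.square_zero h4
    have hx : a x = 0 := by
      have h7 := ha x x x
      rw [h1, hc y x, h2, hy, hz] at h7
      simpa using h7
    exact r.isRow 39 rfl hx hy hz
  · simp [evens, evenT₄, rule] at h1 h2 h4 h6
    have hy := ha.square_zero h4
    exact r.isRow 40 rfl (ha.cube_zero (by rw [h1, hy]) (by rw [h1, hc, h2])) hy
      (ha.square_zero h6)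
  · exact ha.isRow_T₅ h r
  · simp [evens, evenT₆, rule] at h1 h4 h6
    exact ha.isRow_of_idempotent r h1 (ha.square_zero h4) (ha.square_zero h6) 43 44 45 rfl rfl rfl
  · simp [evens, evenT₇, rule] at h1 h4 h6
    exact ha.isRow_of_idempotent r h1 (ha.square_zero h4) (ha.square_zero h6) 46 47 48 rfl rfl rfl
  · simp [evens, evenT₈, rule] at h1 h4 h5 h6
    have hz := ha.square_zero h6
    exact ha.isRow_of_idempotent r h1 (ha.cube_zero (by rw [h4, hz]) (by rw [h4, hc, h5])) hz
      49 50 51 rfl rfl rfl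
  · simp [evens, evenT₉, rule] at h1 h4 h5 h6
    have hz := ha.square_zero h6
    exact ha.isRow_of_idempotent r h1 (ha.cube_zero (by rw [h4, hz]) (by rw [h4, hc, h5])) hz
      52 53 54 rfl rfl rfl
  · exact ha.isRow_T₁₀ h r

theorem eq_zero (ha : IsJordanAction μ a) (hμ : μ = 0) : a = 0 := by
  ext x
  exact ha.square_zero (by rw [hμ]; rfl)

end IsJordanAction
end
end Superalgebra

namespace Superalgebra

/-! ### Jordan superalgebras of type `(3, 1)` -/

section
variable {A : Type*} [AddCommGroup A] [Module ℂ A] (S : Superalgebra A)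

/-- The product of the even part. -/
noncomputable def evenMul : S.grade 0 →ₗ[ℂ] S.grade 0 →ₗ[ℂ] S.grade 0 :=
  LinearMap.mk₂ ℂ (fun x y => ⟨S.mul x y, by simpa using S.mul_mem 0 0 x y x.2 y.2⟩)
    (fun _ _ _ => Subtype.ext (by simp)) (fun _ _ _ => Subtype.ext (by simp))
    (fun _ _ _ => Subtype.ext (by simp)) (fun _ _ _ => Subtype.ext (by simp))

variable {S}

theorem coe_evenMul (x y : S.grade 0) : (S.evenMul x y : A) = S.mul x y := rfl

theorem IsJordan.isJordanProduct (h : S.IsJordan) : IsJordanProduct S.evenMul := by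
  constructor
  · intro x y
    ext
    simpa [coe_evenMul, sign_zero] using h.supercomm 0 0 x y x.2 y.2
  · intro x y z t
    ext
    simpa [coe_evenMul, sign_zero] using h.jordan 0 0 0 0 x y z t x.2 y.2 z.2 t.2

theorem IsJordan.mul_odd_even (h : S.IsJordan) {u x : A} (hu : u ∈ S.grade 1) (hx : x ∈ S.grade 0) :
    S.mul u x = S.mul x u := by
  simpa [sign_zero] using h.supercomm 1 0 u x hu hx

theorem IsJordan.mul_odd_self (h : S.IsJordan) {u : A} (hu : u ∈ S.grade 1) : S.mul u u = 0 := by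
  have h1 := h.supercomm 1 1 u u hu hu
  rw [mul_one, sign_one, neg_one_smul] at h1
  have h2 : (2 : ℂ) • S.mul u u = 0 := by linear_combination (norm := module) h1
  exact (smul_eq_zero.1 h2).resolve_left two_ne_zero

/-- A one-dimensional odd part is a one-dimensional module over the even part. -/
theorem IsJordan.exists_action (h : S.IsJordan) (h1 : Module.finrank ℂ (S.grade 1) = 1) :
    ∃ (f : A) (a : S.grade 0 →ₗ[ℂ] ℂ), f ∈ S.grade 1 ∧ f ≠ 0 ∧
      (∀ u ∈ S.grade 1, ∃ c : ℂ, u = c • f) ∧ (∀ x : S.grade 0, S.mul x f = a x • f) ∧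
      IsJordanAction S.evenMul a := by
  obtain ⟨⟨f, hf⟩, hf0, hspan⟩ := finrank_eq_one_iff'.1 h1
  have hf0' : f ≠ 0 := fun h0 => hf0 (Subtype.ext h0)
  have hspan' : ∀ u ∈ S.grade 1, ∃ c : ℂ, u = c • f := by
    intro u hu
    obtain ⟨c, hc⟩ := hspan ⟨u, hu⟩
    exact ⟨c, (congrArg Subtype.val hc).symm⟩
  -- A functional with value 1 at f makes the coefficient of xf visibly linear in x.
  obtain ⟨g, hg⟩ : ∃ g : A →ₗ[ℂ] ℂ, g f = 1 := by
    obtain ⟨g, hg⟩ : ∃ g : Module.Dual ℂ A, g f ≠ 0 := by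
      by_contra! hall
      exact hf0' ((Module.forall_dual_apply_eq_zero_iff ℂ f).1 hall)
    exact ⟨(g f)⁻¹ • g, by simp [hg]⟩
  let a : S.grade 0 →ₗ[ℂ] ℂ := g ∘ₗ S.mul.flip f ∘ₗ (S.grade 0).subtype
  have ha : ∀ x : S.grade 0, S.mul x f = a x • f := by
    intro x
    obtain ⟨c, hc⟩ := hspan' _ (by simpa using S.mul_mem 0 1 x f x.2 hf)
    have : a x = c := by simp [a, hc, hg]
    rw [this, hc]
  refine ⟨f, a, hf, hf0', hspan', ha, fun x y z => ?_⟩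
  -- With the last argument f, the second and third terms of the superidentity both have coefficient
  -- a(x)a(y)a(z), the source of the factor 2.
  have hj := h.jordan 0 0 0 1 x y z f x.2 y.2 z.2 hf
  have hfe : ∀ x : S.grade 0, S.mul f x = a x • f := fun x => by
    rw [h.mul_odd_even hf x.2, ha]
  simp only [mul_zero, zero_mul, add_zero, sign_zero, ha, hfe, map_smul,
    LinearMap.smul_apply, ← coe_evenMul, smul_smul, ← add_smul] at hj
  have := smul_left_injective ℂ hf0' hj
  linear_combination this

theorem Realizes.mul_eq_sum {V : Type*} [AddCommGroup V] [Module ℂ V] {μ : V →ₗ[ℂ] V →ₗ[ℂ] V}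
    (hμ : ∀ x y, μ x y = μ y x) {c : Fin 3 → Fin 3 → Fin 3 → ℂ} (hc : ∀ i j, c i j = c j i)
    {x y z : V} (r : Realizes μ c x y z) (v w : Fin 3 → ℂ) :
    μ (v 0 • x + v 1 • y + v 2 • z) (w 0 • x + w 1 • y + w 2 • z) =
      (∑ i, ∑ j, c i j 0 * (v i * w j)) • x + (∑ i, ∑ j, c i j 1 * (v i * w j)) • y +
        (∑ i, ∑ j, c i j 2 * (v i * w j)) • z := by
  simp only [map_add, map_smul, LinearMap.add_apply, LinearMap.smul_apply, hμ y x, hμ z x, hμ z y,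
    r.mul_xx, r.mul_xy, r.mul_xz, r.mul_yy, r.mul_yz, r.mul_zz, Fin.sum_univ_three, hc 1 0, hc 2 0,
    hc 2 1]
  module

/-- Since ff = 0 and odd elements commute with even ones, the even product and the functional a
determine the whole product. Coordinates in the basis x, y, z, f thus give the isomorphism. -/
theorem isIsomorphic_alg (h : S.IsJordan) {t : Table 3 1} (ht : ∀ i j, t.even i j = t.even j i)
    (h0 : Module.finrank ℂ (S.grade 0) = 3) {f : A} (hf : f ∈ S.grade 1) (hf0 : f ≠ 0)
    (hspan : ∀ u ∈ S.grade 1, ∃ c : ℂ, u = c • f) {a : S.grade 0 →ₗ[ℂ] ℂ}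
    (ha : ∀ x : S.grade 0, S.mul x f = a x • f) {x y z : S.grade 0}
    (r : Realizes S.evenMul t.even x y z) (hx : a x = t.act 0) (hy : a y = t.act 1)
    (hz : a z = t.act 2) : S.IsIsomorphic t.alg := by
  let ε : (Fin 3 → ℂ) →ₗ[ℂ] S.grade 0 :=
    (LinearMap.proj 0).smulRight x + (LinearMap.proj 1).smulRight y + (LinearMap.proj 2).smulRight z
  have hε : ∀ v, ε v = v 0 • x + v 1 • y + v 2 • z := fun v => rfl
  let ψ : (Fin 3 → ℂ) × (Fin 1 → ℂ) →ₗ[ℂ] A :=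
    ((S.grade 0).subtype ∘ₗ ε).coprod ((LinearMap.proj 0).smulRight f)
  have hψ : ∀ v w, ψ (v, w) = (ε v : A) + w 0 • f := fun v w => by simp [ψ]
  have hdisj := Submodule.disjoint_def.1 S.isCompl.disjoint
  have hε0 : ∀ v, ε v = 0 → v = 0 := by
    intro v hv
    obtain ⟨h1, h2, h3⟩ := linearIndependent_triple_iff.1 r.linearIndependent _ _ _ hv
    ext i
    fin_cases i
    exacts [h1, h2, h3]
  have hw0 : ∀ w : Fin 1 → ℂ, w 0 • f = 0 → w = 0 := by
    intro w hw
    ext i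
    rw [Subsingleton.elim i 0]
    exact (smul_eq_zero.1 hw).resolve_right hf0
  have hwf : ∀ w : Fin 1 → ℂ, w 0 • f ∈ S.grade 1 := fun w => Submodule.smul_mem _ _ hf
  have hm0 : ∀ s, ψ s ∈ S.grade 0 ↔ s ∈ t.alg.grade 0 := by
    rintro ⟨v, w⟩
    rw [hψ, mem_grade_zero, Submodule.add_mem_iff_right _ (ε v).2]
    exact ⟨fun h1 => hw0 w (hdisj _ h1 (hwf w)), fun h1 => by simp [show w = 0 from h1]⟩
  have hm1 : ∀ s, ψ s ∈ S.grade 1 ↔ s ∈ t.alg.grade 1 := by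
    rintro ⟨v, w⟩
    rw [hψ, mem_grade_one, Submodule.add_mem_iff_left _ (hwf w)]
    exact ⟨fun h1 => hε0 v (Subtype.ext (hdisj _ (ε v).2 h1)),
      fun h1 => by simp [show v = 0 from h1]⟩
  have hinj : Function.Injective ψ := by
    rw [injective_iff_map_eq_zero]
    intro s hs
    exact Prod.ext ((mem_grade_one t).1 ((hm1 s).1 (hs ▸ Submodule.zero_mem _)))
      ((mem_grade_zero t).1 ((hm0 s).1 (hs ▸ Submodule.zero_mem _)))
  have hsurj : Function.Surjective ψ := by
    intro v
    obtain ⟨u, hu, w, hw, rfl⟩ := Submodule.mem_sup.1 (S.isCompl.sup_eq_top ▸ Submodule.mem_top :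
      v ∈ S.grade 0 ⊔ S.grade 1)
    obtain ⟨c, rfl⟩ := hspan w hw
    obtain ⟨p, q, s, hpqs⟩ := exists_coefficients h0 r.linearIndependent ⟨u, hu⟩
    refine ⟨(![p, q, s], ![c]), ?_⟩
    rw [hψ, hε]
    congr 1
    exact (congrArg Subtype.val hpqs).symm
  have hε_mul : ∀ v w, S.evenMul (ε v) (ε w) = ε (t.evenProduct v w) := by
    intro v w
    rw [hε, hε, hε, r.mul_eq_sum h.isJordanProduct.comm ht]
    simp only [Table.evenProduct_apply]
  have hεa : ∀ v, a (ε v) = t.actForm v := by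
    intro v
    simp only [hε, map_add, map_smul, hx, hy, hz, Table.actForm_apply, Fin.sum_univ_three,
      smul_eq_mul]
    ring
  have hmul : ∀ s s', S.mul (ψ s) (ψ s') = ψ (t.alg.mul s s') := by
    rintro ⟨v, w⟩ ⟨v', w'⟩
    rw [Table.mul_eq, hψ, hψ, hψ, ← hε_mul, coe_evenMul]
    simp only [map_add, map_smul, LinearMap.add_apply, LinearMap.smul_apply, ha,
      h.mul_odd_even hf (ε v').2, h.mul_odd_self hf, hεa, Pi.add_apply, Pi.smul_apply, smul_eq_mul]
    module
  let φ := LinearEquiv.ofBijective ψ ⟨hinj, hsurj⟩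
  refine ⟨φ.symm, fun u v => ?_, fun i u => ?_⟩
  · rw [LinearEquiv.symm_apply_eq]
    change _ = ψ _
    rw [← hmul]
    change _ = S.mul (φ _) (φ _)
    simp
  · obtain ⟨s, rfl⟩ := φ.surjective u
    rw [LinearEquiv.symm_apply_apply]
    rcases zmod_two_cases i with rfl | rfl
    exacts [hm0 s, hm1 s]

theorem IsJordan.exists_isIsomorphic_classified (h : S.IsJordan) (hS : S.HasType 3 1)
    (hne : S.mul ≠ 0) : ∃ i, S.IsIsomorphic (classified i) := by
  obtain ⟨h0, h1⟩ := hS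
  obtain ⟨f, a, hf, hf0, hspan, ha, haction⟩ := h.exists_action h1
  have hJ := h.isJordanProduct
  rcases hJ.isListed_or_eq_zero h0 with hl | hμ
  · obtain ⟨i, x, y, z, r, hx, hy, hz⟩ := haction.isRow hJ hl
    refine ⟨i, isIsomorphic_alg h (fun j k => ?_) h0 hf hf0 hspan ha r hx hy hz⟩
    ext l
    rw [rows_eq]
    simp [IntRow.half, IntTable.half, halfEven, (jordanEven_intRows i).1 j k l]
  -- A zero even product forces a = 0, and as ff = 0 nothing of the product of S remains.
  · refine absurd ?_ hne
    have ha0 := haction.eq_zero hμ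
    have h00 : ∀ x y : S.grade 0, S.mul x y = 0 := fun x y => by
      rw [← coe_evenMul, hμ]
      rfl
    have h01 : ∀ x : S.grade 0, S.mul x f = 0 := fun x => by rw [ha, ha0]; simp
    ext u v
    have htop : ∀ v, v ∈ S.grade 0 ⊔ S.grade 1 := fun v =>
      S.isCompl.sup_eq_top ▸ Submodule.mem_top
    obtain ⟨x, hx, w, hw, rfl⟩ := Submodule.mem_sup.1 (htop u)
    obtain ⟨y, hy, w', hw', rfl⟩ := Submodule.mem_sup.1 (htop v)
    obtain ⟨c, rfl⟩ := hspan w hw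
    obtain ⟨d, rfl⟩ := hspan w' hw'
    simp [h00 ⟨x, hx⟩ ⟨y, hy⟩, h01 ⟨x, hx⟩, h01 ⟨y, hy⟩, h.mul_odd_even hf hy, h.mul_odd_self hf]

end
end Superalgebra

/-! ### The classification theorem -/

theorem mainTheorem5 :
    -- each listed superalgebra is a Jordan superalgebra of type `(3, 1)` with nonzero product
    (∀ i : Fin 59, (Superalgebra.classified i).IsJordan ∧ (Superalgebra.classified i).HasType 3 1 ∧
      (Superalgebra.classified i).mul ≠ 0) ∧
    -- every Jordan superalgebra of type `(3, 1)` with nonzero product is listed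
    (∀ (A : Type*) [AddCommGroup A] [Module ℂ A] (S : Superalgebra A),
      S.IsJordan → S.HasType 3 1 → S.mul ≠ 0 →
        ∃ i : Fin 59, S.IsIsomorphic (Superalgebra.classified i)) ∧
    -- the list has no repetition
    (∀ i j : Fin 59,
      (Superalgebra.classified i).IsIsomorphic (Superalgebra.classified j) → i = j) ∧
    -- the orbit column
    (∀ i : Fin 59, (Superalgebra.rows i).orbit +
      Module.finrank ℂ (Superalgebra.classified i).derivations = 4 ^ 2) ∧
    -- the decomposition column
    (∀ i : Fin 59, (Superalgebra.classified i).IsIsomorphic (Superalgebra.summandSum i) ∧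
      ∀ t ∈ (Superalgebra.rows i).summands, t.table.alg.IsIndecomposable) := by
  exact ⟨fun i => ⟨Superalgebra.isJordan_classified i,
      by rw [Superalgebra.classified_eq]; exact Superalgebra.hasType_alg _,
      Superalgebra.classified_mul_ne_zero i⟩,
    fun A _ _ S h1 h2 h3 => h1.exists_isIsomorphic_classified h2 h3,
    Superalgebra.eq_of_isIsomorphic,
    Superalgebra.orbit_add_finrank_derivations,
    fun i => ⟨Superalgebra.isIsomorphic_summandSum i,
      fun _ ht => Superalgebra.isIndecomposable_of_mem_summands i ht⟩⟩
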